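/- \textbf{Setting.} Let $\mathcal P$ be a finite vocabulary of unary and binary predicates. A \emph{UFO$^2$ sentence} is a function-free and constant-free first-order sentence over $\mathcal P$, with at most two logical variables $x,y$, in prenex normal form with universal quantifiers only, i.e. $\Psi=\forall x\,\forall y\;\psi(x,y)$ with $\psi$ quantifier-free. Let $\Delta=\{1,\dots,n\}$. A possible world $\omega$ assigns a truth value to every ground atom $P(a)$, $R(a,c)$ with $P,R\in\mathcal P$ and $a,c\in\Delta$. Given weights $w,\overline w:\mathcal P\to\mathbb R$, its weight $W(\omega)$ is the product of $w(\mathrm{pred}(\alpha))$ over all ground atoms $\alpha$ true in $\omega$ and of $\overline w(\mathrm{pred}(\alpha))$ over all ground atoms $\alpha$ false in $\omega$. \emph{Closed-world unary evidence} $\mathcal U$ consists of a set $\mathcal P_{\mathcal U}\subseteq\mathcal P$ and a set of ground atoms of predicates in $\mathcal P_{\mathcal U}$, each containing a single element of $\Delta$ (that is, $P(a)$ or $R(a,a)$); a world satisfies $\mathcal U$ if, among all such single-element ground atoms of predicates in $\mathcal P_{\mathcal U}$, exactly the listed ones are true. \emph{Closed-world binary evidence} $\mathcal E$ consists of a set $\mathcal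 P_{\mathcal E}\subseteq\mathcal P$ and a set of ground atoms $R(a,c)$ with $R\in\mathcal P_{\mathcal E}$ and $a\neq c$; a world satisfies $\mathcal E$ if, among all ground atoms $R(a,c)$ with $R\in\mathcal P_{\mathcal E}$ and $a\ne c$, exactly the listed ones are true. The \emph{Gaifman graph} of $\mathcal E$ has vertex set $\Delta$ and an edge between $a\ne c$ if and only if $\mathcal E$ lists $R(a,c)$ or $R(c,a)$ for some $R$. Put $$\mathrm{WFOMC}(\Psi\wedge\mathcal U\wedge\mathcal E,\Delta,w,\overline w)=\sum_{\omega\models\Psi\wedge\mathcal U\wedge\mathcal E}W(\omega).$$ \textbf{Theorem.} UFO$^2$ with closed-world unary evidence and bounded-treewidth closed-world binary evidence is domain-liftable: for every UFO$^2$ sentence $\Psi$ and every $k\in\mathbb N$ there are an algorithm and a polynomial $T$, both depending only on $\mathcal P$, $\Psi$ and $k$, such that for every $n$, all weights $w,\overline w:\mathcal P\to\mathbb R$, every closed-world unary evidence $\mathcal U$ and every closed-world binary evidence $\mathcal E$ over $\Delta$ whose Gaifman graph has treewidth at most $k$, the algorithm, on input $(n,\mathcal U,\mathcal E,w,\overline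 w)$, outputs $\mathrm{WFOMC}(\Psi\wedge\mathcal U\wedge\mathcal E,\Delta,w,\overline w)$ after at most $T(n)$ steps. Algorithms are programs of a random access machine whose elementary steps are: reading an input cell; assigning constants to, copying, adding, subtracting (truncated at $0$) and comparing natural numbers, with indirect addressing; and assigning integer constants to, copying, adding, subtracting and multiplying real numbers. There are no tests on real numbers. The evidence is given by one bit per predicate for each of $\mathcal P_{\mathcal U}$ and $\mathcal P_{\mathcal E}$ and one bit per ground atom; no tree decomposition is given. -/

import Mathlib

namespace WFOMC

/-! ## Vocabularies, two-variable formulas, possible worlds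

A vocabulary consists of `u` unary and `b` binary predicates. The domain of size `n` is `Fin n`. -/

/-- Predicates: `u` unary ones and `b` binary ones. -/
abbrev Pred (u b : ℕ) : Type := Fin u ⊕ Fin b

/-- Ground atoms `P(a)` and `R(a, c)` over the domain `Fin n`. -/
abbrev GroundAtom (u b n : ℕ) : Type := (Fin u × Fin n) ⊕ (Fin b × Fin n × Fin n)

/-- The predicate of a ground atom. -/
def GroundAtom.pred {u b n : ℕ} (α : GroundAtom u b n) : Pred u b :=
  Sum.map Prod.fst Prod.fst α

/-- The set of domain elements that occur in a ground atom. -/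
def GroundAtom.elements {u b n : ℕ} (α : GroundAtom u b n) : Finset (Fin n) :=
  Sum.elim (fun q => {q.2}) (fun q => {q.2.1, q.2.2}) α

/-- A possible world gives every ground atom a truth value. -/
abbrev World (u b n : ℕ) : Type := GroundAtom u b n → Bool

/-- First-order formulas with the two logical variables `0` and `1` (that is, `x` and `y`). -/
inductive Formula (u b : ℕ) : Type
  | unary (P : Fin u) (s : Fin 2) : Formula u b
  | binary (R : Fin b) (s t : Fin 2) : Formula u b
  | not (φ : Formula u b) : Formula u b
  | and (φ ψ : Formula u b) : Formula u b
  | or (φ ψ : Formula u b) : Formula u b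
  | all (i : Fin 2) (φ : Formula u b) : Formula u b
  | ex (i : Fin 2) (φ : Formula u b) : Formula u b

namespace Formula

/-- Truth of a formula in a world under an assignment of the two variables. -/
def Realize {u b n : ℕ} (ω : World u b n) : Formula u b → (Fin 2 → Fin n) → Prop
  | unary P s, v => ω (Sum.inl (P, v s)) = true
  | binary R s t, v => ω (Sum.inr (R, v s, v t)) = true
  | not φ, v => ¬ φ.Realize ω v
  | and φ ψ, v => φ.Realize ω v ∧ ψ.Realize ω v
  | or φ ψ, v => φ.Realize ω v ∨ ψ.Realize ω v
  | all i φ, v => ∀ a : Fin n, φ.Realize ω (Function.update v i a)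
  | ex i φ, v => ∃ a : Fin n, φ.Realize ω (Function.update v i a)

/-- The free variables of a formula. -/
def freeVars {u b : ℕ} : Formula u b → Finset (Fin 2)
  | unary _ s => {s}
  | binary _ s t => {s, t}
  | not φ => φ.freeVars
  | and φ ψ => φ.freeVars ∪ ψ.freeVars
  | or φ ψ => φ.freeVars ∪ ψ.freeVars
  | all i φ => φ.freeVars.erase i
  | ex i φ => φ.freeVars.erase i

/-- Quantifier-free formulas. -/
def IsQuantifierFree {u b : ℕ} : Formula u b → Prop
  | unary _ _ => True
  | binary _ _ _ => True
  | not φ => φ.IsQuantifierFree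
  | and φ ψ => φ.IsQuantifierFree ∧ ψ.IsQuantifierFree
  | or φ ψ => φ.IsQuantifierFree ∧ ψ.IsQuantifierFree
  | all _ _ => False
  | ex _ _ => False

/-- Formulas in prenex normal form all of whose quantifiers are universal. -/
inductive IsPrenexUniversal {u b : ℕ} : Formula u b → Prop
  | of_quantifierFree {φ : Formula u b} (h : φ.IsQuantifierFree) : IsPrenexUniversal φ
  | all (i : Fin 2) {φ : Formula u b} (h : IsPrenexUniversal φ) : IsPrenexUniversal (φ.all i)

/-- The universally quantified two-variable fragment: sentences in prenex normal form with
universal quantifiers only, such as `∀ x, ∀ y, ψ(x, y)` with `ψ` quantifier-free. -/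
def IsUFO2 {u b : ℕ} (φ : Formula u b) : Prop :=
  φ.freeVars = ∅ ∧ φ.IsPrenexUniversal

/-- The world `ω` is a model of the sentence `φ`. The truth value of a sentence does not depend on
the assignment; over the empty domain (no assignments) a universal sentence is true. -/
def Models {u b n : ℕ} (ω : World u b n) (φ : Formula u b) : Prop :=
  ∀ v : Fin 2 → Fin n, φ.Realize ω v

end Formula

/-! ## Closed-world evidence -/

/-- Closed-world unary evidence for the predicates in `preds`: a set of ground atoms, formed from
these predicates, each of which contains a single domain element (`P(a)` or `R(a, a)`). -/
structure UnaryEvidence (u b n : ℕ) where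
  preds : Finset (Pred u b)
  atoms : Finset (GroundAtom u b n)
  pred_mem : ∀ α ∈ atoms, α.pred ∈ preds
  card_elements : ∀ α ∈ atoms, α.elements.card = 1

/-- Closed-world binary evidence for the predicates in `preds`: a set of ground atoms, formed from
these predicates, each of which contains two distinct domain elements (`R(a, c)` with `a ≠ c`). -/
structure BinaryEvidence (u b n : ℕ) where
  preds : Finset (Pred u b)
  atoms : Finset (GroundAtom u b n)
  pred_mem : ∀ α ∈ atoms, α.pred ∈ preds
  card_elements : ∀ α ∈ atoms, α.elements.card = 2

/-- Among the single-element ground atoms of the predicates in `preds`, exactly those in `atoms`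
are true. -/
def UnaryEvidence.Holds {u b n : ℕ} (U : UnaryEvidence u b n) (ω : World u b n) : Prop :=
  ∀ α : GroundAtom u b n, α.elements.card = 1 → α.pred ∈ U.preds → (ω α = true ↔ α ∈ U.atoms)

/-- Among the ground atoms of the predicates in `preds` that contain two distinct elements, exactly
those in `atoms` are true. -/
def BinaryEvidence.Holds {u b n : ℕ} (E : BinaryEvidence u b n) (ω : World u b n) : Prop :=
  ∀ α : GroundAtom u b n, α.elements.card = 2 → α.pred ∈ E.preds → (ω α = true ↔ α ∈ E.atoms)

/-- The Gaifman graph of closed-world binary evidence. -/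
def BinaryEvidence.gaifmanGraph {u b n : ℕ} (E : BinaryEvidence u b n) : SimpleGraph (Fin n) where
  Adj a c := a ≠ c ∧ ∃ R : Fin b,
    (Sum.inr (R, a, c) : GroundAtom u b n) ∈ E.atoms ∨
      (Sum.inr (R, c, a) : GroundAtom u b n) ∈ E.atoms
  symm := ⟨fun _ _ h => ⟨h.1.symm, h.2.imp fun _ hR => hR.symm⟩⟩
  loopless := ⟨fun _ h => h.1 rfl⟩

/-! ## Treewidth -/

/-- `bag` makes the tree `T` a tree decomposition of `G`. -/
structure IsTreeDecomposition {V I : Type} (G : SimpleGraph V) (T : SimpleGraph I)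
    (bag : I → Finset V) : Prop where
  isTree : T.IsTree
  cover : ∀ a : V, ∃ i, a ∈ bag i
  edge : ∀ a c : V, G.Adj a c → ∃ i, a ∈ bag i ∧ c ∈ bag i
  connected : ∀ a : V, (T.induce {i | a ∈ bag i}).Connected

/-- The treewidth of `G` is at most `k`: there is a finite tree decomposition of `G` all of whose
bags have at most `k + 1` elements. -/
def TreewidthAtMost {V : Type} (G : SimpleGraph V) (k : ℕ) : Prop :=
  ∃ (m : ℕ) (T : SimpleGraph (Fin m)) (bag : Fin m → Finset V),
    IsTreeDecomposition G T bag ∧ ∀ i, (bag i).card ≤ k + 1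

/-! ## Weighted first-order model counting -/

/-- The weight of a world: the product, over all ground atoms, of `w` of the predicate if the atom
is true and of `wbar` of the predicate if it is false. -/
def weight {u b n : ℕ} (w wbar : Pred u b → ℝ) (ω : World u b n) : ℝ :=
  ∏ α : GroundAtom u b n, if ω α = true then w α.pred else wbar α.pred

open Classical in
/-- The weighted first-order model count of `φ` conditioned on `U` and `E`: the sum of the weights
of all models of `φ ∧ U ∧ E` over the domain `Fin n`. -/
noncomputable def wfomc {u b n : ℕ} (φ : Formula u b) (U : UnaryEvidence u b n)
    (E : BinaryEvidence u b n) (w wbar : Pred u b → ℝ) : ℝ :=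
  ∑ ω : World u b n, if φ.Models ω ∧ U.Holds ω ∧ E.Holds ω then weight w wbar ω else 0

/-! ## The machine model

A random access machine with a read-only input (a list of natural numbers and a list of real
numbers), an unbounded memory `idx` of natural numbers, used for control and addressing, and an
unbounded memory `val` of real numbers. Programs are finite structured programs.
Natural numbers can be added, subtracted and compared (there is no unit-cost multiplication of
natural numbers). Real numbers can only be added, subtracted, multiplied and copied: there are no
tests, roundings or real constants by which information could be extracted from them. Every
instruction and every test costs one step. -/

/-- The read-only input. -/
structure Input where
  words : List ℕ
  values : List ℝ

/-- Memory contents. -/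
structure State where
  idx : ℕ → ℕ
  val : ℕ → ℝ

/-- Programs. -/
inductive Prog : Type
  | skip : Prog
  /-- `idx[i] := words[idx[j]]`, the input word with number `idx[j]` (`0` beyond the end) -/
  | read (i j : ℕ) : Prog
  /-- `val[i] := values[idx[j]]`, the input value with number `idx[j]` (`0` beyond the end) -/
  | vread (i j : ℕ) : Prog
  /-- `idx[i] := c` -/
  | const (i c : ℕ) : Prog
  /-- `idx[i] := idx[j] + idx[l]` -/
  | add (i j l : ℕ) : Prog
  /-- `idx[i] := max (idx[j] - idx[l]) 0` -/
  | sub (i j l : ℕ) : Prog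
  /-- `idx[i] := idx[idx[j]]` -/
  | load (i j : ℕ) : Prog
  /-- `idx[idx[i]] := idx[j]` -/
  | store (i j : ℕ) : Prog
  /-- `val[i] := c` -/
  | vconst (i : ℕ) (c : ℤ) : Prog
  /-- `val[i] := val[j] + val[l]` -/
  | vadd (i j l : ℕ) : Prog
  /-- `val[i] := val[j] - val[l]` -/
  | vsub (i j l : ℕ) : Prog
  /-- `val[i] := val[j] * val[l]` -/
  | vmul (i j l : ℕ) : Prog
  /-- `val[i] := val[idx[j]]` -/
  | vload (i j : ℕ) : Prog
  /-- `val[idx[i]] := val[j]` -/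
  | vstore (i j : ℕ) : Prog
  /-- run `p`, then `q` -/
  | seq (p q : Prog) : Prog
  /-- if `idx[i] ≤ idx[j]` then run `p`, else run `q` -/
  | ifLE (i j : ℕ) (p q : Prog) : Prog
  /-- as long as `idx[i] < idx[j]`, run `p` -/
  | whileLT (i j : ℕ) (p : Prog) : Prog

namespace State

/-- The initial memory: all cells are zero. -/
def zero : State := { idx := fun _ => 0, val := fun _ => 0 }

/-- Overwrite one cell of the memory of natural numbers. -/
def setIdx (s : State) (i c : ℕ) : State := { s with idx := Function.update s.idx i c }

/-- Overwrite one cell of the memory of real numbers. -/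
def setVal (s : State) (i : ℕ) (c : ℝ) : State := { s with val := Function.update s.val i c }

end State

/-- `Exec x p s t s'`: on the input `x`, the program `p`, started in the state `s`, halts after
exactly `t` steps in the state `s'`. -/
inductive Exec (x : Input) : Prog → State → ℕ → State → Prop
  | skip (s : State) : Exec x .skip s 1 s
  | read (i j : ℕ) (s : State) : Exec x (.read i j) s 1 (s.setIdx i (x.words.getD (s.idx j) 0))
  | vread (i j : ℕ) (s : State) : Exec x (.vread i j) s 1 (s.setVal i (x.values.getD (s.idx j) 0))
  | const (i c : ℕ) (s : State) : Exec x (.const i c) s 1 (s.setIdx i c)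
  | add (i j l : ℕ) (s : State) : Exec x (.add i j l) s 1 (s.setIdx i (s.idx j + s.idx l))
  | sub (i j l : ℕ) (s : State) : Exec x (.sub i j l) s 1 (s.setIdx i (s.idx j - s.idx l))
  | load (i j : ℕ) (s : State) : Exec x (.load i j) s 1 (s.setIdx i (s.idx (s.idx j)))
  | store (i j : ℕ) (s : State) : Exec x (.store i j) s 1 (s.setIdx (s.idx i) (s.idx j))
  | vconst (i : ℕ) (c : ℤ) (s : State) : Exec x (.vconst i c) s 1 (s.setVal i (c : ℝ))
  | vadd (i j l : ℕ) (s : State) : Exec x (.vadd i j l) s 1 (s.setVal i (s.val j + s.val l))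
  | vsub (i j l : ℕ) (s : State) : Exec x (.vsub i j l) s 1 (s.setVal i (s.val j - s.val l))
  | vmul (i j l : ℕ) (s : State) : Exec x (.vmul i j l) s 1 (s.setVal i (s.val j * s.val l))
  | vload (i j : ℕ) (s : State) : Exec x (.vload i j) s 1 (s.setVal i (s.val (s.idx j)))
  | vstore (i j : ℕ) (s : State) : Exec x (.vstore i j) s 1 (s.setVal (s.idx i) (s.val j))
  | seq {p q : Prog} {s s' s'' : State} {t t' : ℕ} (hp : Exec x p s t s') (hq : Exec x q s' t' s'') :
      Exec x (.seq p q) s (t + t') s''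
  | ifLE_true {i j : ℕ} {p q : Prog} {s s' : State} {t : ℕ} (h : s.idx i ≤ s.idx j)
      (hp : Exec x p s t s') : Exec x (.ifLE i j p q) s (t + 1) s'
  | ifLE_false {i j : ℕ} {p q : Prog} {s s' : State} {t : ℕ} (h : ¬ s.idx i ≤ s.idx j)
      (hq : Exec x q s t s') : Exec x (.ifLE i j p q) s (t + 1) s'
  | while_done {i j : ℕ} {p : Prog} {s : State} (h : ¬ s.idx i < s.idx j) :
      Exec x (.whileLT i j p) s 1 s
  | while_step {i j : ℕ} {p : Prog} {s s' s'' : State} {t t' : ℕ} (h : s.idx i < s.idx j)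
      (hp : Exec x p s t s') (hw : Exec x (.whileLT i j p) s' t' s'') :
      Exec x (.whileLT i j p) s (t + t' + 1) s''

/-- The machine is deterministic: the running time and the final state are determined by the
program, the input and the initial state. -/
theorem Exec.deterministic {x : Input} {p : Prog} {s s₁ s₂ : State} {t₁ t₂ : ℕ}
    (h₁ : Exec x p s t₁ s₁) (h₂ : Exec x p s t₂ s₂) : t₁ = t₂ ∧ s₁ = s₂ := by
  induction h₁ generalizing t₂ s₂ with
  | seq _ _ ihp ihq =>
    cases h₂ with
    | seq hp hq =>
      obtain ⟨rfl, rfl⟩ := ihp hp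
      obtain ⟨rfl, rfl⟩ := ihq hq
      exact ⟨rfl, rfl⟩
  | ifLE_true h _ ih =>
    cases h₂ with
    | ifLE_true _ hp => obtain ⟨rfl, rfl⟩ := ih hp; exact ⟨rfl, rfl⟩
    | ifLE_false h' _ => exact absurd h h'
  | ifLE_false h _ ih =>
    cases h₂ with
    | ifLE_true h' _ => exact absurd h' h
    | ifLE_false _ hq => obtain ⟨rfl, rfl⟩ := ih hq; exact ⟨rfl, rfl⟩
  | while_done h =>
    cases h₂ with
    | while_done _ => exact ⟨rfl, rfl⟩
    | while_step h' _ _ => exact absurd h' h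
  | while_step h _ _ ihp ihw =>
    cases h₂ with
    | while_done h' => exact absurd h h'
    | while_step _ hp hw =>
      obtain ⟨rfl, rfl⟩ := ihp hp
      obtain ⟨rfl, rfl⟩ := ihw hw
      exact ⟨rfl, rfl⟩
  | _ => cases h₂; exact ⟨rfl, rfl⟩

/-- The list of all predicates, unary ones first. -/
def allPreds (u b : ℕ) : List (Pred u b) :=
  (List.finRange u).map Sum.inl ++ (List.finRange b).map Sum.inr

/-- The list of all ground atoms, in lexicographic order, those of unary predicates first. -/
def allAtoms (u b n : ℕ) : List (GroundAtom u b n) :=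
  ((List.finRange u).flatMap fun P => (List.finRange n).map fun a => Sum.inl (P, a)) ++
  ((List.finRange b).flatMap fun R => (List.finRange n).flatMap fun a =>
    (List.finRange n).map fun c => Sum.inr (R, a, c))

/-- The discrete part of the input: the domain size `n`; one bit per predicate that tells whether
the unary evidence specifies it; one bit per predicate that tells whether the binary evidence
specifies it; and one bit per ground atom that tells whether the atom belongs to the evidence. -/
def inputWords {u b n : ℕ} (U : UnaryEvidence u b n) (E : BinaryEvidence u b n) : List ℕ :=
  n :: ((allPreds u b).map (fun p => if p ∈ U.preds then 1 else 0) ++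
    (allPreds u b).map (fun p => if p ∈ E.preds then 1 else 0) ++
    (allAtoms u b n).map (fun α => if α ∈ U.atoms ∨ α ∈ E.atoms then 1 else 0))

/-- The real part of the input: the weights `w` and then the weights `wbar` of all predicates. -/
def inputValues {u b : ℕ} (w wbar : Pred u b → ℝ) : List ℝ :=
  (allPreds u b).map w ++ (allPreds u b).map wbar

/-- Started on the input `(n, U, E, w, wbar)` with empty memory, the program `p` halts within `T`
steps with `r` in the cell `val[0]`. -/
def OutputsWithin {u b n : ℕ} (p : Prog) (U : UnaryEvidence u b n) (E : BinaryEvidence u b n)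
    (w wbar : Pred u b → ℝ) (r : ℝ) (T : ℕ) : Prop :=
  ∃ (t : ℕ) (s : State),
    Exec ⟨inputWords U E, inputValues w wbar⟩ p State.zero t s ∧ t ≤ T ∧ s.val 0 = r

end WFOMC

/-!
The *type* of a domain element `a` in a world is the list of truth values of the ground atoms that
contain `a` only, and the *table* of a pair of elements is the list of truth values of the atoms
that contain both. A sentence `∀ x y, ψ(x, y)` constrains one element, or one pair of elements, at
a time, and so does the evidence. Hence the model count is a sum over the assignments `τ` of types
to the elements, where each element contributes a weight that depends on its type, and each pair of
elements a weight that depends on its two types and on the evidence between them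
(`wfomc_eq_sum_types`).

For the pairs that are not joined in the Gaifman graph the weight only depends on the types, so that
these pairs enter through numbers: the number of all pairs with given types, which is determined by
the numbers of elements of each type, minus the number of edges with these types. One variable is
introduced for each type and one for each pair of types, as a marker of the elements and of the
edges. The marked partition function of the Gaifman graph is a polynomial in a bounded number of
variables, with exponents at most `n ^ 2`, and its coefficients determine the model count
(`sum_types_eq_sum_coeff`, `wfomc_eq_sum_coeff`).

No tree decomposition is given, and none is constructed. The partition function is computed by
recursion over pairs `(S, C)`, where `S` is a tuple of `k + 1` vertices and `C` is a component of
the graph without `S`, for fixed types of the vertices of `S`: a vertex of `C` takes the place of a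
vertex of `S` that has no neighbours in `C`, or that occurs in `S` twice, one sums over the type of
the new vertex, and the rest of `C` falls apart into components of the graph without the new tuple
(`roundValue_eq`). There are polynomially many such pairs, and one finds out by exhaustion for which
of them there is a replacement that leads to solvable pairs. If the graph has a tree decomposition
of width `k`, all pairs are solvable such that the neighbours of `C` lie in one bag
(`solvable_of_isTreeDecomposition`): the bags that meet `C` form a subtree, the node where it is
entered from the given bag still contains all neighbours of `C`, and also contains some vertex of
`C` (`exists_gate`, `IsTreeDecomposition.exists_bag`). The recursion starts with the tuple in which
a single vertex is repeated.

The machine is dealt with by a calculus of computable functions. `Computes f` says that the value of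
`f` can be computed within polynomial time in all contexts of a given kind, where a context consists
of the input and of variables and tables kept in memory. This property is closed under arithmetic,
case distinctions, sums, products and quantifiers over index types of polynomial size, and under
recursion by rounds over tables (`Computes.fold`, `Computes.iterateIn`, `ComputesPoly.iterate`). The
formula for the model count is composed of these operations (`computes_count`).
-/


namespace WFOMC

/-! ### Running programs -/

/-- Started in `s` on the input `x`, the program `p` halts after at most `T` steps in a state that
satisfies `Q`. -/
def Run (x : Input) (p : Prog) (s : State) (T : ℕ) (Q : State → Prop) : Prop :=
  ∃ t s', Exec x p s t s' ∧ t ≤ T ∧ Q s'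

theorem Run.of_exec {x : Input} {p : Prog} {s s' : State} {t : ℕ} {Q : State → Prop}
    (h : Exec x p s t s') (hQ : Q s') : Run x p s t Q :=
  ⟨t, s', h, le_rfl, hQ⟩

theorem Run.mono {x : Input} {p : Prog} {s : State} {T T' : ℕ} {Q Q' : State → Prop}
    (h : Run x p s T Q) (hT : T ≤ T') (hQ : ∀ s', Q s' → Q' s') : Run x p s T' Q' := by
  obtain ⟨t, s', h1, h2, h3⟩ := h
  exact ⟨t, s', h1, h2.trans hT, hQ _ h3⟩

theorem Run.seq {x : Input} {p q : Prog} {s : State} {T T' : ℕ} {Q R : State → Prop}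
    (hp : Run x p s T Q) (hq : ∀ s', Q s' → Run x q s' T' R) :
    Run x (.seq p q) s (T + T') R := by
  obtain ⟨t, s', h1, h2, h3⟩ := hp
  obtain ⟨t', s'', h4, h5, h6⟩ := hq _ h3
  exact ⟨_, _, .seq h1 h4, Nat.add_le_add h2 h5, h6⟩

/-- The rule for counting loops with an invariant `I`. The body has to increment the counter. -/
theorem Run.forLoop {x : Input} {body : Prog} {s : State} {ri rN N T : ℕ} (I : ℕ → State → Prop)
    (h0 : I 0 s) (hcnt : ∀ i s, I i s → s.idx ri = i ∧ s.idx rN = N)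
    (hbody : ∀ i < N, ∀ s, I i s → Run x body s T (I (i + 1))) :
    Run x (.whileLT ri rN body) s (N * (T + 1) + 1) (I N) := by
  have key : ∀ d i s, i + d = N → I i s →
      Run x (.whileLT ri rN body) s (d * (T + 1) + 1) (I N) := by
    intro d
    induction d with
    | zero =>
      intro i s hi h
      obtain ⟨h1, h2⟩ := hcnt i s h
      obtain rfl : i = N := by simpa using hi
      exact (Run.of_exec (.while_done (by omega)) h).mono (by simp) fun _ h => h
    | succ d ih =>
      intro i s hi h
      obtain ⟨h1, h2⟩ := hcnt i s h
      obtain ⟨t, s', e1, l1, q1⟩ := hbody i (by omega) s h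
      obtain ⟨t', s'', e2, l2, q2⟩ := ih (i + 1) s' (by omega) q1
      refine ⟨_, _, .while_step (by omega) e1 e2, ?_, q2⟩
      rw [Nat.succ_mul]
      omega
  exact key N 0 s (by simp) h0

/-! ### Memory layout

The memory is divided into slots: for a number `J` that is larger than all slot numbers in use,
cell `i` of slot `a` has the address `i * J + a`. A variable occupies cell `0` of its slot, a table
occupies a whole slot. -/

/-- The slots with numbers below `p` have the same contents in the two states. -/
def AgreeBelow (J p : ℕ) (s s' : State) : Prop :=
  ∀ a, a % J < p → s'.idx a = s.idx a ∧ s'.val a = s.val a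

theorem AgreeBelow.refl (J p : ℕ) (s : State) : AgreeBelow J p s s := fun _ _ => ⟨rfl, rfl⟩

theorem AgreeBelow.trans {J p : ℕ} {s s' s'' : State} (h : AgreeBelow J p s s')
    (h' : AgreeBelow J p s' s'') : AgreeBelow J p s s'' := fun a ha =>
  ⟨(h' a ha).1.trans (h a ha).1, (h' a ha).2.trans (h a ha).2⟩

theorem AgreeBelow.mono {J p q : ℕ} {s s' : State} (h : AgreeBelow J q s s') (hpq : p ≤ q) :
    AgreeBelow J p s s' := fun a ha => h a (ha.trans_le hpq)

theorem AgreeBelow.setIdx {J p : ℕ} {s s' : State} (h : AgreeBelow J p s s') {i c : ℕ}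
    (hi : p ≤ i % J) : AgreeBelow J p s (s'.setIdx i c) := fun a ha => by
  refine ⟨?_, (h a ha).2⟩
  have : a ≠ i := by rintro rfl; omega
  simpa [State.setIdx, this] using (h a ha).1

@[simp] theorem State.idx_setIdx_self (s : State) (i c : ℕ) : (s.setIdx i c).idx i = c := by
  simp [State.setIdx]

theorem State.idx_setIdx_ne (s : State) {i a : ℕ} (c : ℕ) (h : a ≠ i) :
    (s.setIdx i c).idx a = s.idx a := by
  simp [State.setIdx, h]

@[simp] theorem State.val_setIdx (s : State) (i c : ℕ) : (s.setIdx i c).val = s.val := rfl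

/-- The two kinds of memory cells, for natural and for real numbers, with the instructions that
treat them alike. -/
class Cell (α : Type) where
  get : State → ℕ → α
  set : State → ℕ → α → State
  load : ℕ → ℕ → Prog
  store : ℕ → ℕ → Prog
  get_set : ∀ s i c, get (set s i c) i = c
  get_congr : ∀ s s' a, s'.idx a = s.idx a → s'.val a = s.val a → get s' a = get s a
  idx_set_ne : ∀ s i c a, a ≠ i → (set s i c).idx a = s.idx a
  val_set_ne : ∀ s i c a, a ≠ i → (set s i c).val a = s.val a
  exec_load : ∀ x s i j, Exec x (load i j) s 1 (set s i (get s (s.idx j)))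
  exec_store : ∀ x s i j, Exec x (store i j) s 1 (set s (s.idx i) (get s j))

instance : Cell ℕ where
  get s i := s.idx i
  set s i c := s.setIdx i c
  load := .load
  store := .store
  get_set := by simp
  get_congr _ _ _ h _ := h
  idx_set_ne s i c a h := s.idx_setIdx_ne c h
  val_set_ne _ _ _ _ _ := rfl
  exec_load x s i j := .load i j s
  exec_store x s i j := .store i j s

instance : Cell ℝ where
  get s i := s.val i
  set s i c := s.setVal i c
  load := .vload
  store := .vstore
  get_set := by simp [State.setVal]
  get_congr _ _ _ _ h := h
  idx_set_ne _ _ _ _ _ := rfl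
  val_set_ne s i c a h := by simp [State.setVal, h]
  exec_load x s i j := .vload i j s
  exec_store x s i j := .vstore i j s

section Cell
variable {α : Type} [Cell α]

theorem AgreeBelow.set {J p : ℕ} {s s' : State} (h : AgreeBelow J p s s') {i : ℕ} {c : α}
    (hi : p ≤ i % J) : AgreeBelow J p s (Cell.set s' i c) := fun a ha => by
  have hne : a ≠ i := by rintro rfl; omega
  rw [Cell.idx_set_ne _ _ _ _ hne, Cell.val_set_ne _ _ _ _ hne]
  exact h a ha

theorem AgreeBelow.get {J p : ℕ} {s s' : State} (h : AgreeBelow J p s s') {a : ℕ}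
    (ha : a % J < p) : (Cell.get s' a : α) = Cell.get s a :=
  Cell.get_congr _ _ _ (h a ha).1 (h a ha).2

theorem Cell.get_set_ne (s : State) {i a : ℕ} (c : α) (h : a ≠ i) :
    (Cell.get (Cell.set s i c) a : α) = Cell.get s a :=
  Cell.get_congr _ _ _ (Cell.idx_set_ne _ _ _ _ h) (Cell.val_set_ne _ _ _ _ h)

theorem Cell.get_setIdx_ne (s : State) {i a : ℕ} (c : ℕ) (h : a ≠ i) :
    (Cell.get (s.setIdx i c) a : α) = Cell.get s a :=
  Cell.get_congr _ _ _ (s.idx_setIdx_ne c h) rfl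

end Cell

/-- `idx[i] := idx[i] + m * idx[j]` -/
def addMul (i j : ℕ) : ℕ → Prog
  | 0 => .skip
  | m + 1 => .seq (addMul i j m) (.add i i j)

theorem exec_addMul (x : Input) {i j : ℕ} (hij : i ≠ j) (s : State) (m : ℕ) :
    Exec x (addMul i j m) s (m + 1) (s.setIdx i (s.idx i + m * s.idx j)) := by
  induction m with
  | zero =>
    have : s.setIdx i (s.idx i + 0 * s.idx j) = s := by simp [State.setIdx]
    rw [this]; exact .skip s
  | succ m ih =>
    refine .seq ih ?_
    have := Exec.add (x := x) i i j (s.setIdx i (s.idx i + m * s.idx j))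
    rw [State.idx_setIdx_self, State.idx_setIdx_ne _ _ hij.symm] at this
    convert this using 1
    simp only [State.setIdx, Function.update_idem, Nat.succ_mul, add_assoc]

/-- Put the address of cell `idx[j]` of slot `a` into `idx[i]`. -/
def addressOf (J i j a : ℕ) : Prog := .seq (.const i a) (addMul i j J)

theorem exec_addressOf (x : Input) (J : ℕ) {i j : ℕ} (a : ℕ) (hij : i ≠ j) (s : State) :
    Exec x (addressOf J i j a) s (J + 2) (s.setIdx i (s.idx j * J + a)) := by
  have h := exec_addMul x hij (s.setIdx i a) J
  rw [State.idx_setIdx_self, State.idx_setIdx_ne _ _ hij.symm] at h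
  have h2 := Exec.seq (.const i a s) h
  have e1 : 1 + (J + 1) = J + 2 := by ring
  have e2 : (s.setIdx i a).setIdx i (a + J * s.idx j) = s.setIdx i (s.idx j * J + a) := by
    simp only [State.setIdx, Function.update_idem, add_comm, mul_comm]
  rwa [e1, e2] at h2

/-! ### Computable functions of a context -/

/-- A type of contexts: an element `γ` comprises an input and the values of finitely many variables
and tables. The entry with number `k`, counted from the innermost one, is kept in slot `sl k`;
`Holds J sl γ s` says that the memory `s` contains these values. -/
class Ctx (Γ : Type) where
  input : Γ → Input
  Holds : ℕ → (ℕ → ℕ) → Γ → State → Prop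
  holds_of_agree : ∀ {J p : ℕ} {sl : ℕ → ℕ} {γ : Γ} {s s' : State}, (∀ k, sl k < p) → p ≤ J →
    AgreeBelow J p s s' → Holds J sl γ s → Holds J sl γ s'

/-- The size of the input of a context: the first input word, the number of domain elements. -/
def Ctx.size {Γ : Type} [Ctx Γ] (γ : Γ) : ℕ := (Ctx.input γ).words.getD 0 0

/-- The function `f` of a context can be computed within polynomial time: for all slots given to the
entries of the context below a slot `p`, there is a program that leaves the slots below `p`
unchanged and puts the value of `f` into slot `p`. The number `m` bounds the number of auxiliary
slots above `p`. The number `J` of all slots is known in advance: the program and its running time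
may depend on it. -/
def Computes {Γ α : Type} [Ctx Γ] [Cell α] (f : Γ → α) : Prop :=
  ∃ m : ℕ, ∀ (J p : ℕ) (sl : ℕ → ℕ), (∀ k, sl k < p) → p + m < J →
    ∃ (P : Prog) (T : Polynomial ℕ), ∀ (γ : Γ) (s : State), Ctx.Holds J sl γ s →
      Run (Ctx.input γ) P s (T.eval (Ctx.size γ))
        fun s' => Cell.get s' p = f γ ∧ AgreeBelow J p s s'

section Basic
variable {Γ α : Type} [Ctx Γ] [Cell α]

theorem Computes.congr {f g : Γ → α} (hf : Computes f) (h : ∀ γ, f γ = g γ) : Computes g := by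
  obtain rfl : f = g := funext h
  exact hf

/-- Constants that a single instruction can produce. -/
theorem Computes.of_instr (f : Γ → α) (P : ℕ → Prog)
    (hP : ∀ γ s i, Exec (Ctx.input γ) (P i) s 1 (Cell.set s i (f γ))) : Computes f := by
  refine ⟨0, fun J p sl hsl hp => ⟨P p, 1, fun γ s _ => ?_⟩⟩
  refine (Run.of_exec (hP γ s p) ⟨Cell.get_set _ _ _, (AgreeBelow.refl J p s).set ?_⟩).mono
    (by simp) fun _ h => h
  rw [Nat.mod_eq_of_lt (by omega)]

theorem Computes.nat (c : ℕ) : Computes (fun _ : Γ => c) :=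
  .of_instr _ (fun i => .const i c) fun _ s i => .const i c s

theorem Computes.int (c : ℤ) : Computes (fun _ : Γ => (c : ℝ)) :=
  .of_instr _ (fun i => .vconst i c) fun _ s i => .vconst i c s

/-- Instructions that fetch a value which is addressed by a natural number. -/
theorem Computes.fetch {f : Γ → ℕ} (hf : Computes f) (g : Γ → ℕ → α) (P : ℕ → ℕ → Prog)
    (hP : ∀ γ s i j, Exec (Ctx.input γ) (P i j) s 1 (Cell.set s i (g γ (s.idx j)))) :
    Computes (fun γ => g γ (f γ)) := by
  obtain ⟨m, hf⟩ := hf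
  refine ⟨m, fun J p sl hsl hp => ?_⟩
  obtain ⟨P1, T1, h1⟩ := hf J p sl hsl hp
  refine ⟨.seq P1 (P p p), T1 + 1, fun γ s hs => ?_⟩
  refine ((h1 γ s hs).seq fun s1 h2 => Run.of_exec (hP γ s1 p p)
    (Q := fun s' => Cell.get s' p = g γ (f γ) ∧ AgreeBelow J p s s') ⟨?_, ?_⟩).mono
    (by simp) fun _ h => h
  · rw [Cell.get_set, ← h2.1]; rfl
  · exact h2.2.set (by rw [Nat.mod_eq_of_lt (by omega)])

theorem Computes.word {f : Γ → ℕ} (hf : Computes f) :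
    Computes (fun γ => (Ctx.input γ).words.getD (f γ) 0) :=
  hf.fetch (fun γ i => (Ctx.input γ).words.getD i 0) .read fun _ s i j => .read i j s

theorem Computes.value {f : Γ → ℕ} (hf : Computes f) :
    Computes (fun γ => (Ctx.input γ).values.getD (f γ) 0) :=
  hf.fetch (fun γ i => (Ctx.input γ).values.getD i 0) .vread fun _ s i j => .vread i j s

/-- Binary operations that a single instruction performs. -/
theorem Computes.binop {f g : Γ → α} (hf : Computes f) (hg : Computes g) (op : α → α → α)
    (P : ℕ → ℕ → ℕ → Prog) (hP : ∀ x s i j l,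
      Exec x (P i j l) s 1 (Cell.set s i (op (Cell.get s j) (Cell.get s l)))) :
    Computes (fun γ => op (f γ) (g γ)) := by
  obtain ⟨m, hf⟩ := hf
  obtain ⟨m', hg⟩ := hg
  refine ⟨max m (m' + 1), fun J p sl hsl hp => ?_⟩
  obtain ⟨P1, T1, h1⟩ := hf J p sl hsl (by omega)
  obtain ⟨P2, T2, h2⟩ := hg J (p + 1) sl (fun k => (hsl k).trans (by omega)) (by omega)
  have hpm : p % J = p := Nat.mod_eq_of_lt (by omega)
  refine ⟨.seq P1 (.seq P2 (P p p (p + 1))), T1 + (T2 + 1), fun γ s hs => ?_⟩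
  refine ((h1 γ s hs).seq fun s1 q1 =>
    (h2 γ s1 (Ctx.holds_of_agree hsl (by omega) q1.2 hs)).seq fun s2 q2 =>
    Run.of_exec (hP _ s2 p p (p + 1))
    (Q := fun s' => Cell.get s' p = op (f γ) (g γ) ∧ AgreeBelow J p s s') ⟨?_, ?_⟩).mono
    (by simp) fun _ h => h
  · rw [Cell.get_set, q2.1, q2.2.get (by omega), q1.1]
  · exact (q1.2.trans (q2.2.mono (by omega))).set (by omega)

theorem Computes.add {f g : Γ → ℕ} (hf : Computes f) (hg : Computes g) :
    Computes (fun γ => f γ + g γ) :=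
  hf.binop hg (· + ·) .add fun _ s i j l => .add i j l s

theorem Computes.sub {f g : Γ → ℕ} (hf : Computes f) (hg : Computes g) :
    Computes (fun γ => f γ - g γ) :=
  hf.binop hg (· - ·) .sub fun _ s i j l => .sub i j l s

theorem Computes.addReal {f g : Γ → ℝ} (hf : Computes f) (hg : Computes g) :
    Computes (fun γ => f γ + g γ) :=
  hf.binop hg (· + ·) .vadd fun _ s i j l => .vadd i j l s

theorem Computes.mulReal {f g : Γ → ℝ} (hf : Computes f) (hg : Computes g) :
    Computes (fun γ => f γ * g γ) :=
  hf.binop hg (· * ·) .vmul fun _ s i j l => .vmul i j l s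

open Classical in
theorem Computes.iteLE {a c : Γ → ℕ} {f g : Γ → α} (ha : Computes a) (hc : Computes c)
    (hf : Computes f) (hg : Computes g) :
    Computes (fun γ => if a γ ≤ c γ then f γ else g γ) := by
  obtain ⟨m1, ha⟩ := ha
  obtain ⟨m2, hc⟩ := hc
  obtain ⟨m3, hf⟩ := hf
  obtain ⟨m4, hg⟩ := hg
  refine ⟨max (max m1 (m2 + 1)) (max m3 m4), fun J p sl hsl hp => ?_⟩
  obtain ⟨P1, T1, h1⟩ := ha J p sl hsl (by omega)
  obtain ⟨P2, T2, h2⟩ := hc J (p + 1) sl (fun k => (hsl k).trans (by omega)) (by omega)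
  obtain ⟨P3, T3, h3⟩ := hf J p sl hsl (by omega)
  obtain ⟨P4, T4, h4⟩ := hg J p sl hsl (by omega)
  have hpm : p % J = p := Nat.mod_eq_of_lt (by omega)
  refine ⟨.seq P1 (.seq P2 (.ifLE p (p + 1) P3 P4)), T1 + (T2 + (T3 + T4 + 1)),
    fun γ s hs => ?_⟩
  have hsp : p ≤ J := by omega
  refine ((h1 γ s hs).seq (T' := T2.eval (Ctx.size γ) +
      (T3.eval (Ctx.size γ) + T4.eval (Ctx.size γ) + 1)) fun s1 q1 =>
    (h2 γ s1 (Ctx.holds_of_agree hsl hsp q1.2 hs)).seq fun s2 q2 => ?_).mono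
    (by simp) fun _ h => h
  have e1 : s2.idx p = a γ := ((q2.2 p (by omega)).1).trans q1.1
  have e2 : s2.idx (p + 1) = c γ := q2.1
  have b2 : AgreeBelow J p s s2 := q1.2.trans (q2.2.mono (by omega))
  have hs2 := Ctx.holds_of_agree hsl hsp b2 hs
  by_cases hle : a γ ≤ c γ
  · simp only [if_pos hle]
    obtain ⟨t, s', e, l, q⟩ := h3 γ s2 hs2
    exact ⟨_, s', .ifLE_true (by rw [e1, e2]; exact hle) e, by omega, q.1, b2.trans q.2⟩
  · simp only [if_neg hle]
    obtain ⟨t, s', e, l, q⟩ := h4 γ s2 hs2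
    exact ⟨_, s', .ifLE_false (by rw [e1, e2]; exact hle) e, by omega, q.1, b2.trans q.2⟩

end Basic

/-! ### Variables and tables -/

theorem slot_mod {J a : ℕ} (i : ℕ) (h : a < J) : (i * J + a) % J = a := by
  rw [Nat.mul_add_mod', Nat.mod_eq_of_lt h]

/-- A finite type whose elements are numbered. -/
class Code (ι : Type) where
  size : ℕ
  equiv : ι ≃ Fin size

/-- The number of an element. -/
def Code.code {ι : Type} [Code ι] (i : ι) : ℕ := (Code.equiv i : ℕ)

theorem Code.code_lt {ι : Type} [Code ι] (i : ι) : Code.code i < Code.size ι :=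
  (Code.equiv i).2

theorem Code.code_injective {ι : Type} [Code ι] : Function.Injective (Code.code (ι := ι)) :=
  fun _ _ h => Code.equiv.injective (Fin.ext h)

instance (n : ℕ) : Code (Fin n) := ⟨n, Equiv.refl _⟩

/-- The context `Γ` extended by a variable with values in `ι`. -/
structure Ext (Γ : Type) (ι : Γ → Type) where
  base : Γ
  top : ι base

/-- The context `Γ` extended by an object of `X` that is represented by the table of its values
under `rd`. -/
structure TExt (Γ : Type) {α : Type} (ι X : Γ → Type) (rd : ∀ γ, X γ → ι γ → α) where
  base : Γ
  tab : X base

instance {Γ : Type} [Ctx Γ] {ι : Γ → Type} [∀ γ, Code (ι γ)] : Ctx (Ext Γ ι) where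
  input p := Ctx.input p.base
  Holds J sl p s := Ctx.Holds J (fun k => sl (k + 1)) p.base s ∧ s.idx (sl 0) = Code.code p.top
  holds_of_agree {J q sl p s s'} hsl hq h hs := by
    refine ⟨Ctx.holds_of_agree (fun k => hsl (k + 1)) hq h hs.1, ?_⟩
    have h0 := hsl 0
    rw [(h (sl 0) (by rw [Nat.mod_eq_of_lt (by omega)]; exact h0)).1]
    exact hs.2

instance {Γ α : Type} [Ctx Γ] [Cell α] {ι X : Γ → Type} [∀ γ, Code (ι γ)]
    {rd : ∀ γ, X γ → ι γ → α} : Ctx (TExt Γ ι X rd) where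
  input p := Ctx.input p.base
  Holds J sl p s := Ctx.Holds J (fun k => sl (k + 1)) p.base s ∧
    ∀ i : ι p.base, Cell.get s (Code.code i * J + sl 0) = rd p.base p.tab i
  holds_of_agree {J q sl p s s'} hsl hq h hs := by
    refine ⟨Ctx.holds_of_agree (fun k => hsl (k + 1)) hq h hs.1, fun i => ?_⟩
    have h0 := hsl 0
    rw [h.get (by rw [slot_mod _ (by omega)]; exact h0)]
    exact hs.2 i

/-- Give the innermost entry of a context the slot `a`. -/
def pushSlot (a : ℕ) (sl : ℕ → ℕ) : ℕ → ℕ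
  | 0 => a
  | k + 1 => sl k

theorem pushSlot_lt {a p : ℕ} {sl : ℕ → ℕ} (ha : a < p) (h : ∀ k, sl k < p) (k : ℕ) :
    pushSlot a sl k < p := by
  cases k with
  | zero => exact ha
  | succ k => exact h k

section Weakening
variable {Γ α β : Type} [Ctx Γ] [Cell α] [Cell β]

/-- The variable that was added last. -/
theorem Computes.top {ι : Γ → Type} [∀ γ, Code (ι γ)] :
    Computes (fun p : Ext Γ ι => Code.code p.top) := by
  refine ⟨0, fun J p sl hsl hp => ?_⟩
  have hpm : p % J = p := Nat.mod_eq_of_lt (by omega)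
  have h0 := hsl 0
  refine ⟨.seq (.const p 0) (.add p p (sl 0)), 2, fun γ s hs => ?_⟩
  refine (Run.of_exec (.seq (.const p 0 s) (.add p p (sl 0) _)) ⟨?_, ?_⟩).mono (by simp)
    fun _ h => h
  · have := hs.2
    simp only [Cell.get, State.idx_setIdx_self]
    rw [State.idx_setIdx_ne _ _ (by omega), this]
    simp
  · exact ((AgreeBelow.refl J p s).setIdx (by omega)).setIdx (by omega)

/-- The map `π` forgets or permutes entries of a context. -/
def IsProjection {Δ Γ : Type} [Ctx Δ] [Ctx Γ] (π : Δ → Γ) : Prop :=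
  (∀ δ, Ctx.input (π δ) = Ctx.input δ) ∧
    ∃ ρ : ℕ → ℕ, ∀ J sl δ s, Ctx.Holds J sl δ s → Ctx.Holds J (fun k => sl (ρ k)) (π δ) s

theorem IsProjection.id : IsProjection (fun γ : Γ => γ) :=
  ⟨fun _ => rfl, fun k => k, fun _ _ _ _ h => h⟩

theorem IsProjection.trans {Δ Ξ : Type} [Ctx Δ] [Ctx Ξ] {π : Δ → Γ} {π' : Ξ → Δ}
    (h : IsProjection π) (h' : IsProjection π') : IsProjection (fun ξ => π (π' ξ)) := by
  obtain ⟨h1, ρ, h2⟩ := h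
  obtain ⟨h3, ρ', h4⟩ := h'
  exact ⟨fun ξ => (h1 _).trans (h3 ξ), fun k => ρ' (ρ k),
    fun J sl ξ s hs => h2 J _ _ s (h4 J sl ξ s hs)⟩

theorem IsProjection.base {Δ : Type} [Ctx Δ] {π : Δ → Γ} (h : IsProjection π) {ι : Δ → Type}
    [∀ γ, Code (ι γ)] : IsProjection (fun p : Ext Δ ι => π p.base) := by
  obtain ⟨h1, ρ, h2⟩ := h
  exact ⟨fun p => h1 p.base, fun k => ρ k + 1, fun J sl p s hs => h2 J _ p.base s hs.1⟩

theorem IsProjection.baseTab {Δ : Type} [Ctx Δ] {π : Δ → Γ} (h : IsProjection π) {ι X : Δ → Type}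
    [∀ γ, Code (ι γ)] {rd : ∀ γ, X γ → ι γ → β} :
    IsProjection (fun p : TExt Δ ι X rd => π p.base) := by
  obtain ⟨h1, ρ, h2⟩ := h
  exact ⟨fun p => h1 p.base, fun k => ρ k + 1, fun J sl p s hs => h2 J _ p.base s hs.1⟩

/-- A projection may keep the innermost variable. -/
theorem IsProjection.ext {Δ : Type} [Ctx Δ] {π : Δ → Γ} (h : IsProjection π) {ι : Γ → Type}
    [∀ γ, Code (ι γ)] :
    IsProjection (fun p : Ext Δ (fun δ => ι (π δ)) => (⟨π p.base, p.top⟩ : Ext Γ ι)) := by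
  obtain ⟨h1, ρ, h2⟩ := h
  refine ⟨fun p => h1 p.base, fun k => k.casesOn 0 fun k => ρ k + 1, fun J sl p s hs => ?_⟩
  exact ⟨h2 J _ p.base s hs.1, hs.2⟩

theorem IsProjection.swap {ι κ : Γ → Type} [∀ γ, Code (ι γ)] [∀ γ, Code (κ γ)] :
    IsProjection (fun p : Ext (Ext Γ ι) (fun q => κ q.base) =>
      (⟨⟨p.base.base, p.top⟩, p.base.top⟩ : Ext (Ext Γ κ) (fun q => ι q.base))) :=
  ⟨fun _ => rfl, fun k => k.casesOn 1 fun k => k.casesOn 0 fun k => k + 2,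
    fun _ _ _ _ hs => ⟨⟨hs.1.1, hs.2⟩, hs.1.2⟩⟩

theorem Computes.comp {Δ : Type} [Ctx Δ] {f : Γ → α} (hf : Computes f) {π : Δ → Γ}
    (hπ : IsProjection π) : Computes (fun δ => f (π δ)) := by
  obtain ⟨m, hf⟩ := hf
  obtain ⟨h1, ρ, h2⟩ := hπ
  refine ⟨m, fun J p sl hsl hp => ?_⟩
  obtain ⟨P, T, h⟩ := hf J p (fun k => sl (ρ k)) (fun k => hsl (ρ k)) hp
  refine ⟨P, T, fun δ s hs => ?_⟩
  have := h (π δ) s (h2 J sl δ s hs)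
  rwa [Ctx.size, h1, ← Ctx.size] at this

theorem Computes.weaken {f : Γ → α} (hf : Computes f) {ι : Γ → Type} [∀ γ, Code (ι γ)] :
    Computes (fun p : Ext Γ ι => f p.base) :=
  hf.comp IsProjection.id.base

theorem Computes.weakenTab {f : Γ → α} (hf : Computes f) {ι X : Γ → Type} [∀ γ, Code (ι γ)]
    {rd : ∀ γ, X γ → ι γ → β} : Computes (fun p : TExt Γ ι X rd => f p.base) :=
  hf.comp IsProjection.id.baseTab

/-- Table lookup. The table need not be the innermost entry of the context: `π` projects the context
to one in which it is. -/
theorem Computes.lookup {Δ : Type} [Ctx Δ] {ι X : Γ → Type} [∀ γ, Code (ι γ)]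
    {rd : ∀ γ, X γ → ι γ → α} {π : Δ → TExt Γ ι X rd} (hπ : IsProjection π)
    {i : ∀ δ, ι (π δ).base} (hi : Computes fun δ => Code.code (i δ)) :
    Computes (fun δ => rd (π δ).base (π δ).tab (i δ)) := by
  obtain ⟨m, hi⟩ := hi
  obtain ⟨-, ρ, hπ⟩ := hπ
  refine ⟨m + 1, fun J p sl hsl hp => ?_⟩
  obtain ⟨P, T, h⟩ := hi J p sl hsl (by omega)
  have hpm : p % J = p := Nat.mod_eq_of_lt (by omega)
  have hpm' : (p + 1) % J = p + 1 := Nat.mod_eq_of_lt (by omega)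
  have h0 := hsl (ρ 0)
  refine ⟨.seq P (.seq (addressOf J (p + 1) p (sl (ρ 0))) (Cell.load (α := α) p (p + 1))),
    T + (Polynomial.C (J + 2) + 1), fun γ s hs => ?_⟩
  refine ((h γ s hs).seq fun s1 q1 => Run.of_exec (.seq (exec_addressOf _ J _ (by omega) s1)
    (Cell.exec_load _ _ _ _)) (Q := fun s' => Cell.get s' p = rd (π γ).base (π γ).tab (i γ) ∧
      AgreeBelow J p s s') ⟨?_, ?_⟩).mono (by simp) fun _ h => h
  · have e : s1.idx p = Code.code (i γ) := q1.1
    have hT := (hπ J sl γ s hs).2 (i γ)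
    rw [Cell.get_set, State.idx_setIdx_self, Cell.get_setIdx_ne, e, q1.2.get, hT]
    · rw [slot_mod _ (by omega)]; exact h0
    · intro h'
      have := slot_mod (J := J) (a := sl (ρ 0)) (Code.code (i γ)) (by omega)
      rw [← e, h', hpm'] at this
      omega
  · exact (q1.2.setIdx (by omega)).set (by omega)

end Weakening

/-! ### Loops -/

/-- A computable function that is bounded by a polynomial in the input size, so that a loop may have
this number of rounds. -/
def PolyBounded {Γ : Type} [Ctx Γ] (N : Γ → ℕ) : Prop :=
  Computes N ∧ ∃ B : Polynomial ℕ, ∀ γ, N γ ≤ B.eval (Ctx.size γ)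

section Loops
variable {Γ α : Type} [Ctx Γ] [Cell α]

/-- Accumulate the values of `F` by the binary operation `op`, starting with `A γ 0`. -/
theorem Computes.fold (op : α → α → α) (opP : ℕ → ℕ → ℕ → Prog)
    (hop : ∀ x s i j l, Exec x (opP i j l) s 1 (Cell.set s i (op (Cell.get s j) (Cell.get s l))))
    {N : Γ → ℕ} (hN : PolyBounded N) {F : ∀ γ, Fin (N γ) → α}
    (hF : Computes (fun p : Ext Γ (fun γ => Fin (N γ)) => F p.base p.top)) (A : Γ → ℕ → α)
    (hA0 : Computes fun γ => A γ 0) (hA : ∀ γ (i : Fin (N γ)), A γ (i + 1) = op (A γ i) (F γ i)) :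
    Computes (fun γ => A γ (N γ)) := by
  obtain ⟨⟨m1, hN⟩, B, hB⟩ := hN
  obtain ⟨m2, hF⟩ := hF
  obtain ⟨m3, hA0⟩ := hA0
  refine ⟨max (m1 + 2) (max (m2 + 4) m3), fun J p sl hsl hp => ?_⟩
  -- slot `p` holds the accumulated value, `p + 1` the counter, `p + 2` the number of rounds,
  -- `p + 3` the constant one, and `p + 4` receives the value of `F`
  obtain ⟨P1, T1, h1⟩ := hN J (p + 2) sl (fun k => (hsl k).trans (by omega)) (by omega)
  obtain ⟨P2, T2, h2⟩ := hF J (p + 4) (pushSlot (p + 1) sl)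
    (pushSlot_lt (by omega) (fun k => (hsl k).trans (by omega))) (by omega)
  obtain ⟨P3, T3, h3⟩ := hA0 J p sl hsl (by omega)
  have hm : ∀ i, i ≤ 4 → (p + i) % J = p + i := fun i hi => Nat.mod_eq_of_lt (by omega)
  have hm0 : p % J = p := Nat.mod_eq_of_lt (by omega)
  have hm1 := hm 1 (by omega)
  have hm2 := hm 2 (by omega)
  have hm3 := hm 3 (by omega)
  have hm4 := hm 4 (by omega)
  refine ⟨.seq P3 (.seq P1 (.seq (.const (p + 1) 0) (.seq (.const (p + 3) 1)
    (.whileLT (p + 1) (p + 2) (.seq P2 (.seq (opP p p (p + 4)) (.add (p + 1) (p + 1) (p + 3)))))))),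
    T3 + (T1 + (1 + (1 + (B * (T2 + (1 + 1) + 1) + 1)))), fun γ s hs => ?_⟩
  have key := (h3 γ s hs).seq fun s1 q1 =>
    (h1 γ s1 (Ctx.holds_of_agree hsl (by omega) q1.2 hs)).seq fun s2 q2 =>
    (Run.of_exec (.const (p + 1) 0 s2) (Q := fun s' => s' = s2.setIdx (p + 1) 0) rfl).seq
      fun s3 q3 => (Run.of_exec (.const (p + 3) 1 s3)
        (Q := fun s' => s' = s3.setIdx (p + 3) 1) rfl).seq fun s4 q4 =>
      Run.forLoop (x := Ctx.input γ) (s := s4) (ri := p + 1) (rN := p + 2) (N := N γ)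
      (body := .seq P2 (.seq (opP p p (p + 4)) (.add (p + 1) (p + 1) (p + 3))))
      (T := (T2 + (1 + 1)).eval (Ctx.size γ))
      (fun i s' => s'.idx (p + 1) = i ∧ s'.idx (p + 2) = N γ ∧ s'.idx (p + 3) = 1 ∧
        Cell.get s' p = A γ i ∧ AgreeBelow J p s s') ?_ ?_ ?_
  · refine key.mono ?_ fun s' h => ⟨h.2.2.2.1, h.2.2.2.2⟩
    simp only [Polynomial.eval_add, Polynomial.eval_mul, Polynomial.eval_one]
    gcongr
    exact hB γ
  · subst q4 q3
    have b : AgreeBelow J p s ((s2.setIdx (p + 1) 0).setIdx (p + 3) 1) :=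
      ((q1.2.trans (q2.2.mono (by omega))).setIdx (by omega)).setIdx (by omega)
    refine ⟨?_, ?_, ?_, ?_, b⟩
    · rw [State.idx_setIdx_ne _ _ (by omega), State.idx_setIdx_self]
    · rw [State.idx_setIdx_ne _ _ (by omega), State.idx_setIdx_ne _ _ (by omega)]
      exact q2.1
    · rw [State.idx_setIdx_self]
    · rw [Cell.get_setIdx_ne _ _ (by omega), Cell.get_setIdx_ne _ _ (by omega),
        q2.2.get (by omega), q1.1]
  · rintro i s' ⟨h1, h2, -⟩
    exact ⟨h1, h2⟩
  · rintro i hi s' ⟨e1, e2, e3, e4, b⟩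
    have hs' : Ctx.Holds J (pushSlot (p + 1) sl) (⟨γ, ⟨i, hi⟩⟩ : Ext Γ fun γ => Fin (N γ)) s' :=
      ⟨Ctx.holds_of_agree hsl (by omega) b hs, e1⟩
    refine ((h2 _ s' hs').seq (T' := 1 + 1) fun s5 q5 => Run.of_exec
      (.seq (hop _ s5 _ _ _) (.add _ _ _ _)) ?_).mono
      (by simp [Ctx.size, Ctx.input]) fun _ h => h
    have f1 := (q5.2 (p + 1) (by omega)).1
    have f2 := (q5.2 (p + 2) (by omega)).1
    have f3 := (q5.2 (p + 3) (by omega)).1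
    refine ⟨?_, ?_, ?_, ?_, ?_⟩
    · rw [State.idx_setIdx_self, Cell.idx_set_ne _ _ _ _ (by omega),
        Cell.idx_set_ne _ _ _ _ (by omega), f1, f3, e1, e3]
    · rw [State.idx_setIdx_ne _ _ (by omega), Cell.idx_set_ne _ _ _ _ (by omega), f2, e2]
    · rw [State.idx_setIdx_ne _ _ (by omega), Cell.idx_set_ne _ _ _ _ (by omega), f3, e3]
    · rw [Cell.get_setIdx_ne _ _ (by omega), Cell.get_set, q5.1, q5.2.get (by omega), e4]
      exact (hA γ ⟨i, hi⟩).symm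
    · exact ((b.trans (q5.2.mono (by omega))).set (by omega)).setIdx (by omega)

theorem Computes.natSum {N : Γ → ℕ} (hN : PolyBounded N) {F : ∀ γ, Fin (N γ) → ℕ}
    (hF : Computes (fun p : Ext Γ (fun γ => Fin (N γ)) => F p.base p.top)) :
    Computes (fun γ => ∑ i, F γ i) := by
  refine (Computes.fold (· + ·) .add (fun _ s i j l => .add i j l s) hN hF
    (fun γ i => ∑ j ∈ Finset.range i, if h : j < N γ then F γ ⟨j, h⟩ else 0)
    (by simpa using Computes.nat (Γ := Γ) 0) fun γ i => ?_).congr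
    fun γ => (Finset.sum_range _).trans (by simp)
  rw [Finset.sum_range_succ, dif_pos i.2]

theorem Computes.realSum {N : Γ → ℕ} (hN : PolyBounded N) {F : ∀ γ, Fin (N γ) → ℝ}
    (hF : Computes (fun p : Ext Γ (fun γ => Fin (N γ)) => F p.base p.top)) :
    Computes (fun γ => ∑ i, F γ i) := by
  refine (Computes.fold (· + ·) .vadd (fun _ s i j l => .vadd i j l s) hN hF
    (fun γ i => ∑ j ∈ Finset.range i, if h : j < N γ then F γ ⟨j, h⟩ else 0)
    (by simpa using Computes.int (Γ := Γ) 0) fun γ i => ?_).congr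
    fun γ => (Finset.sum_range _).trans (by simp)
  rw [Finset.sum_range_succ, dif_pos i.2]

theorem Computes.realProd {N : Γ → ℕ} (hN : PolyBounded N) {F : ∀ γ, Fin (N γ) → ℝ}
    (hF : Computes (fun p : Ext Γ (fun γ => Fin (N γ)) => F p.base p.top)) :
    Computes (fun γ => ∏ i, F γ i) := by
  refine (Computes.fold (· * ·) .vmul (fun _ s i j l => .vmul i j l s) hN hF
    (fun γ i => ∏ j ∈ Finset.range i, if h : j < N γ then F γ ⟨j, h⟩ else 1)
    (by simpa using Computes.int (Γ := Γ) 1) fun γ i => ?_).congr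
    fun γ => (Finset.prod_range _).trans (by simp)
  rw [Finset.prod_range_succ, dif_pos i.2]

end Loops

/-! ### Iterated tables -/

section Iterate
variable {Γ α : Type} [Ctx Γ] [Cell α]

/-- Fill slot `a` with the values that `body` puts into slot `p + 4`, for the counter `idx[p]` from
`0` to `idx[p + 1] - 1`. -/
def fillTable (α : Type) [Cell α] (J p a : ℕ) (body : Prog) : Prog :=
  .seq (.const p 0) (.seq (.const (p + 2) 1) (.whileLT p (p + 1)
    (.seq body (.seq (addressOf J (p + 3) p a)
      (.seq (Cell.store (α := α) (p + 3) (p + 4)) (.add p p (p + 2)))))))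

theorem run_fillTable {x : Input} {J p a N T : ℕ} {body : Prog} {s : State} (hJ : p + 4 < J)
    (ha : a < p) (hN : s.idx (p + 1) = N) (g : Fin N → α)
    (hbody : ∀ i : Fin N, ∀ s', s'.idx p = (i : ℕ) →
      (∀ c, c % J < p → c % J ≠ a → s'.idx c = s.idx c ∧ s'.val c = s.val c) →
      Run x body s' T fun s'' => Cell.get s'' (p + 4) = g i ∧ AgreeBelow J (p + 4) s' s'') :
    Run x (fillTable α J p a body) s (N * (T + (J + 4) + 1) + 3) fun s' =>
      (∀ i : Fin N, Cell.get s' (i * J + a) = g i) ∧ s'.idx (p + 1) = N ∧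
      ∀ c, c % J < p → c % J ≠ a → s'.idx c = s.idx c ∧ s'.val c = s.val c := by
  have hm0 : p % J = p := Nat.mod_eq_of_lt (by omega)
  have hm1 : (p + 1) % J = p + 1 := Nat.mod_eq_of_lt (by omega)
  have hm2 : (p + 2) % J = p + 2 := Nat.mod_eq_of_lt (by omega)
  have hm3 : (p + 3) % J = p + 3 := Nat.mod_eq_of_lt (by omega)
  have hm4 : (p + 4) % J = p + 4 := Nat.mod_eq_of_lt (by omega)
  have key := (Run.of_exec (.const p 0 s) (x := x) (Q := fun s' => s' = s.setIdx p 0) rfl).seq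
    fun s1 q1 => (Run.of_exec (.const (p + 2) 1 s1)
      (Q := fun s' => s' = s1.setIdx (p + 2) 1) rfl).seq fun s2 q2 =>
    Run.forLoop (x := x) (s := s2) (ri := p) (rN := p + 1) (N := N)
      (body := .seq body (.seq (addressOf J (p + 3) p a)
        (.seq (Cell.store (α := α) (p + 3) (p + 4)) (.add p p (p + 2)))))
      (T := T + (J + 4))
      (fun i s' => s'.idx p = i ∧ s'.idx (p + 1) = N ∧ s'.idx (p + 2) = 1 ∧
        (∀ j : Fin N, j < i → Cell.get s' (j * J + a) = g j) ∧
        ∀ c, c % J < p → c % J ≠ a → s'.idx c = s.idx c ∧ s'.val c = s.val c) ?_ ?_ ?_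
  · exact key.mono (by omega) fun s' h => ⟨fun j => h.2.2.2.1 j j.2, h.2.1, h.2.2.2.2⟩
  · subst q2 q1
    refine ⟨?_, ?_, ?_, by simp, fun c hc _ => ⟨?_, rfl⟩⟩
    · rw [State.idx_setIdx_ne _ _ (by omega), State.idx_setIdx_self]
    · rw [State.idx_setIdx_ne _ _ (by omega), State.idx_setIdx_ne _ _ (by omega), hN]
    · rw [State.idx_setIdx_self]
    · have n1 : c ≠ p := by rintro rfl; omega
      have n2 : c ≠ p + 2 := by rintro rfl; omega
      rw [State.idx_setIdx_ne _ _ n2, State.idx_setIdx_ne _ _ n1]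
  · rintro i s' ⟨h1, h2, -⟩
    exact ⟨h1, h2⟩
  · rintro i hi s' ⟨e1, e2, e3, e4, e5⟩
    refine ((hbody ⟨i, hi⟩ s' e1 e5).seq (T' := J + 4) fun s3 q3 =>
      (Run.of_exec (.seq (exec_addressOf x J a (by omega) s3) (.seq (Cell.exec_store _ _ _ _)
        (.add _ _ _ _))) ?_).mono (by omega) fun _ h => h)
    have f0 := (q3.2 p (by omega)).1
    have f1 := (q3.2 (p + 1) (by omega)).1
    have f2 := (q3.2 (p + 2) (by omega)).1
    -- the cell that is written does not belong to the registers of the loop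
    have hslot : ∀ j c, c % J ≠ a → c ≠ j * J + a := by
      rintro j c hc rfl
      exact hc (slot_mod _ (by omega))
    rw [f0, e1, State.idx_setIdx_self s3 (p + 3), Cell.get_setIdx_ne _ _ (by omega), q3.1]
    have d0 := hslot i p (by omega)
    have d1 := hslot i (p + 1) (by omega)
    have d2 := hslot i (p + 2) (by omega)
    refine ⟨?_, ?_, ?_, ?_, ?_⟩
    · rw [State.idx_setIdx_self, Cell.idx_set_ne _ _ _ _ d0, Cell.idx_set_ne _ _ _ _ d2,
        State.idx_setIdx_ne _ _ (by omega), State.idx_setIdx_ne _ _ (by omega), f0, f2, e1, e3]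
    · rw [State.idx_setIdx_ne _ _ (by omega), Cell.idx_set_ne _ _ _ _ d1,
        State.idx_setIdx_ne _ _ (by omega), f1, e2]
    · rw [State.idx_setIdx_ne _ _ (by omega), Cell.idx_set_ne _ _ _ _ d2,
        State.idx_setIdx_ne _ _ (by omega), f2, e3]
    · intro j hj
      have hja : ((j : ℕ) * J + a) % J = a := slot_mod _ (by omega)
      have n0 : (j : ℕ) * J + a ≠ p := by intro h; rw [h] at hja; omega
      have n3 : (j : ℕ) * J + a ≠ p + 3 := by intro h; rw [h] at hja; omega
      rw [Cell.get_setIdx_ne _ _ n0]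
      rcases Nat.lt_succ_iff_lt_or_eq.mp hj with hj' | hj'
      · have : (j : ℕ) * J + a ≠ i * J + a := by
          intro h
          have := Nat.eq_of_mul_eq_mul_right (by omega) (Nat.add_right_cancel h)
          omega
        rw [Cell.get_set_ne _ _ this, Cell.get_setIdx_ne _ _ n3, q3.2.get (by omega), e4 j hj']
      · obtain rfl : j = ⟨i, hi⟩ := Fin.ext hj'
        rw [Cell.get_set]
    · intro c hc hca
      have n0 : c ≠ p := by rintro rfl; omega
      have n3 : c ≠ p + 3 := by rintro rfl; omega
      have b := q3.2 c (by omega)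
      have d := hslot i c hca
      rw [State.idx_setIdx_ne _ _ n0, State.val_setIdx, Cell.idx_set_ne _ _ _ _ d,
        Cell.val_set_ne _ _ _ _ d, State.idx_setIdx_ne _ _ n3, State.val_setIdx, b.1, b.2]
      exact e5 c hc hca

/-- A table that is computed in rounds, each of which computes all entries from those of the round
before. The objects `T γ r` of any type `X γ` may be represented by tables. -/
theorem Computes.iterate {ι : Γ → Type} [∀ γ, Code (ι γ)]
    (hι : PolyBounded fun γ => Code.size (ι γ)) {R : Γ → ℕ} (hR : PolyBounded R) {X : Γ → Type}
    (rd : ∀ γ, X γ → ι γ → α) (T : ∀ γ, ℕ → X γ)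
    (step : ∀ γ, Fin (R γ) → X γ → X γ)
    (hstep : Computes fun p : Ext (TExt (Ext Γ fun γ => Fin (R γ)) (fun q => ι q.base)
      (fun q => X q.base) (fun q => rd q.base)) (fun q => ι q.base.base) =>
        rd p.base.base.base (step p.base.base.base p.base.base.top p.base.tab) p.top)
    (h0 : Computes fun p : Ext Γ ι => rd p.base (T p.base 0) p.top)
    (hT : ∀ γ (r : Fin (R γ)), T γ (r + 1) = step γ r (T γ r))
    {i : ∀ γ, ι γ} (hi : Computes fun γ => Code.code (i γ)) :
    Computes (fun γ => rd γ (T γ (R γ)) (i γ)) := by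
  obtain ⟨⟨m1, hR⟩, BR, hBR⟩ := hR
  obtain ⟨⟨m2, hι⟩, BI, hBI⟩ := hι
  obtain ⟨m3, hstep⟩ := hstep
  obtain ⟨m4, h0⟩ := h0
  obtain ⟨m5, hi⟩ := hi
  refine ⟨10 + m1 + m2 + m3 + m4 + m5, fun J p sl hsl hp => ?_⟩
  -- slot `p` holds the table, `p + 1` the table of the next round, `p + 2` the number of the round,
  -- `p + 3` the number of rounds, `p + 4` the constant one; the slots from `p + 5` on are used for
  -- filling tables, where `p + 5` holds the number of the entry and `p + 6` the number of entries
  have hsl' : ∀ q, p ≤ q → ∀ k, sl k < q := fun q hq k => (hsl k).trans_le hq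
  obtain ⟨P1, T1, h1⟩ := hR J (p + 3) sl (hsl' _ (by omega)) (by omega)
  obtain ⟨P2, T2, h2⟩ := hι J (p + 6) sl (hsl' _ (by omega)) (by omega)
  obtain ⟨P3, T3, h3⟩ := h0 J (p + 9) (pushSlot (p + 5) sl)
    (pushSlot_lt (by omega) (hsl' _ (by omega))) (by omega)
  obtain ⟨P4, T4, h4⟩ := hstep J (p + 9) (pushSlot (p + 5) (pushSlot p (pushSlot (p + 2) sl)))
    (pushSlot_lt (by omega) (pushSlot_lt (by omega) (pushSlot_lt (by omega)
      (hsl' _ (by omega))))) (by omega)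
  obtain ⟨P5, T5, h5⟩ := hi J (p + 5) sl (hsl' _ (by omega)) (by omega)
  have hm : ∀ i, i ≤ 9 → (p + i) % J = p + i := fun i hi => Nat.mod_eq_of_lt (by omega)
  have hm0 : p % J = p := Nat.mod_eq_of_lt (by omega)
  have hm2 := hm 2 (by omega)
  have hm3 := hm 3 (by omega)
  have hm4 := hm 4 (by omega)
  have hm5 := hm 5 (by omega)
  have hm6 := hm 6 (by omega)
  -- the entries of the new table are computed into slot `p + 1`, then copied to slot `p`
  let copy : Prog := .seq (addressOf J (p + 10) (p + 5) (p + 1))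
    (Cell.load (α := α) (p + 5 + 4) (p + 10))
  let body : Prog := .seq (fillTable α J (p + 5) (p + 1) P4)
    (.seq (fillTable α J (p + 5) p copy) (.add (p + 2) (p + 2) (p + 4)))
  refine ⟨.seq P1 (.seq P2 (.seq (fillTable α J (p + 5) p P3) (.seq (.const (p + 2) 0)
    (.seq (.const (p + 4) 1) (.seq (.whileLT (p + 2) (p + 3) body)
    (.seq P5 (.seq (addressOf J (p + 6) (p + 5) p) (Cell.load (α := α) p (p + 6))))))))),
    T1 + (T2 + ((BI * (T3 + Polynomial.C (J + 4) + 1) + 3) + (1 + (1 +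
      ((BR * ((BI * (T4 + Polynomial.C (J + 4) + 1) + 3) +
        ((BI * (Polynomial.C (J + 2 + 1) + Polynomial.C (J + 4) + 1) + 3) + 1) + 1) + 1) +
      (T5 + Polynomial.C (J + 2 + 1))))))), fun γ s hs => ?_⟩
  have hN : Code.size (ι γ) ≤ BI.eval (Ctx.size γ) := hBI γ
  have hR' : R γ ≤ BR.eval (Ctx.size γ) := hBR γ
  have hs' : ∀ {s'}, AgreeBelow J p s s' → Ctx.Holds J sl γ s' :=
    fun b => Ctx.holds_of_agree hsl (by omega) b hs
  let g : ℕ → Fin (Code.size (ι γ)) → α := fun r i => rd γ (T γ r) (Code.equiv.symm i)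
  have hg : ∀ {r s' a}, (∀ i : Fin (Code.size (ι γ)), Cell.get s' ((i : ℕ) * J + a) = g r i) →
      ∀ i : ι γ, Cell.get s' (Code.code i * J + a) = rd γ (T γ r) i := by
    intro r s' a h i
    have := h (Code.equiv i)
    simp only [g, Equiv.symm_apply_apply] at this
    exact this
  let I : ℕ → State → Prop := fun r s' => s'.idx (p + 2) = r ∧ s'.idx (p + 3) = R γ ∧
    s'.idx (p + 4) = 1 ∧ s'.idx (p + 6) = Code.size (ι γ) ∧
    (∀ i : Fin (Code.size (ι γ)), Cell.get s' ((i : ℕ) * J + p) = g r i) ∧ AgreeBelow J p s s'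
  have loop : ∀ r < R γ, ∀ s', I r s' → Run (Ctx.input γ) body s'
      ((Code.size (ι γ) * (T4.eval (Ctx.size γ) + (J + 4) + 1) + 3) +
        ((Code.size (ι γ) * ((J + 2 + 1) + (J + 4) + 1) + 3) + 1)) (I (r + 1)) := by
    rintro r hr s' ⟨e2, e3, e4, e6, eT, b⟩
    refine (run_fillTable (by omega) (by omega) e6 (g (r + 1)) ?_).seq fun s1 q1 =>
      (run_fillTable (N := Code.size (ι γ)) (by omega) (by omega) q1.2.1 (g (r + 1)) ?_).seq
        fun s2 q2 => Run.of_exec (.add _ _ _ _) ?_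
    · intro i s3 hi hs3
      have b3 : AgreeBelow J p s s3 := b.trans fun a ha => hs3 a (by omega) (by omega)
      have hT3 : ∀ i : Fin (Code.size (ι γ)), Cell.get s3 ((i : ℕ) * J + p) = g r i := fun i => by
        rw [← eT i]
        have := hs3 (i * J + p) (by rw [slot_mod _ (by omega)]; omega)
          (by rw [slot_mod _ (by omega)]; omega)
        exact Cell.get_congr _ _ _ this.1 this.2
      have := h4 ⟨⟨⟨γ, ⟨r, hr⟩⟩, T γ r⟩, Code.equiv.symm i⟩ s3 ⟨⟨⟨hs' b3, ?_⟩, hg hT3⟩, ?_⟩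
      · refine this.mono le_rfl fun s4 h => ⟨h.1.trans ?_, h.2⟩
        simp only [g, hT γ ⟨r, hr⟩]
      · exact (hs3 (p + 2) (by omega) (by omega)).1.trans e2
      · simp only [pushSlot, Code.code, Equiv.apply_symm_apply]
        exact hi
    · intro i s3 hi hs3
      have hT3 : Cell.get s3 ((i : ℕ) * J + (p + 1)) = g (r + 1) i := by
        rw [← q1.1 i]
        have := hs3 (i * J + (p + 1)) (by rw [slot_mod _ (by omega)]; omega)
          (by rw [slot_mod _ (by omega)]; omega)
        exact Cell.get_congr _ _ _ this.1 this.2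
      refine Run.of_exec (.seq (exec_addressOf _ J _ (by omega) s3) (Cell.exec_load _ _ _ _))
        ⟨?_, ?_⟩
      · have n10 : (i : ℕ) * J + (p + 1) ≠ p + 10 := by
          intro h
          have := slot_mod (J := J) (a := p + 1) i (by omega)
          rw [h, Nat.mod_eq_of_lt (by omega)] at this
          omega
        rw [Cell.get_set, State.idx_setIdx_self, hi, Cell.get_setIdx_ne _ _ n10, hT3]
      · refine ((AgreeBelow.refl J _ s3).setIdx ?_).set ?_
        · rw [Nat.mod_eq_of_lt (by omega)]
          omega
        · rw [Nat.mod_eq_of_lt (by omega)]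
    · have k2 := (q2.2.2 (p + 2) (by omega) (by omega)).1.trans
        (q1.2.2 (p + 2) (by omega) (by omega)).1
      have k3 := (q2.2.2 (p + 3) (by omega) (by omega)).1.trans
        (q1.2.2 (p + 3) (by omega) (by omega)).1
      have k4 := (q2.2.2 (p + 4) (by omega) (by omega)).1.trans
        (q1.2.2 (p + 4) (by omega) (by omega)).1
      refine ⟨?_, ?_, ?_, ?_, fun i => ?_, ?_⟩
      · rw [State.idx_setIdx_self, k2, k4, e2, e4]
      · rw [State.idx_setIdx_ne _ _ (by omega), k3, e3]
      · rw [State.idx_setIdx_ne _ _ (by omega), k4, e4]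
      · rw [State.idx_setIdx_ne _ _ (by omega)]
        exact q2.2.1
      · have n2 : (i : ℕ) * J + p ≠ p + 2 := by
          intro h
          have := slot_mod (J := J) (a := p) i (by omega)
          rw [h, hm2] at this
          omega
        rw [Cell.get_setIdx_ne _ _ n2, q2.1 i]
      · exact ((b.trans fun a ha => q1.2.2 a (by omega) (by omega)).trans
          fun a ha => q2.2.2 a (by omega) (by omega)).setIdx (by omega)
  have key := (h1 γ s (hs' (AgreeBelow.refl J p s))).seq fun s1 q1 =>
    (h2 γ s1 (hs' (q1.2.mono (p := p) (by omega)))).seq fun s2 q2 =>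
    (run_fillTable (x := Ctx.input γ) (J := J) (p := p + 5) (a := p) (T := T3.eval (Ctx.size γ))
      (body := P3) (by omega) (by omega) q2.1 (g 0)
      fun i s' hi hs3 => ?_).seq fun s3 q3 =>
    (Run.of_exec (.const (p + 2) 0 s3) (Q := fun s' => s' = s3.setIdx (p + 2) 0) rfl).seq
      fun s4 q4 => (Run.of_exec (.const (p + 4) 1 s4)
        (Q := fun s' => s' = s4.setIdx (p + 4) 1) rfl).seq fun s5 q5 =>
    (Run.forLoop (N := R γ) I ?_ (fun i s' h => ⟨h.1, h.2.1⟩) loop).seq fun s6 q6 =>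
    (h5 γ s6 (hs' q6.2.2.2.2.2)).seq fun s7 q7 =>
    Run.of_exec (.seq (exec_addressOf _ J (i := p + 6) (j := p + 5) p (by omega) s7)
      (Cell.exec_load (α := α) _ _ p (p + 6)))
      (Q := fun s' => Cell.get s' p = rd γ (T γ (R γ)) (i γ) ∧ AgreeBelow J p s s') ⟨?_, ?_⟩
  · refine key.mono ?_ fun _ h => h
    simp only [Polynomial.eval_add, Polynomial.eval_mul, Polynomial.eval_one,
      Polynomial.eval_ofNat, Polynomial.eval_C]
    gcongr
  · have b3 : AgreeBelow J p s s' := ((q1.2.mono (by omega)).trans (q2.2.mono (by omega))).trans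
      fun a ha => hs3 a (by omega) (by omega)
    have := h3 ⟨γ, Code.equiv.symm i⟩ s' ⟨hs' b3, by
      simp only [pushSlot, Code.code, Equiv.apply_symm_apply]
      exact hi⟩
    exact this
  · subst q5 q4
    have k3 := (q3.2.2 (p + 3) (by omega) (by omega)).1.trans
      ((q2.2 (p + 3) (by omega)).1.trans q1.1)
    refine ⟨?_, ?_, ?_, ?_, fun i => ?_, ?_⟩
    · rw [State.idx_setIdx_ne _ _ (by omega), State.idx_setIdx_self]
    · rw [State.idx_setIdx_ne _ _ (by omega), State.idx_setIdx_ne _ _ (by omega), k3]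
    · rw [State.idx_setIdx_self]
    · rw [State.idx_setIdx_ne _ _ (by omega), State.idx_setIdx_ne _ _ (by omega)]
      exact q3.2.1
    · have := slot_mod (J := J) (a := p) i (by omega)
      have n2 : (i : ℕ) * J + p ≠ p + 2 := by
        intro h
        rw [h, hm2] at this
        omega
      have n4 : (i : ℕ) * J + p ≠ p + 4 := by
        intro h
        rw [h, hm4] at this
        omega
      rw [Cell.get_setIdx_ne _ _ n4, Cell.get_setIdx_ne _ _ n2, q3.1 i]
    · exact ((((q1.2.mono (by omega)).trans (q2.2.mono (by omega))).trans
        fun a ha => q3.2.2 a (by omega) (by omega)).setIdx (by omega)).setIdx (by omega)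
  · have e : s7.idx (p + 5) = Code.code (i γ) := q7.1
    have n6 : Code.code (i γ) * J + p ≠ p + 6 := by
      intro h
      have := slot_mod (J := J) (a := p) (Code.code (i γ)) (by omega)
      rw [h, hm6] at this
      omega
    rw [Cell.get_set, State.idx_setIdx_self, e, Cell.get_setIdx_ne _ _ n6,
      q7.2.get (by rw [slot_mod _ (by omega)]; omega)]
    exact hg q6.2.2.2.2.1 (i γ)
  · exact ((q6.2.2.2.2.2.trans (q7.2.mono (by omega))).setIdx (by omega)).set (by omega)

end Iterate

/-! ### Computable predicates, sums and products -/

section Closure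
variable {Γ α : Type} [Ctx Γ] [Cell α]

open Classical in
/-- The predicate `P` of a context can be decided within polynomial time. -/
def Decides (P : Γ → Prop) : Prop := Computes (fun γ => if P γ then 1 else 0)

open Classical in
theorem Computes.ite {P : Γ → Prop} [∀ γ, Decidable (P γ)] (hP : Decides P) {f g : Γ → α}
    (hf : Computes f) (hg : Computes g) : Computes (fun γ => if P γ then f γ else g γ) := by
  refine ((Computes.nat 1).iteLE hP hf hg).congr fun γ => ?_
  by_cases h : P γ <;> simp [h]

theorem Decides.congr {P Q : Γ → Prop} (hP : Decides P) (h : ∀ γ, P γ ↔ Q γ) : Decides Q := by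
  obtain rfl : P = Q := funext fun γ => propext (h γ)
  exact hP

theorem Decides.comp {Δ : Type} [Ctx Δ] {P : Γ → Prop} (hP : Decides P) {π : Δ → Γ}
    (hπ : IsProjection π) : Decides (fun δ => P (π δ)) :=
  Computes.comp hP hπ

theorem Decides.weaken {P : Γ → Prop} (hP : Decides P) {ι : Γ → Type} [∀ γ, Code (ι γ)] :
    Decides (fun p : Ext Γ ι => P p.base) :=
  hP.comp IsProjection.id.base

theorem Decides.const (P : Prop) : Decides (fun _ : Γ => P) := by
  by_cases h : P
  · exact (Computes.nat 1).congr fun _ => by simp [h]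
  · exact (Computes.nat 0).congr fun _ => by simp [h]

theorem Decides.le {f g : Γ → ℕ} (hf : Computes f) (hg : Computes g) :
    Decides (fun γ => f γ ≤ g γ) :=
  (hf.iteLE hg (.nat 1) (.nat 0)).congr fun _ => by congr

theorem Decides.not {P : Γ → Prop} (hP : Decides P) : Decides (fun γ => ¬ P γ) := by
  classical
  refine (Computes.ite hP (.nat 0) (.nat 1)).congr fun γ => ?_
  by_cases h : P γ <;> simp [h]

theorem Decides.and {P Q : Γ → Prop} (hP : Decides P) (hQ : Decides Q) :
    Decides (fun γ => P γ ∧ Q γ) := by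
  classical
  refine (Computes.ite hP hQ (.nat 0)).congr fun γ => ?_
  by_cases h : P γ <;> simp [h]

theorem Decides.or {P Q : Γ → Prop} (hP : Decides P) (hQ : Decides Q) :
    Decides (fun γ => P γ ∨ Q γ) :=
  (hP.not.and hQ.not).not.congr fun _ => by tauto

theorem Decides.imp {P Q : Γ → Prop} (hP : Decides P) (hQ : Decides Q) :
    Decides (fun γ => P γ → Q γ) :=
  (hP.and hQ.not).not.congr fun _ => by tauto

theorem Decides.iff {P Q : Γ → Prop} (hP : Decides P) (hQ : Decides Q) :
    Decides (fun γ => P γ ↔ Q γ) :=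
  ((hP.imp hQ).and (hQ.imp hP)).congr fun _ => by tauto

theorem Decides.lt {f g : Γ → ℕ} (hf : Computes f) (hg : Computes g) :
    Decides (fun γ => f γ < g γ) :=
  (Decides.le hg hf).not.congr fun _ => not_le

theorem Decides.eq {f g : Γ → ℕ} (hf : Computes f) (hg : Computes g) :
    Decides (fun γ => f γ = g γ) :=
  ((Decides.le hf hg).and (Decides.le hg hf)).congr fun _ => le_antisymm_iff.symm

theorem PolyBounded.comp {Δ : Type} [Ctx Δ] {N : Γ → ℕ} (hN : PolyBounded N) {π : Δ → Γ}
    (hπ : IsProjection π) : PolyBounded (fun δ => N (π δ)) := by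
  obtain ⟨h1, B, hB⟩ := hN
  refine ⟨h1.comp hπ, B, fun δ => ?_⟩
  rw [Ctx.size, ← hπ.1 δ]
  exact hB (π δ)

theorem PolyBounded.weaken {N : Γ → ℕ} (hN : PolyBounded N) {ι : Γ → Type} [∀ γ, Code (ι γ)] :
    PolyBounded (fun p : Ext Γ ι => N p.base) :=
  hN.comp IsProjection.id.base

theorem PolyBounded.const (c : ℕ) : PolyBounded (fun _ : Γ => c) :=
  ⟨.nat c, .C c, fun _ => by simp⟩

theorem PolyBounded.of_le {f N : Γ → ℕ} (hf : Computes f) (hN : PolyBounded N)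
    (h : ∀ γ, f γ ≤ N γ) : PolyBounded f := by
  obtain ⟨B, hB⟩ := hN.2
  exact ⟨hf, B, fun γ => (h γ).trans (hB γ)⟩

theorem PolyBounded.size : PolyBounded (fun γ : Γ => Ctx.size γ) :=
  ⟨(Computes.nat 0).word, .X, fun _ => by simp⟩

theorem PolyBounded.add {M N : Γ → ℕ} (hM : PolyBounded M) (hN : PolyBounded N) :
    PolyBounded (fun γ => M γ + N γ) := by
  obtain ⟨h1, A, hA⟩ := hM
  obtain ⟨h2, B, hB⟩ := hN
  refine ⟨h1.add h2, A + B, fun γ => ?_⟩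
  rw [Polynomial.eval_add]
  exact Nat.add_le_add (hA γ) (hB γ)

/-- The number of rounds of a loop serves as a factor. -/
theorem Computes.mulNat {N f : Γ → ℕ} (hN : PolyBounded N) (hf : Computes f) :
    Computes (fun γ => N γ * f γ) :=
  (Computes.natSum hN (F := fun γ _ => f γ) hf.weaken).congr fun γ => by simp

theorem PolyBounded.mul {M N : Γ → ℕ} (hM : PolyBounded M) (hN : PolyBounded N) :
    PolyBounded (fun γ => M γ * N γ) := by
  obtain ⟨A, hA⟩ := hM.2
  obtain ⟨B, hB⟩ := hN.2
  refine ⟨hN.1.mulNat hM, A * B, fun γ => ?_⟩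
  rw [Polynomial.eval_mul]
  exact Nat.mul_le_mul (hA γ) (hB γ)

/-! ### Finite types of polynomial size -/

/-- A family of finite types whose sizes are polynomially bounded and computable. -/
def PolyFam (ι : Γ → Type) [∀ γ, Code (ι γ)] : Prop := PolyBounded fun γ => Code.size (ι γ)

theorem PolyFam.fin {N : Γ → ℕ} (hN : PolyBounded N) : PolyFam (fun γ => Fin (N γ)) := hN

theorem PolyFam.comp {Δ : Type} [Ctx Δ] {ι : Γ → Type} [∀ γ, Code (ι γ)] (hι : PolyFam ι)
    {π : Δ → Γ} (hπ : IsProjection π) : PolyFam (fun δ => ι (π δ)) :=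
  PolyBounded.comp hι hπ

theorem PolyFam.weaken {κ : Γ → Type} [∀ γ, Code (κ γ)] (hκ : PolyFam κ) {ι : Γ → Type}
    [∀ γ, Code (ι γ)] : PolyFam (fun p : Ext Γ ι => κ p.base) :=
  hκ.comp IsProjection.id.base

instance {ι κ : Type} [Code ι] [Code κ] : Code (ι × κ) :=
  ⟨Code.size ι * Code.size κ, (Equiv.prodCongr Code.equiv Code.equiv).trans finProdFinEquiv⟩

/-- Tuples are numbered by iterated pairs. -/
@[reducible]
def Code.tuple (ι : Type) [Code ι] : ∀ d : ℕ, Code (Fin d → ι)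
  | 0 => ⟨1, Equiv.ofUnique _ _⟩
  | d + 1 =>
    letI := Code.tuple ι d
    ⟨Code.size (ι × (Fin d → ι)), (Fin.consEquiv fun _ => ι).symm.trans Code.equiv⟩

instance {ι : Type} [Code ι] {d : ℕ} : Code (Fin d → ι) := Code.tuple ι d

theorem PolyFam.prod {ι κ : Γ → Type} [∀ γ, Code (ι γ)] [∀ γ, Code (κ γ)] (hι : PolyFam ι)
    (hκ : PolyFam κ) : PolyFam (fun γ => ι γ × κ γ) :=
  PolyBounded.mul hι hκ

theorem PolyFam.tuple {ι : Γ → Type} [∀ γ, Code (ι γ)] (hι : PolyFam ι) (d : ℕ) :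
    PolyFam (fun γ => Fin d → ι γ) := by
  induction d with
  | zero => exact PolyBounded.const 1
  | succ d ih => exact PolyFam.prod hι ih

section Sums
variable {ι : Γ → Type} [∀ γ, Code (ι γ)]

/-- A variable may run through the numbers of the elements. -/
theorem IsProjection.decode : IsProjection (fun p : Ext Γ (fun γ => Fin (Code.size (ι γ))) =>
    (⟨p.base, Code.equiv.symm p.top⟩ : Ext Γ ι)) :=
  ⟨fun _ => rfl, fun k => k, fun _ _ p _ hs => ⟨hs.1, by
    rw [hs.2]
    simp only [Code.code, Equiv.apply_symm_apply]
    rfl⟩⟩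

variable [∀ γ, Fintype (ι γ)]

theorem Computes.sumNat (hι : PolyFam ι) {F : ∀ γ, ι γ → ℕ}
    (hF : Computes (fun p : Ext Γ ι => F p.base p.top)) : Computes (fun γ => ∑ i, F γ i) :=
  (Computes.natSum hι (F := fun γ i => F γ (Code.equiv.symm i)) (hF.comp .decode)).congr
    fun _ => Equiv.sum_comp _ _

theorem Computes.sum (hι : PolyFam ι) {F : ∀ γ, ι γ → ℝ}
    (hF : Computes (fun p : Ext Γ ι => F p.base p.top)) : Computes (fun γ => ∑ i, F γ i) :=
  (Computes.realSum hι (F := fun γ i => F γ (Code.equiv.symm i)) (hF.comp .decode)).congr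
    fun _ => Equiv.sum_comp _ _

end Sums

/-- The priority is low, so that sums over types with an instance of their own use the latter. -/
instance (priority := low) Code.toFintype {ι : Type} [Code ι] : Fintype ι :=
  Fintype.ofEquiv _ Code.equiv.symm

section Quantifiers
variable {ι κ : Γ → Type} [∀ γ, Code (ι γ)] [∀ γ, Code (κ γ)]

theorem Decides.exists (hι : PolyFam ι) {P : ∀ γ, ι γ → Prop}
    (hP : Decides (fun p : Ext Γ ι => P p.base p.top)) : Decides (fun γ => ∃ i, P γ i) := by
  classical
  refine (Decides.lt (.nat 0) (Computes.sumNat hι (F := fun γ i => if P γ i then 1 else 0)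
    (hP.congr fun γ => ?_))).congr fun γ => ?_
  · rfl
  · simp [Finset.card_pos, Finset.filter_nonempty_iff]

theorem Decides.forall (hι : PolyFam ι) {P : ∀ γ, ι γ → Prop}
    (hP : Decides (fun p : Ext Γ ι => P p.base p.top)) : Decides (fun γ => ∀ i, P γ i) :=
  (Decides.exists hι (P := fun γ i => ¬ P γ i) hP.not).not.congr fun _ => by push Not; rfl

/-- The element `f γ` of a finite type can be computed, as a number. -/
def Indexes (f : ∀ γ, ι γ) : Prop := Computes fun γ => Code.code (f γ)

theorem Indexes.comp {Δ : Type} [Ctx Δ] {f : ∀ γ, ι γ} (hf : Indexes f) {π : Δ → Γ}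
    (hπ : IsProjection π) : Indexes (fun δ => f (π δ)) :=
  Computes.comp hf hπ

theorem Indexes.weaken {f : ∀ γ, ι γ} (hf : Indexes f) :
    Indexes (fun p : Ext Γ κ => f p.base) :=
  Computes.weaken hf

theorem Indexes.top : Indexes (fun p : Ext Γ ι => p.top) := Computes.top

theorem Indexes.congr {f g : ∀ γ, ι γ} (hf : Indexes f) (h : ∀ γ, f γ = g γ) : Indexes g := by
  obtain rfl : f = g := funext h
  exact hf

theorem Indexes.eq {f g : ∀ γ, ι γ} (hf : Indexes f) (hg : Indexes g) :
    Decides (fun γ => f γ = g γ) :=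
  (Decides.eq (f := fun γ => Code.code (f γ)) hf hg).congr fun _ => Code.code_injective.eq_iff

theorem Indexes.ite {P : Γ → Prop} [∀ γ, Decidable (P γ)] (hP : Decides P) {f g : ∀ γ, ι γ}
    (hf : Indexes f) (hg : Indexes g) : Indexes (fun γ => if P γ then f γ else g γ) :=
  (Computes.ite hP hf hg).congr fun γ => by by_cases h : P γ <;> simp [h]

/-- An element of a finite type can be found by searching if it can be recognized. -/
theorem Indexes.search (hι : PolyFam ι) {f : ∀ γ, ι γ}
    (h : Decides (fun p : Ext Γ ι => p.top = f p.base)) : Indexes f := by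
  classical
  refine (Computes.sumNat hι (F := fun γ i => if i = f γ then Code.code i else 0)
    (Computes.ite h .top (.nat 0))).congr fun γ => ?_
  simp

theorem Indexes.pair (hκ : PolyFam κ) {f : ∀ γ, ι γ} {g : ∀ γ, κ γ} (hf : Indexes f)
    (hg : Indexes g) : Indexes (fun γ => (f γ, g γ)) :=
  Computes.add hg (Computes.mulNat hκ hf)

theorem Indexes.fst (hι : PolyFam ι) (hκ : PolyFam κ) {f : ∀ γ, ι γ × κ γ} (hf : Indexes f) :
    Indexes (fun γ => (f γ).1) := by
  refine .search hι ((Decides.exists hκ.weaken (P := fun (p : Ext Γ ι) b => (p.top, b) = f p.base)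
    (Indexes.eq (Indexes.pair hκ.weaken.weaken Indexes.top.weaken .top) hf.weaken.weaken)).congr
    fun γ => ⟨?_, fun h => ⟨(f γ.base).2, by rw [h]⟩⟩)
  rintro ⟨b, hb⟩
  rw [← hb]

theorem Indexes.snd (hι : PolyFam ι) (hκ : PolyFam κ) {f : ∀ γ, ι γ × κ γ} (hf : Indexes f) :
    Indexes (fun γ => (f γ).2) := by
  refine .search hκ ((Decides.exists hι.weaken (P := fun (p : Ext Γ κ) b => (b, p.top) = f p.base)
    (Indexes.eq (Indexes.pair hκ.weaken.weaken .top Indexes.top.weaken) hf.weaken.weaken)).congr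
    fun γ => ⟨?_, fun h => ⟨(f γ.base).1, by rw [h]⟩⟩)
  rintro ⟨b, hb⟩
  rw [← hb]

theorem Indexes.apply (hι : PolyFam ι) {d : ℕ} {S : ∀ γ, Fin d → ι γ} (hS : Indexes S)
    (j : Fin d) : Indexes (fun γ => S γ j) := by
  induction d with
  | zero => exact j.elim0
  | succ d ih =>
    have h : Indexes (fun γ => (S γ 0, Fin.tail (S γ))) := hS
    induction j using Fin.cases with
    | zero => exact h.fst hι (hι.tuple d)
    | succ j => exact ih (h.snd hι (hι.tuple d)) j

theorem Indexes.tuple (hι : PolyFam ι) {d : ℕ} {S : ∀ γ, Fin d → ι γ}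
    (hS : ∀ j, Indexes (fun γ => S γ j)) : Indexes S := by
  induction d with
  | zero =>
    exact (Computes.nat 0).congr fun γ => (Nat.lt_one_iff.mp (Code.code_lt (S γ))).symm
  | succ d ih =>
    exact Indexes.pair (hι.tuple d) (hS 0) (ih fun j => hS j.succ)

theorem Indexes.update (hι : PolyFam ι) {d : ℕ} {S : ∀ γ, Fin d → ι γ} (hS : Indexes S)
    {i : Γ → Fin d} (hi : Indexes i) {x : ∀ γ, ι γ} (hx : Indexes x) :
    Indexes (fun γ => Function.update (S γ) (i γ) (x γ)) := by
  refine .tuple hι fun j => ?_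
  refine (Indexes.ite (P := fun γ => j = i γ) (Indexes.eq (.nat j) hi) hx (hS.apply hι j)).congr
    fun γ => ?_
  simp [Function.update_apply]

end Quantifiers

/-- Case distinction on the values of a variable with a fixed finite range. -/
theorem Computes.cases {c : ℕ} {t : Γ → Fin c} (ht : Indexes t) {F : Fin c → Γ → α}
    (hF : ∀ j, Computes (F j)) : Computes (fun γ => F (t γ) γ) := by
  classical
  rcases isEmpty_or_nonempty Γ with hΓ | ⟨⟨γ₀⟩⟩
  · exact ⟨0, fun J p sl _ _ => ⟨.skip, 0, fun γ => hΓ.elim γ⟩⟩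
  · have key : ∀ m ≤ c, Computes (fun γ => if (t γ : ℕ) < m then F (t γ) γ else F (t γ₀) γ) := by
      intro m
      induction m with
      | zero => exact fun _ => (hF (t γ₀)).congr fun γ => by simp
      | succ m ih =>
        intro hm
        refine (Computes.ite (P := fun γ => t γ = ⟨m, hm⟩) (Indexes.eq ht (.nat m)) (hF ⟨m, hm⟩)
          (ih (by omega))).congr fun γ => ?_
        by_cases h : t γ = ⟨m, hm⟩
        · simp [h]
        · have : (t γ : ℕ) ≠ m := fun h' => h (Fin.ext h')
          have h2 : (t γ : ℕ) < m + 1 ↔ (t γ : ℕ) < m := by omega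
          simp only [h, if_false, h2]
    exact (key c le_rfl).congr fun γ => by simp

theorem Indexes.applyVar {ι : Γ → Type} [∀ γ, Code (ι γ)] (hι : PolyFam ι) {d : ℕ}
    {S : ∀ γ, Fin d → ι γ} (hS : Indexes S) {i : Γ → Fin d} (hi : Indexes i) :
    Indexes (fun γ => S γ (i γ)) :=
  Computes.cases hi (F := fun j γ => Code.code (S γ j)) fun j => hS.apply hι j

/-- Substitution of a computable element for a variable. -/
theorem Computes.subst {ι : Γ → Type} [∀ γ, Code (ι γ)] (hι : PolyFam ι) {i : ∀ γ, ι γ}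
    (hi : Indexes i) {F : ∀ γ, ι γ → ℝ} (hF : Computes (fun p : Ext Γ ι => F p.base p.top)) :
    Computes (fun γ => F γ (i γ)) := by
  classical
  refine (Computes.sum hι (F := fun γ j => if j = i γ then F γ j else 0)
    (Computes.ite (Indexes.eq .top hi.weaken) hF
      (by simpa using Computes.int (Γ := Ext Γ ι) 0))).congr fun γ => ?_
  simp

theorem Computes.finsetProd {κ : Type} (s : Finset κ) {F : κ → Γ → ℝ}
    (hF : ∀ j, Computes (F j)) : Computes (fun γ => ∏ j ∈ s, F j γ) := by
  classical
  induction s using Finset.induction_on with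
  | empty => simpa using Computes.int (Γ := Γ) 1
  | insert a s ha ih => exact ((hF a).mulReal ih).congr fun γ => by rw [Finset.prod_insert ha]

theorem Computes.finsetSum {κ : Type} (s : Finset κ) {F : κ → Γ → ℝ}
    (hF : ∀ j, Computes (F j)) : Computes (fun γ => ∑ j ∈ s, F j γ) := by
  classical
  induction s using Finset.induction_on with
  | empty => simpa using Computes.int (Γ := Γ) 0
  | insert a s ha ih => exact ((hF a).addReal ih).congr fun γ => by rw [Finset.sum_insert ha]

theorem Decides.forallFinite {κ : Type} [Finite κ] {P : κ → Γ → Prop}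
    (hP : ∀ j, Decides (P j)) : Decides (fun γ => ∀ j, P j γ) := by
  classical
  have := Fintype.ofFinite κ
  have key : ∀ s : Finset κ, Decides (fun γ => ∀ j ∈ s, P j γ) := by
    intro s
    induction s using Finset.induction_on with
    | empty => simpa using Decides.const True
    | insert a s ha ih => exact ((hP a).and ih).congr fun γ => by simp
  exact (key Finset.univ).congr fun γ => by simp

theorem Decides.existsFinite {κ : Type} [Finite κ] {P : κ → Γ → Prop}
    (hP : ∀ j, Decides (P j)) : Decides (fun γ => ∃ j, P j γ) :=
  (Decides.forallFinite fun j => (hP j).not).not.congr fun _ => by push Not; rfl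

theorem Computes.pow {f : Γ → ℝ} (hf : Computes f) {N : Γ → ℕ} (hN : PolyBounded N) :
    Computes (fun γ => f γ ^ N γ) :=
  (Computes.realProd hN (F := fun γ _ => f γ) hf.weaken).congr fun γ => by simp

/-! ### Recursion by rounds -/

/-- `Computes.iterate`, with a step that is computable in every context in which the counter, the
table and the index are. -/
theorem Computes.iterateIn {ι : Γ → Type} [∀ γ, Code (ι γ)] (hι : PolyFam ι) {R : Γ → ℕ}
    (hR : PolyBounded R) {X : Γ → Type} (rd : ∀ γ, X γ → ι γ → α) (T : ∀ γ, ℕ → X γ)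
    (step : ∀ γ, Fin (R γ) → X γ → X γ)
    (hstep : ∀ {Δ : Type} [Ctx Δ] (π : Δ → Γ) (r : ∀ δ, Fin (R (π δ))) (t : ∀ δ, X (π δ))
      (i : ∀ δ, ι (π δ)), IsProjection π → Indexes r → Indexes i →
      (∀ {Δ' : Type} [Ctx Δ'] (π' : Δ' → Δ) (i' : ∀ δ, ι (π (π' δ))), IsProjection π' →
        Indexes i' → Computes (fun δ => rd (π (π' δ)) (t (π' δ)) (i' δ))) →
      Computes (fun δ => rd (π δ) (step (π δ) (r δ) (t δ)) (i δ)))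
    (h0 : Computes fun p : Ext Γ ι => rd p.base (T p.base 0) p.top)
    (hT : ∀ γ (r : Fin (R γ)), T γ (r + 1) = step γ r (T γ r))
    {i : ∀ γ, ι γ} (hi : Indexes i) : Computes (fun γ => rd γ (T γ (R γ)) (i γ)) := by
  refine Computes.iterate hι hR rd T step ?_ h0 hT hi
  refine hstep (Δ := Ext (TExt (Ext Γ fun γ => Fin (R γ)) (fun q => ι q.base) (fun q => X q.base)
    (fun q => rd q.base)) (fun q => ι q.base.base)) (fun p => p.base.base.base)
    (fun p => p.base.base.top) (fun p => p.base.tab) (fun p => p.top)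
    IsProjection.id.base.baseTab.base (Computes.weaken (Computes.weakenTab Computes.top)) .top ?_
  intro Δ' _ π' i' hπ' hi'
  exact Computes.lookup (π := fun δ => (π' δ).base) (IsProjection.id.base.trans hπ') hi'

theorem Decides.iterateIn {ι : Γ → Type} [∀ γ, Code (ι γ)] (hι : PolyFam ι) {R : Γ → ℕ}
    (hR : PolyBounded R) (T : ∀ γ, ℕ → ι γ → Prop)
    (step : ∀ γ, Fin (R γ) → (ι γ → Prop) → ι γ → Prop)
    (hstep : ∀ {Δ : Type} [Ctx Δ] (π : Δ → Γ) (r : ∀ δ, Fin (R (π δ))) (t : ∀ δ, ι (π δ) → Prop)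
      (i : ∀ δ, ι (π δ)), IsProjection π → Indexes r → Indexes i →
      (∀ {Δ' : Type} [Ctx Δ'] (π' : Δ' → Δ) (i' : ∀ δ, ι (π (π' δ))), IsProjection π' →
        Indexes i' → Decides (fun δ => t (π' δ) (i' δ))) →
      Decides (fun δ => step (π δ) (r δ) (t δ) (i δ)))
    (h0 : Decides fun p : Ext Γ ι => T p.base 0 p.top)
    (hT : ∀ γ (r : Fin (R γ)), T γ (r + 1) = step γ r (T γ r))
    {i : ∀ γ, ι γ} (hi : Indexes i) : Decides (fun γ => T γ (R γ) (i γ)) :=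
  open Classical in
  Computes.iterateIn hι hR (X := fun γ => ι γ → Prop) (fun _ t i => if t i then 1 else 0) T step
    hstep h0 hT hi

end Closure

/-! ### Computing with polynomials -/

section Poly
variable {Γ : Type} [Ctx Γ] {d : ℕ}

/-- The exponents of a monomial in `d` variables all of whose exponents are less than `L`. -/
noncomputable def boxExponents {L : ℕ} (m : Fin d → Fin L) : Fin d →₀ ℕ :=
  Finsupp.equivFunOnFinite.symm fun j => (m j : ℕ)

@[simp] theorem boxExponents_apply {L : ℕ} (m : Fin d → Fin L) (j : Fin d) :
    boxExponents m j = m j := rfl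

/-- The coefficients of the polynomial `f γ` at the monomials with exponents less than `L γ` can be
computed within polynomial time. -/
def ComputesPoly (L : Γ → ℕ) (f : Γ → MvPolynomial (Fin d) ℝ) : Prop :=
  Computes fun p : Ext Γ fun γ => Fin d → Fin (L γ) => (f p.base).coeff (boxExponents p.top)

variable {L : Γ → ℕ}

theorem ComputesPoly.congr {f g : Γ → MvPolynomial (Fin d) ℝ} (hf : ComputesPoly L f)
    (h : ∀ γ, f γ = g γ) : ComputesPoly L g := by
  obtain rfl : f = g := funext h
  exact hf

theorem ComputesPoly.monomial (hL : PolyBounded L) {e : Γ → Fin d →₀ ℕ}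
    (he : ∀ j, Computes fun γ => e γ j) {r : Γ → ℝ} (hr : Computes r) :
    ComputesPoly L (fun γ => MvPolynomial.monomial (e γ) (r γ)) := by
  classical
  refine (Computes.ite (P := fun p : Ext Γ fun γ => Fin d → Fin (L γ) =>
    ∀ j, e p.base j = p.top j) (Decides.forallFinite fun j => Decides.eq (he j).weaken
      (Indexes.apply (PolyFam.fin hL).weaken .top j)) hr.weaken
    (by simpa using Computes.int (Γ := Ext Γ fun γ => Fin d → Fin (L γ)) 0)).congr fun p => ?_
  rw [MvPolynomial.coeff_monomial]
  congr 1
  exact propext (Finsupp.ext_iff (f := e p.base) (g := boxExponents p.top)).symm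

theorem ComputesPoly.C (hL : PolyBounded L) {r : Γ → ℝ} (hr : Computes r) :
    ComputesPoly L (fun γ => (MvPolynomial.C (r γ) : MvPolynomial (Fin d) ℝ)) :=
  ComputesPoly.monomial hL (e := fun _ => 0) (fun _ => .nat 0) hr

theorem ComputesPoly.int (hL : PolyBounded L) (c : ℤ) :
    ComputesPoly L (fun _ => (c : MvPolynomial (Fin d) ℝ)) :=
  (ComputesPoly.C hL (.int c)).congr fun _ => by simp

theorem ComputesPoly.X (hL : PolyBounded L) {j : Γ → Fin d} (hj : Indexes j) :
    ComputesPoly L (fun γ => (MvPolynomial.X (j γ) : MvPolynomial (Fin d) ℝ)) := by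
  classical
  refine ComputesPoly.monomial hL (e := fun γ => Finsupp.single (j γ) 1) (fun i => ?_)
    (by simpa using Computes.int (Γ := Γ) 1)
  exact (Computes.ite (P := fun γ => j γ = i) (Indexes.eq hj (.nat i)) (.nat 1) (.nat 0)).congr
    fun γ => (Finsupp.single_apply).symm

theorem ComputesPoly.ite {P : Γ → Prop} [∀ γ, Decidable (P γ)] (hP : Decides P)
    {f g : Γ → MvPolynomial (Fin d) ℝ} (hf : ComputesPoly L f) (hg : ComputesPoly L g) :
    ComputesPoly L (fun γ => if P γ then f γ else g γ) :=
  (Computes.ite (P := fun p : Ext Γ fun γ => Fin d → Fin (L γ) => P p.base) hP.weaken hf hg).congr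
    fun p => by by_cases h : P p.base <;> simp [h]

/-- The exponents of the factors of a monomial within the box lie in the box, too. -/
theorem coeff_mul_box {L : ℕ} (f g : MvPolynomial (Fin d) ℝ) (m : Fin d → Fin L) :
    (f * g).coeff (boxExponents m) = ∑ a : Fin d → Fin L, ∑ c : Fin d → Fin L,
      if ∀ j, (a j : ℕ) + c j = m j then
        f.coeff (boxExponents a) * g.coeff (boxExponents c) else 0 := by
  classical
  rw [MvPolynomial.coeff_mul, ← Fintype.sum_prod_type', ← Finset.sum_filter]
  symm
  refine Finset.sum_bij (fun q _ => (boxExponents q.1, boxExponents q.2)) ?_ ?_ ?_ ?_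
  · intro q hq
    simp only [Finset.mem_filter, Finset.mem_univ, true_and] at hq
    rw [Finset.HasAntidiagonal.mem_antidiagonal]
    ext j
    simpa using hq j
  · intro q _ q' _ h
    have h1 : ∀ j, (q.1 j : ℕ) = q'.1 j := fun j => DFunLike.congr_fun (congrArg Prod.fst h) j
    have h2 : ∀ j, (q.2 j : ℕ) = q'.2 j := fun j => DFunLike.congr_fun (congrArg Prod.snd h) j
    exact Prod.ext (funext fun j => Fin.ext (h1 j)) (funext fun j => Fin.ext (h2 j))
  · rintro ⟨a, c⟩ h
    rw [Finset.HasAntidiagonal.mem_antidiagonal] at h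
    have hj : ∀ j, a j + c j = m j := fun j => DFunLike.congr_fun h j
    refine ⟨(fun j => ⟨a j, by have := hj j; have := (m j).2; omega⟩,
      fun j => ⟨c j, by have := hj j; have := (m j).2; omega⟩), by simpa using hj, ?_⟩
    refine Prod.ext (Finsupp.ext fun j => ?_) (Finsupp.ext fun j => ?_) <;> simp
  · intro q _
    rfl

theorem ComputesPoly.mul (hL : PolyBounded L) {f g : Γ → MvPolynomial (Fin d) ℝ}
    (hf : ComputesPoly L f) (hg : ComputesPoly L g) : ComputesPoly L (fun γ => f γ * g γ) := by
  have hβ : PolyFam (fun γ => Fin d → Fin (L γ)) := (PolyFam.fin hL).tuple d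
  refine (Computes.sum (hβ.weaken (ι := fun γ => Fin d → Fin (L γ)))
    (F := fun p a => ∑ c : Fin d → Fin (L p.base), if ∀ j, (a j : ℕ) + c j = p.top j then
        (f p.base).coeff (boxExponents a) * (g p.base).coeff (boxExponents c) else 0) ?_).congr
    fun p => (coeff_mul_box _ _ _).symm
  refine Computes.sum (hβ.weaken.weaken)
    (F := fun (p : Ext (Ext Γ fun γ => Fin d → Fin (L γ)) fun p => Fin d → Fin (L p.base)) c =>
      if ∀ j, (p.top j : ℕ) + c j = p.base.top j then (f p.base.base).coeff (boxExponents p.top) *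
        (g p.base.base).coeff (boxExponents c) else 0) ?_
  have hV := (PolyFam.fin hL).weaken (ι := fun γ => Fin d → Fin (L γ))
    |>.weaken (ι := fun p => Fin d → Fin (L p.base))
    |>.weaken (ι := fun p => Fin d → Fin (L p.base.base))
  refine Computes.ite (Decides.forallFinite fun j => Decides.eq (Computes.add ?_ ?_) ?_)
    (Computes.mulReal ?_ ?_) (by simpa using Computes.int 0)
  · exact Indexes.apply hV Indexes.top.weaken j
  · exact Indexes.apply hV .top j
  · exact Indexes.apply hV Indexes.top.weaken.weaken j
  · exact Computes.comp hf (IsProjection.id.base.ext.base)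
  · exact Computes.comp hg (IsProjection.id.base.base.ext)

theorem ComputesPoly.sum {ι : Γ → Type} [∀ γ, Code (ι γ)] [∀ γ, Fintype (ι γ)] (hι : PolyFam ι)
    {F : ∀ γ, ι γ → MvPolynomial (Fin d) ℝ}
    (hF : ComputesPoly (fun p : Ext Γ ι => L p.base) (fun p => F p.base p.top)) :
    ComputesPoly L (fun γ => ∑ i, F γ i) := by
  have h : Computes fun p : Ext (Ext Γ ι) fun p => Fin d → Fin (L p.base) =>
    (F p.base.base p.base.top).coeff (boxExponents p.top) := hF
  exact (Computes.sum (ι := fun p : Ext Γ fun γ => Fin d → Fin (L γ) => ι p.base) hι.weaken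
    (F := fun p i => (F p.base i).coeff (boxExponents p.top))
    (h.comp (IsProjection.swap (ι := fun γ => Fin d → Fin (L γ)) (κ := ι)))).congr
    fun _ => (MvPolynomial.coeff_sum _ _ _).symm

/-- Tables of polynomials that are computed in rounds. -/
theorem ComputesPoly.iterate (hL : PolyBounded L) {ι : Γ → Type} [∀ γ, Code (ι γ)]
    (hι : PolyFam ι) {R : Γ → ℕ} (hR : PolyBounded R)
    (T : ∀ γ, ℕ → ι γ → MvPolynomial (Fin d) ℝ)
    (step : ∀ γ, Fin (R γ) → (ι γ → MvPolynomial (Fin d) ℝ) → ι γ → MvPolynomial (Fin d) ℝ)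
    (hstep : ∀ {Δ : Type} [Ctx Δ] (π : Δ → Γ) (r : ∀ δ, Fin (R (π δ)))
      (t : ∀ δ, ι (π δ) → MvPolynomial (Fin d) ℝ) (i : ∀ δ, ι (π δ)), IsProjection π → Indexes r →
      Indexes i →
      (∀ {Δ' : Type} [Ctx Δ'] (π' : Δ' → Δ) (i' : ∀ δ, ι (π (π' δ))), IsProjection π' →
        Indexes i' → ComputesPoly (fun δ => L (π (π' δ))) (fun δ => t (π' δ) (i' δ))) →
      ComputesPoly (fun δ => L (π δ)) (fun δ => step (π δ) (r δ) (t δ) (i δ)))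
    (h0 : ComputesPoly (fun p : Ext Γ ι => L p.base) (fun p => T p.base 0 p.top))
    (hT : ∀ γ (r : Fin (R γ)), T γ (r + 1) = step γ r (T γ r))
    {i : ∀ γ, ι γ} (hi : Indexes i) : ComputesPoly L (fun γ => T γ (R γ) (i γ)) := by
  have hβ : PolyFam (fun γ => Fin d → Fin (L γ)) := (PolyFam.fin hL).tuple d
  -- the table has one entry for each polynomial and each monomial of the box
  refine Computes.iterateIn (Γ := Ext Γ fun γ => Fin d → Fin (L γ))
    (ι := fun p => ι p.base × (Fin d → Fin (L p.base))) (hι.weaken.prod hβ.weaken) hR.weaken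
    (X := fun p => ι p.base → MvPolynomial (Fin d) ℝ)
    (fun _ t q => (t q.1).coeff (boxExponents q.2)) (fun p => T p.base) (fun p => step p.base)
    ?_ ?_ (fun p r => hT p.base r) (i := fun p => (i p.base, p.top))
    (Indexes.pair hβ.weaken hi.weaken .top)
  · intro Δ _ π r t i hπ hr hi ht
    have hπ' : IsProjection (fun δ => (π δ).base) := IsProjection.id.base.trans hπ
    have h1 : Indexes fun δ => (i δ).1 := hi.fst (hι.comp hπ') (hβ.comp hπ')
    have h2 : Indexes fun δ => (i δ).2 := hi.snd (hι.comp hπ') (hβ.comp hπ')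
    have h := hstep (fun δ => (π δ).base) r t _ hπ' hr h1 fun {Δ'} _ π' i' hp hi' => by
      have := ht (fun q : Ext Δ' fun q => Fin d → Fin (L (π (π' q)).base) => π' q.base)
        (fun q => (i' q.base, q.top)) hp.base
        (Indexes.pair (hβ.comp (hπ'.trans hp.base)) hi'.weaken .top)
      exact this
    exact Computes.subst (ι := fun δ => Fin d → Fin (L (π δ).base))
      (F := fun δ m => (step (π δ).base (r δ) (t δ) (i δ).1).coeff (boxExponents m))
      (hβ.comp hπ') h2 h
  · have hπ : IsProjection (fun q : Ext (Ext Γ fun γ => Fin d → Fin (L γ))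
      (fun p => ι p.base × (Fin d → Fin (L p.base))) => q.base.base) := IsProjection.id.base.base
    have h1 := Indexes.fst (hι.comp hπ) (hβ.comp hπ) Indexes.top
    have h2 := Indexes.snd (hι.comp hπ) (hβ.comp hπ) Indexes.top
    refine Computes.subst (F := fun (q : Ext (Ext Γ fun γ => Fin d → Fin (L γ))
      (fun p => ι p.base × (Fin d → Fin (L p.base)))) m =>
        (T q.base.base 0 q.top.1).coeff (boxExponents m)) (hβ.comp hπ) h2 ?_
    refine Computes.subst (F := fun (q : Ext (Ext (Ext Γ fun γ => Fin d → Fin (L γ))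
      (fun p => ι p.base × (Fin d → Fin (L p.base)))) fun q => Fin d → Fin (L q.base.base)) j =>
        (T q.base.base.base 0 j).coeff (boxExponents q.top)) (hι.comp hπ).weaken h1.weaken ?_
    have h0' : Computes (fun p : Ext (Ext Γ ι) fun p => Fin d → Fin (L p.base) =>
      (T p.base.base 0 p.base.top).coeff (boxExponents p.top)) := h0
    exact (h0'.comp (IsProjection.swap (ι := fun γ => Fin d → Fin (L γ)) (κ := ι))).comp hπ.ext.ext

/-- A product is computed by multiplying one factor per round. -/
theorem ComputesPoly.prod (hL : PolyBounded L) {N : Γ → ℕ} (hN : PolyBounded N)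
    {F : ∀ γ, Fin (N γ) → MvPolynomial (Fin d) ℝ}
    (hF : ComputesPoly (fun p : Ext Γ fun γ => Fin (N γ) => L p.base) (fun p => F p.base p.top)) :
    ComputesPoly L (fun γ => ∏ i, F γ i) := by
  refine (ComputesPoly.iterate hL (ι := fun _ => Fin 1) (PolyFam.fin (.const 1)) hN
    (fun γ r _ => ∏ i ∈ Finset.range r, if h : i < N γ then F γ ⟨i, h⟩ else 1)
    (fun γ r t _ => t 0 * F γ r) ?_ ((ComputesPoly.int hL.weaken 1).congr fun p => by simp)
    (fun γ r => funext fun _ => ?_) (i := fun _ => 0) (.nat 0)).congr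
    fun γ => (Finset.prod_range _).trans (by simp)
  · intro Δ _ π r t i hπ hr hi ht
    refine ComputesPoly.mul (hL.comp hπ) (ht (fun δ => δ) (fun _ => 0) .id (.nat 0)) ?_
    have hF' : Computes (fun p : Ext (Ext Γ fun γ => Fin (N γ)) fun p => Fin d → Fin (L p.base) =>
      (F p.base.base p.base.top).coeff (boxExponents p.top)) := hF
    refine Computes.subst (ι := fun p : Ext Δ fun δ => Fin d → Fin (L (π δ)) =>
      Fin (N (π p.base))) (F := fun p r => (F (π p.base) r).coeff (boxExponents p.top))
      (PolyFam.fin (hN.comp hπ.base)) hr.weaken ?_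
    exact (hF'.comp (IsProjection.swap (ι := fun γ => Fin d → Fin (L γ))
      (κ := fun γ => Fin (N γ)))).comp hπ.ext.ext
  · rw [Finset.prod_range_succ, dif_pos r.2]

theorem ComputesPoly.cases {c : ℕ} {t : Γ → Fin c} (ht : Indexes t)
    {F : Fin c → Γ → MvPolynomial (Fin d) ℝ} (hF : ∀ j, ComputesPoly L (F j)) :
    ComputesPoly L (fun γ => F (t γ) γ) :=
  Computes.cases (t := fun p : Ext Γ fun γ => Fin d → Fin (L γ) => t p.base)
    (F := fun j p => (F j p.base).coeff (boxExponents p.top)) ht.weaken hF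

end Poly

/-! ### Tree decompositions -/

section Tree
variable {V I : Type}

open SimpleGraph

/-- A walk that ends in `A` has an initial part that meets `A` in its last vertex only. -/
theorem exists_first_hit {T : SimpleGraph I} {A : Set I} {t j : I} (w : T.Walk t j) (hj : j ∈ A) :
    ∃ i ∈ A, ∃ r : T.Walk t i, ∀ y ∈ r.support, y ∈ A → y = i := by
  induction w with
  | nil => exact ⟨_, hj, .nil, by simp⟩
  | @cons a b c hab w ih =>
    by_cases ha : a ∈ A
    · exact ⟨a, ha, .nil, by simp⟩
    · obtain ⟨i, hi, r, hr⟩ := ih hj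
      refine ⟨i, hi, .cons hab r, fun y hy hyA => ?_⟩
      rw [Walk.support_cons, List.mem_cons] at hy
      rcases hy with rfl | hy
      · exact absurd hyA ha
      · exact hr y hy hyA

/-- Gates in trees: all walks from `t` to a connected set `A` of nodes enter `A` through the same
node `i`. -/
theorem exists_gate {T : SimpleGraph I} (hT : T.IsTree) {A : Set I} {j₀ : I} (hj₀ : j₀ ∈ A)
    (hA : ∀ i ∈ A, ∀ j ∈ A, ∃ w : T.Walk i j, ∀ y ∈ w.support, y ∈ A) (t : I) :
    ∃ i ∈ A, ∀ j ∈ A, ∀ w : T.Walk t j, i ∈ w.support := by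
  classical
  obtain ⟨w₀⟩ := hT.connected.preconnected t j₀
  obtain ⟨i, hi, r, hr⟩ := exists_first_hit w₀ hj₀
  refine ⟨i, hi, fun j hj w => ?_⟩
  obtain ⟨q, hq⟩ := hA i hi j hj
  have hpath : (r.bypass.append q.bypass).IsPath := by
    rw [Walk.isPath_def, Walk.support_append, List.nodup_append]
    refine ⟨r.bypass_isPath.support_nodup, q.bypass_isPath.support_nodup.tail, ?_⟩
    rintro a ha b hb rfl
    have h1 := hq a (q.support_bypass_subset_support (List.mem_of_mem_tail hb))
    have h2 := hr a (r.support_bypass_subset_support ha) h1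
    subst h2
    have := q.bypass_isPath.support_nodup
    rw [← Walk.cons_tail_support] at this
    exact (List.nodup_cons.mp this).1 hb
  have huniq : (⟨_, hpath⟩ : T.Path t j) = ⟨_, w.bypass_isPath⟩ :=
    (hT.isAcyclic.subsingleton_path t j).elim _ _
  have h : i ∈ (r.bypass.append q.bypass).support := by
    rw [Walk.mem_support_append_iff]
    exact Or.inl r.bypass.end_mem_support
  rw [Subtype.mk.inj huniq] at h
  exact w.support_bypass_subset_support h

/-- The nodes of a tree decomposition whose bags contain a given vertex are connected by walks. -/
theorem IsTreeDecomposition.exists_walk {G : SimpleGraph V} {T : SimpleGraph I} {bag : I → Finset V}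
    (h : IsTreeDecomposition G T bag) {a : V} {i j : I} (hi : a ∈ bag i) (hj : a ∈ bag j) :
    ∃ w : T.Walk i j, ∀ y ∈ w.support, a ∈ bag y := by
  obtain ⟨w⟩ := (h.connected a).preconnected ⟨i, hi⟩ ⟨j, hj⟩
  let f : T.induce {i | a ∈ bag i} →g T := ⟨Subtype.val, fun h => h⟩
  refine ⟨w.map f, fun y hy => ?_⟩
  have hy' : y ∈ (w.map f).support := hy
  rw [Walk.support_map, List.mem_map] at hy'
  obtain ⟨z, -, rfl⟩ := hy'
  exact z.2

/-- If the neighbours of a connected set of vertices lie in one bag, then they lie in one bag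
together with some vertex of the set. Here the set consists of the vertices that can be reached from
`v` by `R`-steps along edges. -/
theorem IsTreeDecomposition.exists_bag {G : SimpleGraph V} {T : SimpleGraph I}
    {bag : I → Finset V} (h : IsTreeDecomposition G T bag) {R : V → V → Prop}
    (hR : ∀ a c, R a c → G.Adj a c) {v : V} {t : I}
    (ht : ∀ s a, Relation.ReflTransGen R v a → ¬ Relation.ReflTransGen R v s → G.Adj a s →
      s ∈ bag t) :
    ∃ i x, Relation.ReflTransGen R v x ∧ x ∈ bag i ∧
      ∀ s a, Relation.ReflTransGen R v a → ¬ Relation.ReflTransGen R v s → G.Adj a s →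
        s ∈ bag i := by
  set A : Set I := {i | ∃ x, Relation.ReflTransGen R v x ∧ x ∈ bag i} with hA
  obtain ⟨i₀, hi₀⟩ := h.cover v
  have conn : ∀ y, Relation.ReflTransGen R v y → ∀ j, y ∈ bag j →
      ∃ w : T.Walk i₀ j, ∀ z ∈ w.support, z ∈ A := by
    intro y hy
    induction hy with
    | refl =>
      intro j hj
      obtain ⟨w, hw⟩ := h.exists_walk hi₀ hj
      exact ⟨w, fun z hz => ⟨v, .refl, hw z hz⟩⟩
    | @tail y y' hy hyy' ih =>
      intro j hj
      obtain ⟨j', h1, h2⟩ := h.edge y y' (hR _ _ hyy')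
      obtain ⟨w, hw⟩ := ih j' h1
      obtain ⟨w', hw'⟩ := h.exists_walk h2 hj
      refine ⟨w.append w', fun z hz => ?_⟩
      rw [Walk.mem_support_append_iff] at hz
      rcases hz with hz | hz
      · exact hw z hz
      · exact ⟨y', hy.tail hyy', hw' z hz⟩
  have hi₀A : i₀ ∈ A := ⟨v, .refl, hi₀⟩
  obtain ⟨i, ⟨x, hx, hxi⟩, hi⟩ := exists_gate h.isTree hi₀A (fun i hi j hj => by
    obtain ⟨x, hx, hxi⟩ := hi
    obtain ⟨y, hy, hyj⟩ := hj
    obtain ⟨w, hw⟩ := conn x hx i hxi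
    obtain ⟨w', hw'⟩ := conn y hy j hyj
    refine ⟨w.reverse.append w', fun z hz => ?_⟩
    rw [Walk.mem_support_append_iff, Walk.support_reverse, List.mem_reverse] at hz
    exact hz.elim (hw z) (hw' z)) t
  refine ⟨i, x, hx, hxi, fun s a ha hs has => ?_⟩
  obtain ⟨j, h1, h2⟩ := h.edge a s has
  obtain ⟨w, hw⟩ := h.exists_walk (ht s a ha hs has) h2
  exact hw i (hi j ⟨a, ha, h1⟩ w)

end Tree

/-! ### Partition functions of regions of a graph -/

section Partition
variable {V K A : Type} [Fintype V] [DecidableEq V] [Fintype K] [DecidableEq K] [CommRing A]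

open Classical in
/-- The sum, over all assignments `τ` of types in `K` to the vertices that agree with `f` outside of
`C`, of the weights of the vertices in `C` and of the edges that meet `C`. The weight of an edge
depends on its two ends and their types. -/
noncomputable def partitionSum (G : SimpleGraph V) (α : V → K → A) (ρ : Sym2 (V × K) → A)
    (C : Finset V) (f : V → K) : A :=
  ∑ τ : V → K with ∀ x ∉ C, τ x = f x, (∏ x ∈ C, α x (τ x)) *
    ∏ e ∈ G.edgeFinset with ∃ x ∈ C, x ∈ e, ρ (e.map fun x => (x, τ x))

variable {G : SimpleGraph V} {α : V → K → A} {ρ : Sym2 (V × K) → A}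

theorem partitionSum_empty (f : V → K) : partitionSum G α ρ ∅ f = 1 := by
  classical
  have : (Finset.univ.filter fun τ : V → K => ∀ x ∉ (∅ : Finset V), τ x = f x) = {f} := by
    ext τ
    simp [funext_iff]
  rw [partitionSum, this]
  simp

open Classical in
/-- Summing over the type of one vertex `x` of the region first. -/
theorem partitionSum_erase {C : Finset V} {x : V} (hx : x ∈ C) (f : V → K) :
    partitionSum G α ρ C f = ∑ t, α x t * (∏ y with G.Adj x y ∧ y ∉ C, ρ s((x, t), (y, f y))) *
      partitionSum G α ρ (C.erase x) (Function.update f x t) := by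
  rw [partitionSum, ← Finset.sum_fiberwise _ (fun τ : V → K => τ x)]
  refine Finset.sum_congr rfl fun t _ => ?_
  rw [partitionSum, Finset.mul_sum]
  have hset : (Finset.univ.filter fun τ : V → K => ∀ y ∉ C, τ y = f y).filter (fun τ => τ x = t) =
      Finset.univ.filter fun τ : V → K => ∀ y ∉ C.erase x, τ y = Function.update f x t y := by
    ext τ
    simp only [Finset.mem_filter, Finset.mem_univ, true_and, Finset.mem_erase, not_and']
    constructor
    · rintro ⟨h1, rfl⟩ y hy
      by_cases hyx : y = x
      · subst hyx; simp
      · rw [Function.update_of_ne hyx]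
        exact h1 y fun h => hy h hyx
    · intro h
      refine ⟨fun y hy => ?_, ?_⟩
      · have hyx : y ≠ x := fun h => hy (h ▸ hx)
        have := h y fun h' => absurd h' hy
        rwa [Function.update_of_ne hyx] at this
      · simpa using h x (by simp)
  rw [hset]
  refine Finset.sum_congr rfl fun τ hτ => ?_
  simp only [Finset.mem_filter, Finset.mem_univ, true_and] at hτ
  have hτx : τ x = t := by simpa using hτ x (by simp)
  have hτy : ∀ y ∉ C, τ y = f y := fun y hy => by
    have hyx : y ≠ x := fun h => hy (h ▸ hx)
    rw [hτ y (fun h => hy (Finset.mem_of_mem_erase h)), Function.update_of_ne hyx]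
  -- an edge that meets `C` meets `C.erase x`, or it joins `x` with a vertex outside of `C`
  have hE : (G.edgeFinset.filter fun e => ∃ y ∈ C, y ∈ e) =
      (Finset.univ.filter fun y => G.Adj x y ∧ y ∉ C).image (fun y => s(x, y)) ∪
        G.edgeFinset.filter fun e => ∃ y ∈ C.erase x, y ∈ e := by
    ext e
    induction e using Sym2.ind with
    | _ a c =>
      simp only [Finset.mem_filter, SimpleGraph.mem_edgeFinset, SimpleGraph.mem_edgeSet,
        Finset.mem_union, Finset.mem_image, Finset.mem_univ, true_and, Finset.mem_erase,
        Sym2.mem_iff]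
      constructor
      · rintro ⟨hac, y, hy, hye⟩
        by_cases hyx : y = x
        · subst hyx
          rcases hye with rfl | rfl
          · by_cases hc : c ∈ C
            · exact Or.inr ⟨hac, c, ⟨hac.ne', hc⟩, Or.inr rfl⟩
            · exact Or.inl ⟨c, ⟨hac, hc⟩, rfl⟩
          · by_cases ha : a ∈ C
            · exact Or.inr ⟨hac, a, ⟨hac.ne, ha⟩, Or.inl rfl⟩
            · exact Or.inl ⟨a, ⟨hac.symm, ha⟩, Sym2.eq_swap⟩
        · exact Or.inr ⟨hac, y, ⟨hyx, hy⟩, hye⟩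
      · rintro (⟨y, ⟨hxy, hy⟩, he⟩ | ⟨hac, y, ⟨-, hy⟩, hye⟩)
        · rw [Sym2.eq_iff] at he
          rcases he with ⟨rfl, rfl⟩ | ⟨rfl, rfl⟩
          · exact ⟨hxy, x, hx, Or.inl rfl⟩
          · exact ⟨hxy.symm, x, hx, Or.inr rfl⟩
        · exact ⟨hac, y, hy, hye⟩
  have hdisj : Disjoint ((Finset.univ.filter fun y => G.Adj x y ∧ y ∉ C).image (fun y => s(x, y)))
      (G.edgeFinset.filter fun e => ∃ y ∈ C.erase x, y ∈ e) := by
    rw [Finset.disjoint_left]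
    intro e he he'
    simp only [Finset.mem_image, Finset.mem_filter, Finset.mem_univ, true_and,
      Finset.mem_erase] at he he'
    obtain ⟨y, ⟨-, hy⟩, rfl⟩ := he
    obtain ⟨-, z, ⟨hzx, hz⟩, hze⟩ := he'
    rcases Sym2.mem_iff.mp hze with rfl | rfl
    · exact hzx rfl
    · exact hy hz
  rw [hE, Finset.prod_union hdisj, Finset.prod_image (fun y _ y' _ h => Sym2.congr_right.mp h),
    ← Finset.mul_prod_erase C _ hx, hτx]
  have hprod : ∏ y with G.Adj x y ∧ y ∉ C, ρ (Sym2.map (fun z => (z, τ z)) s(x, y)) =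
      ∏ y with G.Adj x y ∧ y ∉ C, ρ s((x, t), (y, f y)) := by
    refine Finset.prod_congr rfl fun y hy => ?_
    simp only [Finset.mem_filter] at hy
    rw [Sym2.map_mk, hτx, hτy y hy.2.2]
  rw [hprod]
  ring

/-- Only the types of the neighbours of the region matter. -/
theorem partitionSum_congr {C : Finset V} {f g : V → K}
    (h : ∀ y ∉ C, (∃ x ∈ C, G.Adj x y) → f y = g y) :
    partitionSum G α ρ C f = partitionSum G α ρ C g := by
  classical
  induction C using Finset.induction_on generalizing f g with
  | empty => rw [partitionSum_empty, partitionSum_empty]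
  | insert x C hx ih =>
    rw [partitionSum_erase (Finset.mem_insert_self x C), partitionSum_erase
      (Finset.mem_insert_self x C), Finset.erase_insert hx]
    refine Finset.sum_congr rfl fun t _ => ?_
    congr 1
    · congr 1
      refine Finset.prod_congr rfl fun y hy => ?_
      simp only [Finset.mem_filter, Finset.mem_univ, true_and] at hy
      rw [h y hy.2 ⟨x, Finset.mem_insert_self x C, hy.1⟩]
    · refine ih fun y hy hxy => ?_
      by_cases hyx : y = x
      · subst hyx; simp
      · rw [Function.update_of_ne hyx, Function.update_of_ne hyx]
        obtain ⟨z, hz, hzy⟩ := hxy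
        exact h y (by simp [hy, hyx]) ⟨z, Finset.mem_insert_of_mem hz, hzy⟩

theorem partitionSum_union {C D : Finset V} (hCD : Disjoint C D)
    (hadj : ∀ x ∈ C, ∀ y ∈ D, ¬ G.Adj x y) (f : V → K) :
    partitionSum G α ρ (C ∪ D) f = partitionSum G α ρ C f * partitionSum G α ρ D f := by
  classical
  induction C using Finset.induction_on generalizing f with
  | empty => rw [partitionSum_empty, one_mul, Finset.empty_union]
  | insert x C hx ih =>
    rw [Finset.disjoint_insert_left] at hCD
    rw [partitionSum_erase (x := x) (by simp), partitionSum_erase (Finset.mem_insert_self x C),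
      Finset.erase_insert hx, Finset.insert_union, Finset.erase_insert (by simp [hx, hCD.1]),
      Finset.sum_mul]
    refine Finset.sum_congr rfl fun t _ => ?_
    rw [ih hCD.2 fun z hz => hadj z (Finset.mem_insert_of_mem hz)]
    have h1 : partitionSum G α ρ D (Function.update f x t) = partitionSum G α ρ D f := by
      refine partitionSum_congr fun y _ ⟨z, hz, hzy⟩ => ?_
      refine Function.update_of_ne ?_ _ _
      rintro rfl
      exact hadj _ (Finset.mem_insert_self _ C) z hz hzy.symm
    have h2 : (Finset.univ.filter fun y => G.Adj x y ∧ y ∉ insert x (C ∪ D)) =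
        Finset.univ.filter fun y => G.Adj x y ∧ y ∉ insert x C := by
      refine Finset.filter_congr fun y _ => and_congr_right fun hxy => ?_
      have : y ∉ D := fun hy => hadj x (Finset.mem_insert_self x C) y hy hxy
      simp [this]
    rw [h1, h2]
    ring

end Partition

/-! ### Components and the separator recursion -/

section Components
variable {V : Type} {G : SimpleGraph V} {S : Set V}

/-- A step along an edge of `G` to a vertex outside of `S`. -/
def AvoidStep (G : SimpleGraph V) (S : Set V) (a c : V) : Prop := G.Adj a c ∧ c ∉ S

/-- For `v ∉ S`, the vertex `y` lies in the component of `v` in the graph without the vertices in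
`S`. -/
def InComp (G : SimpleGraph V) (S : Set V) (v y : V) : Prop :=
  Relation.ReflTransGen (AvoidStep G S) v y

theorem InComp.notMem {v y : V} (h : InComp G S v y) (hv : v ∉ S) : y ∉ S := by
  cases h with
  | refl => exact hv
  | tail _ h => exact h.2

theorem InComp.symm {v y : V} (h : InComp G S v y) (hv : v ∉ S) : InComp G S y v := by
  unfold InComp at h
  induction h with
  | refl => exact .refl
  | @tail a c hva hac ih =>
    exact .head ⟨hac.1.symm, InComp.notMem hva hv⟩ ih

theorem InComp.trans {v y z : V} (h : InComp G S v y) (h' : InComp G S y z) : InComp G S v z :=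
  Relation.ReflTransGen.trans h h'

/-- The vertices that can be reached from `v` by at most `r` steps that avoid `S`. -/
def reachWithin (G : SimpleGraph V) (S : Set V) (v : V) : ℕ → V → Prop
  | 0, y => y = v
  | r + 1, y => reachWithin G S v r y ∨ y ∉ S ∧ ∃ a, reachWithin G S v r a ∧ G.Adj a y

theorem reachWithin_mono {v y : V} {r r' : ℕ} (h : r ≤ r') (hy : reachWithin G S v r y) :
    reachWithin G S v r' y := by
  induction h with
  | refl => exact hy
  | step _ ih => exact Or.inl ih

theorem reachWithin_inComp {v y : V} {r : ℕ} (h : reachWithin G S v r y) : InComp G S v y := by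
  induction r generalizing y with
  | zero => obtain rfl : y = v := h; exact .refl
  | succ r ih =>
    rcases h with h | ⟨hy, a, ha, hay⟩
    · exact ih h
    · exact (ih ha).tail ⟨hay, hy⟩

/-- As many steps as there are vertices suffice: before that, every further step adds a vertex. -/
theorem inComp_iff_reachWithin [Fintype V] {v y : V} :
    InComp G S v y ↔ reachWithin G S v (Fintype.card V) y := by
  classical
  refine ⟨fun h => ?_, reachWithin_inComp⟩
  have stable : ∃ r ≤ Fintype.card V, ∀ z, reachWithin G S v (r + 1) z → reachWithin G S v r z := by
    by_contra hcon
    push Not at hcon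
    have hcard : ∀ r ≤ Fintype.card V + 1,
        r ≤ (Finset.univ.filter fun z => reachWithin G S v r z).card := by
      intro r
      induction r with
      | zero => simp
      | succ r ih =>
        intro hr
        obtain ⟨z, hz, hz'⟩ := hcon r (by omega)
        refine Nat.succ_le_of_lt ((ih (by omega)).trans_lt (Finset.card_lt_card ?_))
        rw [Finset.ssubset_iff_of_subset fun z hz => by
          simp only [Finset.mem_filter, Finset.mem_univ, true_and] at hz ⊢
          exact Or.inl hz]
        exact ⟨z, by simpa using hz, by simpa using hz'⟩
    have := (hcard _ le_rfl).trans (Finset.card_le_univ _)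
    omega
  obtain ⟨r, hr, hstable⟩ := stable
  refine reachWithin_mono hr ?_
  unfold InComp at h
  induction h with
  | refl => exact reachWithin_mono (Nat.zero_le r) rfl
  | tail _ hac ih => exact hstable _ (Or.inr ⟨hac.2, _, ih, hac.1⟩)

end Components

section ComponentProduct

open Classical in
/-- The vertices that satisfy `InComp G S v`, as a finite set. -/
noncomputable def component {V : Type} [Fintype V] (G : SimpleGraph V) (S : Set V) (v : V) :
    Finset V :=
  Finset.univ.filter (InComp G S v)

@[simp] theorem mem_component {V : Type} [Fintype V] {G : SimpleGraph V} {S : Set V} {v y : V} :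
    y ∈ component G S v ↔ InComp G S v y := by
  simp [component]

variable {V K A : Type} [Fintype V] [DecidableEq V] [Fintype K] [DecidableEq K] [CommRing A]
variable {G : SimpleGraph V} {α : V → K → A} {ρ : Sym2 (V × K) → A} {S : Set V}

open Classical in
/-- The partition function of a union of components is the product over the components, each of
which is represented by its least vertex. -/
theorem partitionSum_eq_prod_component [LinearOrder V] {Y : Finset V} (hYS : ∀ y ∈ Y, y ∉ S)
    (hY : ∀ a ∈ Y, ∀ c, G.Adj a c → c ∉ S → c ∈ Y) (f : V → K) :
    partitionSum G α ρ Y f = ∏ v, if v ∈ Y ∧ ∀ v' < v, ¬ InComp G S v v' then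
      partitionSum G α ρ (component G S v) f else 1 := by
  set I := Finset.univ.filter fun v => v ∈ Y ∧ ∀ v' < v, ¬ InComp G S v v' with hI
  have hclosed : ∀ v ∈ Y, ∀ y, InComp G S v y → y ∈ Y := by
    intro v hv y hy
    unfold InComp at hy
    induction hy with
    | refl => exact hv
    | tail _ hac ih => exact hY _ ih _ hac.1 hac.2
  have huniq : ∀ v ∈ I, ∀ v' ∈ I, InComp G S v v' → v = v' := by
    intro v hv v' hv' h
    simp only [hI, Finset.mem_filter, Finset.mem_univ, true_and] at hv hv'
    exact le_antisymm (not_lt.mp fun hlt => hv.2 v' hlt h)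
      (not_lt.mp fun hlt => hv'.2 v hlt (h.symm (hYS v hv.1)))
  have hprod : ∀ J ⊆ I, partitionSum G α ρ (J.biUnion (component G S)) f =
      ∏ v ∈ J, partitionSum G α ρ (component G S v) f := by
    intro J
    induction J using Finset.induction_on with
    | empty => intro _; rw [Finset.biUnion_empty, partitionSum_empty, Finset.prod_empty]
    | insert v J hv ih =>
      intro hJ
      have hvI : v ∈ I := hJ (Finset.mem_insert_self v J)
      have hvY : v ∈ Y := (Finset.mem_filter.mp hvI).2.1
      have key : ∀ a ∈ component G S v, ∀ v' ∈ J, a ∉ component G S v' := by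
        intro a ha v' hv' ha'
        rw [mem_component] at ha ha'
        have hv'I : v' ∈ I := hJ (Finset.mem_insert_of_mem hv')
        have hv'Y : v' ∈ Y := (Finset.mem_filter.mp hv'I).2.1
        have := huniq v hvI v' hv'I (ha.trans (ha'.symm (hYS v' hv'Y)))
        exact hv (this ▸ hv')
      rw [Finset.biUnion_insert, Finset.prod_insert hv,
        ← ih ((Finset.subset_insert v J).trans hJ), partitionSum_union]
      · rw [Finset.disjoint_left]
        intro a ha ha'
        obtain ⟨v', hv', ha''⟩ := Finset.mem_biUnion.mp ha'
        exact key a ha v' hv' ha''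
      · intro a ha c hc hac
        obtain ⟨v', hv', hc'⟩ := Finset.mem_biUnion.mp hc
        rw [mem_component] at ha hc'
        have hv'Y : v' ∈ Y :=
          (Finset.mem_filter.mp (hJ (Finset.mem_insert_of_mem hv'))).2.1
        refine key c (mem_component.mpr (ha.tail ⟨hac, hc'.notMem (hYS v' hv'Y)⟩)) v' hv' ?_
        exact mem_component.mpr hc'
  have hYI : Y = I.biUnion (component G S) := by
    ext y
    rw [Finset.mem_biUnion]
    constructor
    · intro hy
      have hne : (component G S y).Nonempty := ⟨y, mem_component.mpr .refl⟩
      set v := (component G S y).min' hne with hv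
      have hyv : InComp G S y v := mem_component.mp (Finset.min'_mem _ hne)
      have hvY := hclosed y hy v hyv
      refine ⟨v, ?_, mem_component.mpr (hyv.symm (hYS y hy))⟩
      simp only [hI, Finset.mem_filter, Finset.mem_univ, true_and]
      refine ⟨hvY, fun v' hlt h => ?_⟩
      exact absurd (Finset.min'_le _ v' (mem_component.mpr (hyv.trans h))) (not_le.mpr hlt)
    · rintro ⟨v, hv, hy⟩
      exact hclosed v (Finset.mem_filter.mp hv).2.1 y (mem_component.mp hy)
  rw [← Finset.prod_filter, ← hI, ← hprod I subset_rfl, ← hYI]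

end ComponentProduct

section Recursion
variable {n k c : ℕ} {A : Type} [CommRing A]

/-- A vertex `q.2` of the component `C` of `v` may replace the separator vertex at position `q.1` if
the latter has no neighbour in `C` or occurs at another position, too, and all components of the
rest of `C` are solved. -/
def Replaceable (G : SimpleGraph (Fin n)) (solved : (Fin (k + 1) → Fin n) → Fin n → Prop)
    (S : Fin (k + 1) → Fin n) (v : Fin n) (q : Fin (k + 1) × Fin n) : Prop :=
  InComp G (Set.range S) v q.2 ∧
    ((∀ a, InComp G (Set.range S) v a → ¬ G.Adj a (S q.1)) ∨ ∃ j, j ≠ q.1 ∧ S j = S q.1) ∧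
    ∀ y, InComp G (Set.range S) v y → y ≠ q.2 → solved (Function.update S q.1 q.2) y

/-- The component of `v` in the graph without the separator `S` can be solved in `r` rounds. -/
def Solvable (G : SimpleGraph (Fin n)) : ℕ → (Fin (k + 1) → Fin n) → Fin n → Prop
  | 0, _, _ => False
  | r + 1, S, v => ∃ q, Replaceable G (Solvable G r) S v q

/-- The first replacement, in the order of codes. -/
def FirstReplacement (G : SimpleGraph (Fin n)) (r : ℕ) (S : Fin (k + 1) → Fin n) (v : Fin n)
    (q : Fin (k + 1) × Fin n) : Prop :=
  Replaceable G (Solvable G r) S v q ∧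
    ∀ q', Code.code q' < Code.code q → ¬ Replaceable G (Solvable G r) S v q'

open Classical in
/-- The weights of the edges between a vertex `x` of type `t` and the vertices of the separator `S`,
the types of which are `σ`. A vertex that occurs at several positions counts once. -/
noncomputable def separatorWeight (G : SimpleGraph (Fin n)) (ρ : Sym2 (Fin n × Fin c) → A)
    (S : Fin (k + 1) → Fin n) (σ : Fin (k + 1) → Fin c) (x : Fin n) (t : Fin c) : A :=
  ∏ j, if G.Adj x (S j) ∧ ∀ j' < j, S j' ≠ S j then ρ s((x, t), (S j, σ j)) else 1

open Classical in
/-- The product, over the components of the graph without `S` that are contained in `Y`, of their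
values. Each component contributes through its least vertex. -/
noncomputable def componentProduct (G : SimpleGraph (Fin n)) (S : Fin (k + 1) → Fin n)
    (Y : Fin n → Prop) (val : Fin n → A) : A :=
  ∏ v, if Y v ∧ ∀ v' < v, ¬ InComp G (Set.range S) v v' then val v else 1

open Classical in
/-- The partition function of the component of `v` in the graph without `S`, the vertices of which
have the types `σ`, as computed in `r` rounds. -/
noncomputable def roundValue (G : SimpleGraph (Fin n)) (α : Fin n → Fin c → A)
    (ρ : Sym2 (Fin n × Fin c) → A) :
    ℕ → (Fin (k + 1) → Fin n) × Fin n × (Fin (k + 1) → Fin c) → A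
  | 0, _ => 0
  | r + 1, (S, v, σ) => ∑ q, if FirstReplacement G r S v q then
      ∑ t, α q.2 t * separatorWeight G ρ S σ q.2 t *
        componentProduct G (Function.update S q.1 q.2)
          (fun y => InComp G (Set.range S) v y ∧ y ≠ q.2)
          fun y => roundValue G α ρ r (Function.update S q.1 q.2, y, Function.update σ q.1 t)
      else 0

variable {G : SimpleGraph (Fin n)} {α : Fin n → Fin c → A} {ρ : Sym2 (Fin n × Fin c) → A}

open Classical in
/-- The edges between `x` and the separator are those that leave the region `C`. -/
theorem separatorWeight_eq {S : Fin (k + 1) → Fin n} {σ : Fin (k + 1) → Fin c} {x : Fin n}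
    {C : Finset (Fin n)} {f : Fin n → Fin c} (hC : ∀ y, G.Adj x y → y ∉ C → y ∈ Set.range S)
    (hS : ∀ j, G.Adj x (S j) → S j ∉ C ∧ f (S j) = σ j) (t : Fin c) :
    separatorWeight G ρ S σ x t = ∏ y with G.Adj x y ∧ y ∉ C, ρ s((x, t), (y, f y)) := by
  rw [separatorWeight, ← Finset.prod_filter]
  refine Finset.prod_bij (fun j _ => S j) ?_ ?_ ?_ ?_
  · intro j hj
    simp only [Finset.mem_filter, Finset.mem_univ, true_and] at hj ⊢
    exact ⟨hj.1, (hS j hj.1).1⟩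
  · intro j hj j' hj' h
    simp only [Finset.mem_filter, Finset.mem_univ, true_and] at hj hj'
    exact le_antisymm (not_lt.mp fun hlt => hj.2 j' hlt h.symm)
      (not_lt.mp fun hlt => hj'.2 j hlt h)
  · intro y hy
    simp only [Finset.mem_filter, Finset.mem_univ, true_and] at hy
    have hne : (Finset.univ.filter fun j => S j = y).Nonempty := by
      obtain ⟨j, hj⟩ := hC y hy.1 hy.2
      exact ⟨j, by simpa using hj⟩
    have hmin := Finset.min'_mem _ hne
    simp only [Finset.mem_filter, Finset.mem_univ, true_and] at hmin
    refine ⟨_, ?_, hmin⟩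
    simp only [Finset.mem_filter, Finset.mem_univ, true_and]
    refine ⟨by rw [hmin]; exact hy.1, fun j' hlt h => ?_⟩
    exact absurd (Finset.min'_le _ j' (by simpa using h.trans hmin)) (not_le.mpr hlt)
  · intro j hj
    simp only [Finset.mem_filter, Finset.mem_univ, true_and] at hj
    rw [(hS j hj.1).2]

/-- After a replacement, the components of the rest of `C` do not leave `C`. -/
theorem Replaceable.inComp {solved : (Fin (k + 1) → Fin n) → Fin n → Prop}
    {S : Fin (k + 1) → Fin n} {v : Fin n} {q : Fin (k + 1) × Fin n}
    (h : Replaceable G solved S v q) {a y : Fin n} (ha : InComp G (Set.range S) v a)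
    (hay : G.Adj a y) (hy : y ∉ Set.range (Function.update S q.1 q.2)) :
    InComp G (Set.range S) v y ∧ y ≠ q.2 := by
  have hyx : y ≠ q.2 := by
    rintro rfl
    exact hy ⟨q.1, by simp⟩
  refine ⟨?_, hyx⟩
  by_cases hyS : y ∈ Set.range S
  · exfalso
    obtain ⟨j, rfl⟩ := hyS
    by_cases hj : j = q.1
    · subst hj
      rcases h.2.1 with h1 | ⟨j', hj', he⟩
      · exact h1 a ha hay
      · exact hy ⟨j', by rw [Function.update_of_ne hj', he]⟩
    · exact hy ⟨j, by rw [Function.update_of_ne hj]⟩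
  · exact ha.tail ⟨hay, hyS⟩

/-- The recursion computes the partition functions of all components that it can solve. -/
theorem roundValue_eq {r : ℕ} {S : Fin (k + 1) → Fin n} {v : Fin n} (hv : v ∉ Set.range S)
    (hr : Solvable G r S v) {σ : Fin (k + 1) → Fin c} {f : Fin n → Fin c}
    (hf : ∀ j a, InComp G (Set.range S) v a → G.Adj a (S j) → f (S j) = σ j) :
    roundValue G α ρ r (S, v, σ) = partitionSum G α ρ (component G (Set.range S) v) f := by
  classical
  induction r generalizing S v σ f with
  | zero => exact hr.elim
  | succ r ih =>
    obtain ⟨q, hq, hfirst⟩ : ∃ q, FirstReplacement G r S v q := by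
      have hne : (Finset.univ.filter fun q => Replaceable G (Solvable G r) S v q).Nonempty := by
        obtain ⟨q, hq⟩ := hr
        exact ⟨q, by simpa using hq⟩
      obtain ⟨q, hq, hmin⟩ := Finset.exists_min_image _ (fun q => Code.code q) hne
      refine ⟨q, by simpa using hq, fun q' hlt hq' => ?_⟩
      exact absurd (hmin q' (by simpa using hq')) (not_le.mpr hlt)
    have hiff : ∀ q', FirstReplacement G r S v q' ↔ q' = q := by
      intro q'
      refine ⟨fun h => Code.code_injective (le_antisymm ?_ ?_), fun h => h ▸ ⟨hq, hfirst⟩⟩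
      · exact not_lt.mp fun hlt => h.2 q hlt hq
      · exact not_lt.mp fun hlt => hfirst q' hlt h.1
    rw [roundValue, Finset.sum_congr rfl fun q' _ => by rw [if_congr (hiff q') rfl rfl],
      Finset.sum_ite_eq' Finset.univ q, if_pos (Finset.mem_univ q),
      partitionSum_erase (x := q.2) (mem_component.mpr hq.1)]
    have hS : ∀ j, S j ∉ component G (Set.range S) v := fun j hj =>
      (mem_component.mp hj).notMem hv ⟨j, rfl⟩
    -- the new separator vertex does not occur in the old separator
    have hxS : ∀ j, S j ≠ q.2 := fun j h => hS j (h ▸ mem_component.mpr hq.1)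
    refine Finset.sum_congr rfl fun t _ => ?_
    congr 1
    · congr 1
      refine separatorWeight_eq (fun y hxy hy => ?_) (fun j hj => ⟨hS j, hf j _ hq.1 hj⟩) t
      by_contra hyS
      exact hy (mem_component.mpr (hq.1.tail ⟨hxy, hyS⟩))
    · rw [componentProduct, partitionSum_eq_prod_component
        (S := Set.range (Function.update S q.1 q.2))]
      · refine Finset.prod_congr rfl fun y _ => ?_
        have hmem : y ∈ (component G (Set.range S) v).erase q.2 ↔
            InComp G (Set.range S) v y ∧ y ≠ q.2 := by
          rw [Finset.mem_erase, mem_component, and_comm]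
        by_cases hy' : (InComp G (Set.range S) v y ∧ y ≠ q.2) ∧
            ∀ v' < y, ¬ InComp G (Set.range (Function.update S q.1 q.2)) y v'
        · rw [if_pos hy', if_pos ⟨hmem.mpr hy'.1, hy'.2⟩]
          have hy := hy'.1
          have hcomp : ∀ a, InComp G (Set.range (Function.update S q.1 q.2)) y a →
              InComp G (Set.range S) v a ∧ a ≠ q.2 := by
            intro a ha
            unfold InComp at ha
            induction ha with
            | refl => exact hy
            | tail _ hac ih => exact hq.inComp ih.1 hac.1 hac.2
          refine ih ?_ (hq.2.2 y hy.1 hy.2) ?_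
          · rintro ⟨j, rfl⟩
            by_cases hj : j = q.1
            · subst hj
              simp at hy
            · rw [Function.update_of_ne hj] at hy
              exact hS j (mem_component.mpr hy.1)
          · intro j a ha haj
            by_cases hj : j = q.1
            · subst hj
              simp
            · rw [Function.update_of_ne hj] at haj ⊢
              rw [Function.update_of_ne hj, Function.update_of_ne (hxS j)]
              exact hf j a (hcomp a ha).1 haj
        · rw [if_neg hy', if_neg fun h => hy' ⟨hmem.mp h.1, h.2⟩]
      · rintro y hy ⟨j, rfl⟩
        rw [Finset.mem_erase] at hy
        by_cases hj : j = q.1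
        · subst hj
          simp at hy
        · rw [Function.update_of_ne hj] at hy
          exact hS j hy.2
      · intro a ha y hay hy
        rw [Finset.mem_erase, mem_component] at ha ⊢
        exact (hq.inComp ha.2 hay hy).symm

/-- Along a tree decomposition of width `k`, all components are solved: some vertex of the component
shares a bag with all neighbours of the component, so that there is room for it in the separator. -/
theorem solvable_of_isTreeDecomposition {I : Type} {T : SimpleGraph I} {bag : I → Finset (Fin n)}
    (h : IsTreeDecomposition G T bag) (hk : ∀ i, (bag i).card ≤ k + 1) {r : ℕ}
    {S : Fin (k + 1) → Fin n} {v : Fin n} (hv : v ∉ Set.range S)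
    (hr : (component G (Set.range S) v).card ≤ r) {i : I}
    (hi : ∀ j a, InComp G (Set.range S) v a → G.Adj a (S j) → S j ∈ bag i) :
    Solvable G r S v := by
  classical
  induction r generalizing S v i with
  | zero =>
    have : v ∈ component G (Set.range S) v := mem_component.mpr .refl
    rw [Finset.card_eq_zero.mp (Nat.le_zero.mp hr)] at this
    simp at this
  | succ r ih =>
    have hS : ∀ j, ¬ InComp G (Set.range S) v (S j) := fun j hj => hj.notMem hv ⟨j, rfl⟩
    have hout : ∀ s a, InComp G (Set.range S) v a → ¬ InComp G (Set.range S) v s → G.Adj a s →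
        s ∈ Set.range S := fun s a ha hs has => by
      by_contra hsS
      exact hs (ha.tail ⟨has, hsS⟩)
    obtain ⟨i', x, hx, hxi, hi'⟩ := h.exists_bag (fun a c (hac : AvoidStep G (Set.range S) a c) =>
      hac.1) (v := v) (t := i) fun s a ha hs has => by
        obtain ⟨j, rfl⟩ := hout s a ha hs has
        exact hi j a ha has
    -- a position that the neighbours of the component leave free
    obtain ⟨p, hp⟩ : ∃ p, (∀ a, InComp G (Set.range S) v a → ¬ G.Adj a (S p)) ∨
        ∃ j, j ≠ p ∧ S j = S p := by
      by_contra hcon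
      push Not at hcon
      have hinj : Function.Injective S := fun j p hjp => by
        by_contra hne
        exact (hcon p).2 j hne hjp
      have hsub : Finset.univ.image S ⊆ (bag i').erase x := by
        intro s hs
        obtain ⟨p, -, rfl⟩ := Finset.mem_image.mp hs
        obtain ⟨a, ha, has⟩ := (hcon p).1
        rw [Finset.mem_erase]
        exact ⟨fun h => hS p (h ▸ hx), hi' _ a ha (hS p) has⟩
      have := Finset.card_le_card hsub
      rw [Finset.card_image_of_injective _ hinj, Finset.card_erase_of_mem hxi, Finset.card_univ,
        Fintype.card_fin] at this
      have := hk i'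
      have := Finset.card_pos.mpr ⟨x, hxi⟩
      omega
    refine ⟨(p, x), ?_⟩
    have hrep : Replaceable G (fun _ _ => True) S v (p, x) := ⟨hx, hp, fun _ _ _ => trivial⟩
    refine ⟨hx, hp, fun y hy hyx => ?_⟩
    have hcomp : ∀ a, InComp G (Set.range (Function.update S p x)) y a →
        InComp G (Set.range S) v a ∧ a ≠ x := by
      intro a ha
      unfold InComp at ha
      induction ha with
      | refl => exact ⟨hy, hyx⟩
      | tail _ hac ih => exact hrep.inComp ih.1 hac.1 hac.2
    refine ih ?_ ?_ (i := i') ?_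
    · rintro ⟨j, rfl⟩
      by_cases hj : j = p
      · subst hj
        simp at hyx
      · rw [Function.update_of_ne hj] at hy
        exact hS j hy
    · refine Nat.le_of_lt_succ (lt_of_lt_of_le (Finset.card_lt_card ?_) hr)
      rw [Finset.ssubset_iff_of_subset fun a ha => mem_component.mpr
        (hcomp a (mem_component.mp ha)).1]
      exact ⟨x, mem_component.mpr hx, fun h => (hcomp x (mem_component.mp h)).2 rfl⟩
    · intro j a ha haj
      by_cases hj : j = p
      · subst hj
        simpa using hxi
      · rw [Function.update_of_ne hj] at haj ⊢
        exact hi' _ a (hcomp a ha).1 (hS j) haj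

open Classical in
/-- The partition function of the whole graph, from those of the components that remain when the
vertex `x` is removed. -/
theorem partitionSum_univ_eq {m : ℕ} {T : SimpleGraph (Fin m)} {bag : Fin m → Finset (Fin n)}
    (h : IsTreeDecomposition G T bag) (hk : ∀ i, (bag i).card ≤ k + 1) (x : Fin n)
    (f : Fin n → Fin c) :
    partitionSum G α ρ Finset.univ f = ∑ t, α x t *
      componentProduct G (fun _ : Fin (k + 1) => x) (fun y => y ≠ x)
        fun y => roundValue G α ρ n ((fun _ : Fin (k + 1) => x), y, fun _ => t) := by
  rw [partitionSum_erase (Finset.mem_univ x)]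
  refine Finset.sum_congr rfl fun t _ => ?_
  have hS : ∀ y, y ∉ Set.range (fun _ : Fin (k + 1) => x) ↔ y ≠ x := by
    intro y
    simp [eq_comm]
  rw [componentProduct, partitionSum_eq_prod_component
    (S := Set.range fun _ : Fin (k + 1) => x) (fun y hy => (hS y).mpr (Finset.ne_of_mem_erase hy))
    (fun a _ y _ hy => Finset.mem_erase.mpr ⟨(hS y).mp hy, Finset.mem_univ y⟩)]
  simp only [Finset.mem_univ, not_true, and_false, Finset.filter_false, Finset.prod_empty, mul_one,
    Finset.mem_erase, and_true]
  congr 1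
  refine Finset.prod_congr rfl fun y _ => ?_
  by_cases hy : y ≠ x ∧ ∀ v' < y, ¬ InComp G (Set.range fun _ : Fin (k + 1) => x) y v'
  · obtain ⟨i, hi⟩ := h.cover x
    rw [if_pos hy, if_pos hy]
    exact (roundValue_eq ((hS y).mpr hy.1) (solvable_of_isTreeDecomposition h hk
      ((hS y).mpr hy.1) ((Finset.card_le_univ _).trans (by simp)) fun _ _ _ _ => hi)
      fun j a _ _ => by simp).symm
  · rw [if_neg hy, if_neg hy]

end Recursion

/-! ### Types, pairs of types, and the weights of a world -/

section Types
variable {u b n : ℕ}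

open Formula

/-- The universal quantifiers of a sentence in prenex normal form may be dropped, as a model is
required to satisfy the formula under every assignment. -/
theorem Formula.IsPrenexUniversal.exists_matrix {φ : Formula u b} (h : φ.IsPrenexUniversal) :
    ∃ ψ : Formula u b, ψ.IsQuantifierFree ∧
      ∀ (n : ℕ) (ω : World u b n), Models ω φ ↔ Models ω ψ := by
  induction h with
  | of_quantifierFree h => exact ⟨_, h, fun _ _ => Iff.rfl⟩
  | @all i φ _ ih =>
    obtain ⟨ψ, hψ, hφ⟩ := ih
    refine ⟨ψ, hψ, fun n ω => (Iff.trans ⟨fun h v => ?_, fun h v a => h _⟩ (hφ n ω))⟩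
    have := h v (v i)
    rwa [Function.update_eq_self] at this

/-- The ground atoms that contain only the element `a`. -/
def unaryAtom (a : Fin n) : Pred u b → GroundAtom u b n :=
  Sum.elim (fun P => .inl (P, a)) fun R => .inr (R, a, a)

/-- The ground atoms that contain two elements `a` and `c`: `(R, 0)` stands for `R(a, c)` and
`(R, 1)` for `R(c, a)`. -/
def binaryAtom (a c : Fin n) (q : Fin b × Fin 2) : GroundAtom u b n :=
  .inr (q.1, ![a, c] q.2, ![c, a] q.2)

/-- Exchange of the two elements of a pair. -/
def swapArgs (q : Fin b × Fin 2) : Fin b × Fin 2 := (q.1, Fin.rev q.2)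

@[simp] theorem swapArgs_swapArgs (q : Fin b × Fin 2) : swapArgs (swapArgs q) = q := by
  simp [swapArgs]

theorem binaryAtom_swapArgs (a c : Fin n) (q : Fin b × Fin 2) :
    (binaryAtom a c (swapArgs q) : GroundAtom u b n) = binaryAtom c a q := by
  obtain ⟨R, i⟩ := q
  fin_cases i <;> simp [binaryAtom, swapArgs, Fin.rev]

/-- The possible world with two elements of the types `s` and `t`, where `β` gives the truth values
of the atoms that contain both elements. -/
def pairWorld (s t : Pred u b → Bool) (β : Fin b × Fin 2 → Bool) : World u b 2 :=
  Sum.elim (fun q => ![s, t] q.2 (.inl q.1)) fun q =>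
    if q.2.1 = q.2.2 then ![s, t] q.2.1 (.inr q.1) else β (q.1, q.2.1)

/-- The truth value of a quantifier-free formula only depends on the ground atoms formed from the
values of the two variables. -/
theorem Formula.IsQuantifierFree.realize_iff {ψ : Formula u b} (h : ψ.IsQuantifierFree)
    (ω : World u b n) (v : Fin 2 → Fin n) (ω' : World u b 2)
    (h1 : ∀ P i, ω' (.inl (P, i)) = ω (.inl (P, v i)))
    (h2 : ∀ R i j, ω' (.inr (R, i, j)) = ω (.inr (R, v i, v j))) :
    ψ.Realize ω v ↔ ψ.Realize ω' id := by
  induction ψ with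
  | unary P s => simp [Realize, h1]
  | binary R s t => simp [Realize, h2]
  | not φ ih => exact not_congr (ih h)
  | and φ ψ ih1 ih2 => exact and_congr (ih1 h.1) (ih2 h.2)
  | or φ ψ ih1 ih2 => exact or_congr (ih1 h.1) (ih2 h.2)
  | all i φ => exact h.elim
  | ex i φ => exact h.elim

/-- The satisfaction of `ψ` by a pair of elements of the types `s` and `t`. -/
def PairSat (ψ : Formula u b) (s t : Pred u b → Bool) (β : Fin b × Fin 2 → Bool) : Prop :=
  ψ.Realize (pairWorld s t β) id

theorem Formula.IsQuantifierFree.realize_iff_pairSat {ψ : Formula u b} (h : ψ.IsQuantifierFree)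
    (ω : World u b n) (v : Fin 2 → Fin n) : ψ.Realize ω v ↔
      PairSat ψ (fun p => ω (unaryAtom (v 0) p)) (fun p => ω (unaryAtom (v 1) p))
        (fun q => ω (binaryAtom (v 0) (v 1) q)) := by
  refine h.realize_iff ω v _ (fun P i => ?_) fun R i j => ?_
  · fin_cases i <;> simp [pairWorld, unaryAtom]
  · fin_cases i <;> fin_cases j <;> simp [pairWorld, unaryAtom, binaryAtom]

/-- The pairs of distinct elements, each pair in increasing order. -/
abbrev OrderedPair (n : ℕ) : Type := {p : Fin n × Fin n // p.1 < p.2}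

/-- A ground atom contains one element or two. -/
def atomOf : (Fin n × Pred u b) ⊕ (OrderedPair n × (Fin b × Fin 2)) → GroundAtom u b n :=
  Sum.elim (fun q => unaryAtom q.1 q.2) fun q => binaryAtom q.1.1.1 q.1.1.2 q.2

theorem atomOf_bijective : Function.Bijective (atomOf : _ → GroundAtom u b n) := by
  constructor
  · rintro (⟨a, P | R⟩ | ⟨⟨⟨a, c⟩, hac⟩, R, i⟩) (⟨a', P' | R'⟩ | ⟨⟨⟨a', c'⟩, hac'⟩, R', i'⟩) h <;>
      simp only [atomOf, unaryAtom, binaryAtom, Sum.elim_inl, Sum.elim_inr, Sum.inl.injEq,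
        Sum.inr.injEq, Prod.mk.injEq, reduceCtorEq] at h ⊢
    · exact ⟨h.2, by rw [h.1]⟩
    · exact ⟨h.2.1, by rw [h.1]⟩
    · fin_cases i' <;> simp at h hac' <;> omega
    · fin_cases i <;> simp at h hac <;> omega
    · fin_cases i <;> fin_cases i' <;> simp at h hac hac' ⊢ <;> omega
  · rintro (⟨P, a⟩ | ⟨R, a, c⟩)
    · exact ⟨.inl (a, .inl P), rfl⟩
    · rcases lt_trichotomy a c with h | rfl | h
      · exact ⟨.inr (⟨(a, c), h⟩, R, 0), rfl⟩
      · exact ⟨.inl (a, .inr R), rfl⟩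
      · exact ⟨.inr (⟨(c, a), h⟩, R, 1), rfl⟩

theorem pred_unaryAtom (a : Fin n) (p : Pred u b) : (unaryAtom a p).pred = p := by
  cases p <;> rfl

theorem elements_unaryAtom (a : Fin n) (p : Pred u b) : (unaryAtom a p).elements.card = 1 := by
  cases p <;> simp [unaryAtom, GroundAtom.elements]

theorem pred_binaryAtom (a c : Fin n) (q : Fin b × Fin 2) :
    (binaryAtom a c q : GroundAtom u b n).pred = .inr q.1 := rfl

theorem elements_binaryAtom {a c : Fin n} (h : a ≠ c) (q : Fin b × Fin 2) :
    (binaryAtom a c q : GroundAtom u b n).elements.card = 2 := by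
  obtain ⟨R, i⟩ := q
  fin_cases i <;> simp [binaryAtom, GroundAtom.elements, h, h.symm]

/-- A world is given by the types of its elements and by the tables of its pairs of elements. -/
noncomputable def worldEquiv : World u b n ≃
    (Fin n → Pred u b → Bool) × (OrderedPair n → Fin b × Fin 2 → Bool) :=
  ((Equiv.ofBijective _ atomOf_bijective).symm.arrowCongr (Equiv.refl Bool)).trans
    ((Equiv.sumArrowEquivProdArrow _ _ _).trans
      ((Equiv.curry _ _ _).prodCongr (Equiv.curry _ _ _)))

/-- The condition on the type of a single element `a`: it satisfies `ψ` with both variables equal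
to `a`, and agrees with the unary evidence. As the two arguments are equal, all binary atoms are
determined by the type. -/
def TypeSat (ψ : Formula u b) (U : UnaryEvidence u b n) (a : Fin n) (s : Pred u b → Bool) : Prop :=
  PairSat ψ s s (fun q => s (.inr q.1)) ∧
    ∀ p, p ∈ U.preds → (s p = true ↔ unaryAtom a p ∈ U.atoms)

/-- The condition on a pair of elements of the types `s` and `t`: it satisfies `ψ`, in both orders,
and agrees with the truth values `ev` of the predicates in `D`. -/
def TableSat (ψ : Formula u b) (D : Finset (Pred u b)) (ev : Fin b × Fin 2 → Prop)
    (s t : Pred u b → Bool) (β : Fin b × Fin 2 → Bool) : Prop :=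
  (PairSat ψ s t β ∧ PairSat ψ t s fun q => β (swapArgs q)) ∧
    ∀ q, Sum.inr q.1 ∈ D → (β q = true ↔ ev q)

theorem unaryEvidence_holds_iff (U : UnaryEvidence u b n) (ω : World u b n) :
    U.Holds ω ↔ ∀ a p, p ∈ U.preds → (ω (unaryAtom a p) = true ↔ unaryAtom a p ∈ U.atoms) := by
  refine ⟨fun h a p hp => h _ (elements_unaryAtom a p) (by rwa [pred_unaryAtom]),
    fun h α h1 h2 => ?_⟩
  obtain ⟨⟨a, p⟩ | ⟨p, q⟩, rfl⟩ := atomOf_bijective.2 α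
  · refine h a p ?_
    rwa [atomOf, Sum.elim_inl, pred_unaryAtom] at h2
  · rw [atomOf, Sum.elim_inr, elements_binaryAtom p.2.ne] at h1
    omega

theorem binaryEvidence_holds_iff (E : BinaryEvidence u b n) (ω : World u b n) :
    E.Holds ω ↔ ∀ (p : OrderedPair n) (q : Fin b × Fin 2), Sum.inr q.1 ∈ E.preds →
      (ω (binaryAtom p.1.1 p.1.2 q) = true ↔ binaryAtom p.1.1 p.1.2 q ∈ E.atoms) := by
  refine ⟨fun h p q hp => h _ (elements_binaryAtom p.2.ne q) (by rwa [pred_binaryAtom]),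
    fun h α h1 h2 => ?_⟩
  obtain ⟨⟨a, p⟩ | ⟨p, q⟩, rfl⟩ := atomOf_bijective.2 α
  · rw [atomOf, Sum.elim_inl, elements_unaryAtom] at h1
    omega
  · exact h p q h2

theorem models_iff {ψ : Formula u b} (hψ : ψ.IsQuantifierFree) (ω : World u b n) :
    Models ω ψ ↔ (∀ a, PairSat ψ (fun p => ω (unaryAtom a p)) (fun p => ω (unaryAtom a p))
        fun q => ω (unaryAtom a (.inr q.1))) ∧
      ∀ p : OrderedPair n,
        PairSat ψ (fun p' => ω (unaryAtom p.1.1 p')) (fun p' => ω (unaryAtom p.1.2 p'))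
          (fun q => ω (binaryAtom p.1.1 p.1.2 q)) ∧
        PairSat ψ (fun p' => ω (unaryAtom p.1.2 p')) (fun p' => ω (unaryAtom p.1.1 p'))
          (fun q => ω (binaryAtom p.1.1 p.1.2 (swapArgs q))) := by
  have hdiag : ∀ a : Fin n, (fun q : Fin b × Fin 2 => ω (binaryAtom a a q)) =
      fun q => ω (unaryAtom a (.inr q.1)) := by
    intro a
    funext ⟨R, i⟩
    fin_cases i <;> rfl
  constructor
  · intro h
    refine ⟨fun a => ?_, fun p => ⟨?_, ?_⟩⟩
    · have := (hψ.realize_iff_pairSat ω _).mp (h ![a, a])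
      simpa [hdiag] using this
    · have := (hψ.realize_iff_pairSat ω _).mp (h ![p.1.1, p.1.2])
      simpa using this
    · have := (hψ.realize_iff_pairSat ω _).mp (h ![p.1.2, p.1.1])
      simpa [binaryAtom_swapArgs] using this
  · rintro ⟨h1, h2⟩ v
    rw [hψ.realize_iff_pairSat]
    rcases lt_trichotomy (v 0) (v 1) with h | h | h
    · exact (h2 ⟨(v 0, v 1), h⟩).1
    · rw [← h, hdiag]
      exact h1 _
    · have := (h2 ⟨(v 1, v 0), h⟩).2
      simpa [binaryAtom_swapArgs] using this

open Classical in
/-- The weight of the type `s` of the element `a`. -/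
noncomputable def typeWeight (ψ : Formula u b) (U : UnaryEvidence u b n) (w wbar : Pred u b → ℝ)
    (a : Fin n) (s : Pred u b → Bool) : ℝ :=
  if TypeSat ψ U a s then ∏ p, if s p = true then w p else wbar p else 0

open Classical in
/-- The weight of a pair of elements of the types `s` and `t`, summed over all its tables. -/
noncomputable def tableWeight (ψ : Formula u b) (D : Finset (Pred u b))
    (ev : Fin b × Fin 2 → Prop) (w wbar : Pred u b → ℝ) (s t : Pred u b → Bool) : ℝ :=
  ∑ β : Fin b × Fin 2 → Bool, if TableSat ψ D ev s t β then
    ∏ q, if β q = true then w (.inr q.1) else wbar (.inr q.1) else 0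

theorem tableWeight_symm (ψ : Formula u b) (D : Finset (Pred u b))
    (ev : Fin b × Fin 2 → Prop) (w wbar : Pred u b → ℝ) (s t : Pred u b → Bool) :
    tableWeight ψ D (fun q => ev (swapArgs q)) w wbar t s = tableWeight ψ D ev w wbar s t := by
  classical
  have hs : Function.Involutive (swapArgs : Fin b × Fin 2 → _) := swapArgs_swapArgs
  refine Fintype.sum_equiv (hs.toPerm.arrowCongr (Equiv.refl Bool)) _ _ fun β => ?_
  have e : ∀ q, (hs.toPerm.arrowCongr (Equiv.refl Bool)) β q = β (swapArgs q) := fun _ => rfl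
  refine if_congr ?_ ?_ rfl
  · simp only [TableSat, e, swapArgs_swapArgs]
    refine and_congr and_comm ?_
    refine ⟨fun h q hq => ?_, fun h q hq => ?_⟩
    · have := h (swapArgs q) hq
      rwa [swapArgs_swapArgs] at this
    · have := h (swapArgs q) hq
      rwa [swapArgs_swapArgs] at this
  · exact Fintype.prod_equiv hs.toPerm _ _ fun q => by
      rw [e, Function.Involutive.coe_toPerm, swapArgs_swapArgs]
      rfl

/-- The model count is the partition function of a system in which each element interacts with each
other element. -/
theorem wfomc_eq_sum_types {φ ψ : Formula u b} (hψ : ψ.IsQuantifierFree)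
    (hφ : ∀ ω : World u b n, Models ω φ ↔ Models ω ψ) (U : UnaryEvidence u b n)
    (E : BinaryEvidence u b n) (w wbar : Pred u b → ℝ) :
    wfomc φ U E w wbar = ∑ τ : Fin n → Pred u b → Bool, (∏ a, typeWeight ψ U w wbar a (τ a)) *
      ∏ p : OrderedPair n, tableWeight ψ E.preds (fun q => binaryAtom p.1.1 p.1.2 q ∈ E.atoms)
        w wbar (τ p.1.1) (τ p.1.2) := by
  classical
  have key : ∀ ω : World u b n,
      (if φ.Models ω ∧ U.Holds ω ∧ E.Holds ω then weight w wbar ω else 0) =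
      (∏ a, typeWeight ψ U w wbar a ((worldEquiv ω).1 a)) * ∏ p : OrderedPair n,
        if TableSat ψ E.preds (fun q => binaryAtom p.1.1 p.1.2 q ∈ E.atoms)
          ((worldEquiv ω).1 p.1.1) ((worldEquiv ω).1 p.1.2) ((worldEquiv ω).2 p) then
        ∏ q, if (worldEquiv ω).2 p q = true then w (.inr q.1) else wbar (.inr q.1) else 0 := by
    intro ω
    simp only [typeWeight, Finset.prod_ite_zero, Finset.mem_univ, true_imp_iff]
    rw [ite_zero_mul_ite_zero]
    refine if_congr ?_ ?_ rfl
    · rw [hφ, models_iff hψ, unaryEvidence_holds_iff, binaryEvidence_holds_iff]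
      simp only [TypeSat, TableSat, forall_and]
      constructor
      · rintro ⟨⟨h1, h2, h3⟩, h4, h5⟩
        exact ⟨⟨h1, h4⟩, ⟨h2, h3⟩, h5⟩
      · rintro ⟨⟨h1, h4⟩, ⟨h2, h3⟩, h5⟩
        exact ⟨⟨h1, h2, h3⟩, h4, h5⟩
    · rw [weight, ← (Equiv.ofBijective _ (atomOf_bijective (u := u) (b := b) (n := n))).prod_comp,
        Fintype.prod_sum_type, Fintype.prod_prod_type, Fintype.prod_prod_type]
      congr 1
      refine Finset.prod_congr rfl fun a _ => Finset.prod_congr rfl fun p _ => ?_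
      simp only [Equiv.ofBijective_apply, atomOf, Sum.elim_inl, pred_unaryAtom]
      rfl
  rw [wfomc, Finset.sum_congr rfl fun ω _ => key ω,
    worldEquiv.sum_comp (fun x : (Fin n → Pred u b → Bool) × (OrderedPair n → Fin b × Fin 2 → Bool)
      => (∏ a, typeWeight ψ U w wbar a (x.1 a)) * ∏ p : OrderedPair n,
        if TableSat ψ E.preds (fun q => binaryAtom p.1.1 p.1.2 q ∈ E.atoms)
          (x.1 p.1.1) (x.1 p.1.2) (x.2 p) then
        ∏ q, if x.2 p q = true then w (.inr q.1) else wbar (.inr q.1) else 0),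
    Fintype.sum_prod_type]
  refine Finset.sum_congr rfl fun τ _ => ?_
  dsimp only
  rw [← Finset.mul_sum]
  congr 1
  simp only [tableWeight, Finset.prod_univ_sum, Fintype.piFinset_univ]

end Types

/-! ### Counting pairs by their types -/

section Counting
variable {n c : ℕ}

theorem prod_orderedPair {M : Type*} [CommMonoid M] (F : Sym2 (Fin n) → M) :
    ∏ p : OrderedPair n, F s(p.1.1, p.1.2) = ∏ e with ¬ e.IsDiag, F e := by
  have h : ∏ e ∈ (Finset.univ : Finset (Fin n)).sym2 with ¬ e.IsDiag, F e =
      ∏ p ∈ Finset.univ.offDiag with p.1 < p.2, F s(p.1, p.2) :=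
    Finset.sum_sym2_filter_not_isDiag (M := Additive M) Finset.univ F
  rw [Finset.sym2_univ] at h
  rw [h]
  have : (Finset.univ.filter fun p : Fin n × Fin n => p.1 < p.2) =
      Finset.univ.offDiag.filter fun p => p.1 < p.2 := by
    ext p
    simpa using fun h : p.1 < p.2 => h.ne
  rw [← this]
  exact (Finset.prod_subtype (p := fun p : Fin n × Fin n => p.1 < p.2) _ (by simp) fun p =>
    F s(p.1, p.2)).symm

/-- The number of pairs of distinct elements whose types are those in `z`, if there are `N s`
elements of the type `s`. -/
def pairCount (N : Fin c → ℕ) : Sym2 (Fin c) → ℕ :=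
  Sym2.lift ⟨fun s t => if s = t then (N s).choose 2 else N s * N t, fun s t => by
    by_cases h : s = t
    · simp [h]
    · simp [h, Ne.symm h, mul_comm]⟩

theorem card_pairs_eq_pairCount (τ : Fin n → Fin c) (z : Sym2 (Fin c)) :
    (Finset.univ.filter fun e : Sym2 (Fin n) => ¬ e.IsDiag ∧ e.map τ = z).card =
      pairCount (fun s => (Finset.univ.filter fun x => τ x = s).card) z := by
  classical
  induction z with | _ s t => ?_
  simp only [pairCount, Sym2.lift_mk]
  split_ifs with h
  · subst h
    rw [← Sym2.card_image_offDiag]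
    congr 1
    ext e
    induction e with | _ x y => ?_
    simp only [Finset.mem_filter, Finset.mem_univ, true_and, Sym2.mk_isDiag_iff, Sym2.map_mk,
      Sym2.eq_iff, Finset.mem_image, Finset.mem_offDiag, Prod.exists, Function.uncurry_apply_pair]
    constructor
    · rintro ⟨h1, h2⟩
      exact ⟨x, y, by tauto, by simp⟩
    · rintro ⟨x', y', h1, h2⟩
      rcases h2 with ⟨rfl, rfl⟩ | ⟨rfl, rfl⟩
      · tauto
      · exact ⟨fun h => h1.2.2 h.symm, Or.inl ⟨h1.2.1, h1.1⟩⟩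
  · rw [← Finset.card_product]
    symm
    refine Finset.card_bij (fun p _ => s(p.1, p.2)) ?_ ?_ ?_
    · rintro ⟨x, y⟩ hp
      simp only [Finset.mem_product, Finset.mem_filter, Finset.mem_univ, true_and] at hp
      simp only [Finset.mem_filter, Finset.mem_univ, true_and, Sym2.mk_isDiag_iff, Sym2.map_mk,
        hp.1, hp.2, and_true]
      rintro rfl
      exact h (hp.1.symm.trans hp.2)
    · rintro ⟨x, y⟩ hp ⟨x', y'⟩ hp' he
      simp only [Finset.mem_product, Finset.mem_filter, Finset.mem_univ, true_and] at hp hp'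
      rcases Sym2.eq_iff.mp he with ⟨h1, h2⟩ | ⟨h1, h2⟩
      · exact Prod.ext h1 h2
      · exact absurd (hp.1.symm.trans ((congrArg τ h1).trans hp'.2)) h
    · intro e he
      induction e with | _ x y => ?_
      simp only [Finset.mem_filter, Finset.mem_univ, true_and, Sym2.mk_isDiag_iff, Sym2.map_mk,
        Sym2.eq_iff] at he
      rcases he.2 with ⟨h1, h2⟩ | ⟨h1, h2⟩
      · exact ⟨(x, y), by simp [h1, h2], rfl⟩
      · exact ⟨(y, x), by simp [h1, h2], Sym2.eq_swap⟩

/-- The pairs without an edge, the weights of which only depend on their types, enter through their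
numbers. The edges are among the pairs, so that nothing is truncated in the difference. -/
theorem prod_pairs_eq (G : SimpleGraph (Fin n)) [DecidableRel G.Adj] (τ : Fin n → Fin c)
    (F : Sym2 (Fin n) → ℝ) (r : Sym2 (Fin c) → ℝ)
    (hF : ∀ e, ¬ e.IsDiag → e ∉ G.edgeSet → F e = r (e.map τ)) :
    ∏ e with ¬ e.IsDiag, F e = (∏ e ∈ G.edgeFinset, F e) *
      ∏ z, r z ^ (pairCount (fun s => (Finset.univ.filter fun x => τ x = s).card) z -
        (G.edgeFinset.filter fun e => e.map τ = z).card) := by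
  classical
  have hsub : G.edgeFinset ⊆ Finset.univ.filter fun e : Sym2 (Fin n) => ¬ e.IsDiag := by
    intro e he
    simpa using G.not_isDiag_of_mem_edgeFinset he
  rw [← Finset.prod_sdiff hsub, mul_comm]
  congr 1
  rw [Finset.prod_congr rfl fun e he => hF e (by simpa using (Finset.mem_sdiff.mp he).1)
    (by simpa using (Finset.mem_sdiff.mp he).2),
    ← Finset.prod_fiberwise' _ (fun e : Sym2 (Fin n) => e.map τ) r]
  refine Finset.prod_congr rfl fun z _ => ?_
  rw [Finset.prod_const, ← card_pairs_eq_pairCount, ← Finset.filter_filter,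
    ← Finset.card_sdiff_of_subset (Finset.filter_subset_filter _ hsub)]
  congr 2
  ext e
  simp only [Finset.mem_filter, Finset.mem_sdiff]
  tauto

end Counting

/-! ### Elimination of the pairs without evidence -/

section Polynomials
variable {n c d : ℕ}

open Classical in
/-- The exponent of a term of the partition function: the number of elements of each type and the
number of edges with each pair of types. -/
noncomputable def typeExponent (G : SimpleGraph (Fin n))
    (var : Fin c ⊕ Sym2 (Fin c) ≃ Fin d) (τ : Fin n → Fin c) : Fin d →₀ ℕ :=
  ∑ x, Finsupp.single (var (.inl (τ x))) 1 +
    ∑ e ∈ G.edgeFinset, Finsupp.single (var (.inr (e.map τ))) 1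

open Classical in
theorem typeExponent_inl (G : SimpleGraph (Fin n))
    (var : Fin c ⊕ Sym2 (Fin c) ≃ Fin d) (τ : Fin n → Fin c) (s : Fin c) :
    typeExponent G var τ (var (.inl s)) = (Finset.univ.filter fun x => τ x = s).card := by
  simp [typeExponent, Finsupp.single_apply]

open Classical in
theorem typeExponent_inr (G : SimpleGraph (Fin n))
    (var : Fin c ⊕ Sym2 (Fin c) ≃ Fin d) (τ : Fin n → Fin c) (z : Sym2 (Fin c)) :
    typeExponent G var τ (var (.inr z)) = (G.edgeFinset.filter fun e => e.map τ = z).card := by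
  simp [typeExponent, Finsupp.single_apply]

open Classical in
theorem typeExponent_lt (G : SimpleGraph (Fin n))
    (var : Fin c ⊕ Sym2 (Fin c) ≃ Fin d) (τ : Fin n → Fin c) (j : Fin d) :
    typeExponent G var τ j < n * n + 1 := by
  obtain ⟨s | z, rfl⟩ := var.surjective j
  · rw [typeExponent_inl]
    have := Finset.card_le_univ (Finset.univ.filter fun x => τ x = s)
    rw [Fintype.card_fin] at this
    nlinarith [Nat.le_mul_self n]
  · rw [typeExponent_inr]
    have h1 := Finset.card_filter_le G.edgeFinset fun e => e.map τ = z
    have h2 := G.card_edgeFinset_le_card_choose_two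
    rw [Fintype.card_fin] at h2
    have h3 := Nat.choose_le_pow n 2
    rw [pow_two] at h3
    omega

/-- The vertex weights with markers for the types. -/
noncomputable def markedVertexWeight (var : Fin c ⊕ Sym2 (Fin c) ≃ Fin d)
    (α : Fin n → Fin c → ℝ) (x : Fin n) (t : Fin c) : MvPolynomial (Fin d) ℝ :=
  .C (α x t) * .X (var (.inl t))

/-- The edge weights with markers for the pairs of types. -/
noncomputable def markedEdgeWeight (var : Fin c ⊕ Sym2 (Fin c) ≃ Fin d)
    (ρ : Sym2 (Fin n × Fin c) → ℝ) (e : Sym2 (Fin n × Fin c)) : MvPolynomial (Fin d) ℝ :=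
  .C (ρ e) * .X (var (.inr (e.map Prod.snd)))

open Classical in
theorem partitionSum_marked (G : SimpleGraph (Fin n))
    (var : Fin c ⊕ Sym2 (Fin c) ≃ Fin d) (α : Fin n → Fin c → ℝ) (ρ : Sym2 (Fin n × Fin c) → ℝ)
    (f : Fin n → Fin c) :
    partitionSum G (markedVertexWeight var α) (markedEdgeWeight var ρ) Finset.univ f =
      ∑ τ, MvPolynomial.monomial (typeExponent G var τ)
        ((∏ x, α x (τ x)) * ∏ e ∈ G.edgeFinset, ρ (e.map fun x => (x, τ x))) := by
  unfold partitionSum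
  refine Finset.sum_congr (by ext; simp) fun τ _ => ?_
  have hm : ∀ e : Sym2 (Fin n), (e.map fun x => (x, τ x)).map Prod.snd = e.map τ := fun e => by
    rw [Sym2.map_map]
    rfl
  rw [typeExponent, ← MvPolynomial.monomial_mul, ← mul_one (∏ x, α x (τ x)),
    ← mul_one (∏ e ∈ G.edgeFinset, ρ (e.map fun x => (x, τ x))), ← MvPolynomial.C_mul_monomial,
    ← MvPolynomial.C_mul_monomial, MvPolynomial.monomial_sum_one, MvPolynomial.monomial_sum_one,
    map_prod, map_prod, ← Finset.prod_mul_distrib, ← Finset.prod_mul_distrib]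
  congr 1
  refine Finset.prod_congr ?_ fun e _ => by rw [markedEdgeWeight, hm, MvPolynomial.X]
  ext e
  simp only [Finset.mem_univ, true_and, Finset.mem_filter, and_iff_left_iff_imp]
  induction e with | _ x y => exact fun _ => ⟨x, Sym2.mem_mk_left x y⟩

/-- The product of the weights of the pairs without an edge, as a function of the exponents. For
exponents that do not occur in the partition function, the value is irrelevant. -/
noncomputable def remainingWeight (var : Fin c ⊕ Sym2 (Fin c) ≃ Fin d) (r : Sym2 (Fin c) → ℝ)
    (m : Fin d → ℕ) : ℝ :=
  ∏ z, r z ^ (pairCount (fun s => m (var (.inl s))) z - m (var (.inr z)))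

/-- The partition function of a complete graph is determined by that of the marked graph `G` if the
weights of the other pairs only depend on the types. -/
theorem sum_types_eq_sum_coeff (G : SimpleGraph (Fin n))
    (var : Fin c ⊕ Sym2 (Fin c) ≃ Fin d) (α : Fin n → Fin c → ℝ) (ρ : Sym2 (Fin n × Fin c) → ℝ)
    (r : Sym2 (Fin c) → ℝ)
    (hr : ∀ e : Sym2 (Fin n × Fin c), ¬ (e.map Prod.fst).IsDiag → e.map Prod.fst ∉ G.edgeSet →
      ρ e = r (e.map Prod.snd)) (f : Fin n → Fin c) :
    ∑ τ : Fin n → Fin c, (∏ x, α x (τ x)) *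
        ∏ p : OrderedPair n, ρ s((p.1.1, τ p.1.1), (p.1.2, τ p.1.2)) =
      ∑ m : Fin d → Fin (n * n + 1), (partitionSum G (markedVertexWeight var α)
        (markedEdgeWeight var ρ) Finset.univ f).coeff (boxExponents m) *
          remainingWeight var r fun j => m j := by
  classical
  simp only [partitionSum_marked, MvPolynomial.coeff_sum, Finset.sum_mul]
  rw [Finset.sum_comm]
  refine Finset.sum_congr rfl fun τ _ => ?_
  rw [Finset.sum_eq_single fun j => ⟨typeExponent G var τ j, typeExponent_lt G var τ j⟩]
  · have h1 : boxExponents (fun j => (⟨typeExponent G var τ j, typeExponent_lt G var τ j⟩ :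
        Fin (n * n + 1))) = typeExponent G var τ := Finsupp.ext fun j => rfl
    rw [h1, MvPolynomial.coeff_monomial, if_pos rfl, mul_assoc]
    congr 1
    have h2 := prod_orderedPair fun e : Sym2 (Fin n) => ρ (e.map fun x => (x, τ x))
    simp only [Sym2.map_mk] at h2
    have hm : ∀ e : Sym2 (Fin n), (e.map fun x => (x, τ x)).map Prod.snd = e.map τ := fun e => by
      rw [Sym2.map_map]
      rfl
    have hm' : ∀ e : Sym2 (Fin n), (e.map fun x => (x, τ x)).map Prod.fst = e := fun e => by
      rw [Sym2.map_map]
      exact congrFun Sym2.map_id' e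
    rw [h2, prod_pairs_eq G τ _ r fun e h h' => by
      rw [hr _ (by rwa [hm']) (by rwa [hm']), hm]]
    simp only [remainingWeight, typeExponent_inl, typeExponent_inr]
  · intro m _ hm
    rw [MvPolynomial.coeff_monomial, if_neg, zero_mul]
    rintro h
    exact hm (funext fun j => Fin.ext (DFunLike.congr_fun h j).symm)
  · simp

end Polynomials

section Evidence
variable {u b n c d : ℕ}

/-- The weight of a pair of elements with types, under the binary evidence `E`. -/
noncomputable def evidenceWeight (ψ : Formula u b) (E : BinaryEvidence u b n)
    (w wbar : Pred u b → ℝ) (typ : Fin c ≃ (Pred u b → Bool)) : Sym2 (Fin n × Fin c) → ℝ :=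
  Sym2.lift ⟨fun x y => tableWeight ψ E.preds (fun q => binaryAtom x.1 y.1 q ∈ E.atoms) w wbar
    (typ x.2) (typ y.2), fun x y => by
      dsimp only
      rw [← tableWeight_symm]
      simp only [binaryAtom_swapArgs]⟩

/-- The weight of a pair of types if no atom is listed. -/
noncomputable def defaultWeight (ψ : Formula u b) (D : Finset (Pred u b)) (w wbar : Pred u b → ℝ)
    (typ : Fin c ≃ (Pred u b → Bool)) : Sym2 (Fin c) → ℝ :=
  Sym2.lift ⟨fun s t => tableWeight ψ D (fun _ => False) w wbar (typ s) (typ t), fun _ _ =>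
    (tableWeight_symm _ _ _ _ _ _ _).symm⟩

theorem evidenceWeight_eq_defaultWeight (ψ : Formula u b) (E : BinaryEvidence u b n)
    (w wbar : Pred u b → ℝ) (typ : Fin c ≃ (Pred u b → Bool)) (e : Sym2 (Fin n × Fin c))
    (he : ¬ (e.map Prod.fst).IsDiag) (he' : e.map Prod.fst ∉ E.gaifmanGraph.edgeSet) :
    evidenceWeight ψ E w wbar typ e = defaultWeight ψ E.preds w wbar typ (e.map Prod.snd) := by
  induction e with | _ x y => ?_
  have hxy : x.1 ≠ y.1 := he
  have hadj : ¬ E.gaifmanGraph.Adj x.1 y.1 := he'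
  have h : ∀ q, ¬ (binaryAtom x.1 y.1 q ∈ E.atoms) := by
    rintro ⟨R, i⟩ hq
    refine hadj ⟨hxy, R, ?_⟩
    fin_cases i
    · exact Or.inl hq
    · exact Or.inr hq
  simp only [evidenceWeight, defaultWeight, Sym2.lift_mk, Sym2.map_mk, h]

/-- The partition function of the Gaifman graph with marked weights, computed by a recursion over
separators that starts with the single vertex `x`. -/
noncomputable def rootValue (k : ℕ) (ψ : Formula u b) (U : UnaryEvidence u b n)
    (E : BinaryEvidence u b n) (w wbar : Pred u b → ℝ) (typ : Fin c ≃ (Pred u b → Bool))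
    (var : Fin c ⊕ Sym2 (Fin c) ≃ Fin d) (x : Fin n) : MvPolynomial (Fin d) ℝ :=
  ∑ t, markedVertexWeight var (fun a s => typeWeight ψ U w wbar a (typ s)) x t *
    componentProduct E.gaifmanGraph (fun _ : Fin (k + 1) => x) (fun y => y ≠ x) fun y =>
      roundValue E.gaifmanGraph
        (markedVertexWeight var fun a s => typeWeight ψ U w wbar a (typ s))
        (markedEdgeWeight var (evidenceWeight ψ E w wbar typ)) n
        ((fun _ : Fin (k + 1) => x), y, fun _ => t)

theorem wfomc_eq_sum_coeff {φ ψ : Formula u b} (hψ : ψ.IsQuantifierFree)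
    (hφ : ∀ ω : World u b n, φ.Models ω ↔ ψ.Models ω) (U : UnaryEvidence u b n)
    (E : BinaryEvidence u b n) (w wbar : Pred u b → ℝ) (typ : Fin c ≃ (Pred u b → Bool))
    (var : Fin c ⊕ Sym2 (Fin c) ≃ Fin d) {k : ℕ} (hk : TreewidthAtMost E.gaifmanGraph k)
    (x : Fin n) :
    wfomc φ U E w wbar = ∑ m : Fin d → Fin (n * n + 1),
      (rootValue k ψ U E w wbar typ var x).coeff (boxExponents m) *
        remainingWeight var (defaultWeight ψ E.preds w wbar typ) fun j => m j := by
  obtain ⟨m, T, bag, hT, hbag⟩ := hk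
  rw [wfomc_eq_sum_types hψ hφ, ← Equiv.sum_comp (Equiv.arrowCongr (Equiv.refl (Fin n)) typ)]
  have h0 : Fin n → Fin c := fun _ => typ.symm fun _ => true
  have := sum_types_eq_sum_coeff E.gaifmanGraph var
    (fun a s => typeWeight ψ U w wbar a (typ s)) (evidenceWeight ψ E w wbar typ)
    (defaultWeight ψ E.preds w wbar typ) (evidenceWeight_eq_defaultWeight ψ E w wbar typ) h0
  simp only [partitionSum_univ_eq hT hbag x h0] at this
  exact this

theorem wfomc_of_isEmpty {φ ψ : Formula u b} (hψ : ψ.IsQuantifierFree)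
    (hφ : ∀ ω : World u b n, φ.Models ω ↔ ψ.Models ω) (U : UnaryEvidence u b n)
    (E : BinaryEvidence u b n) (w wbar : Pred u b → ℝ) (hn : n = 0) :
    wfomc φ U E w wbar = 1 := by
  subst hn
  have : IsEmpty (OrderedPair 0) := ⟨fun p => p.1.1.elim0⟩
  simp [wfomc_eq_sum_types hψ hφ]

end Evidence

/-! ### Reading the input -/

/-- A problem instance: closed-world evidence over the domain `Fin n`, and weights. -/
structure Problem (u b : ℕ) where
  n : ℕ
  unary : UnaryEvidence u b n
  binary : BinaryEvidence u b n
  w : Pred u b → ℝ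
  wbar : Pred u b → ℝ

/-- The Gaifman graph of the binary evidence. -/
abbrev Problem.graph {u b : ℕ} (I : Problem u b) : SimpleGraph (Fin I.n) := I.binary.gaifmanGraph

/-- The context without variables. -/
instance {u b : ℕ} : Ctx (Problem u b) where
  input I := ⟨inputWords I.unary I.binary, inputValues I.w I.wbar⟩
  Holds _ _ _ _ := True
  holds_of_agree _ _ _ _ := trivial

theorem getElem?_flatMap_of_length {α β : Type} {l : List α} {f : α → List β} {m : ℕ}
    (h : ∀ x ∈ l, (f x).length = m) {i j : ℕ} (hj : j < m) :
    (l.flatMap f)[i * m + j]? = l[i]?.bind fun x => (f x)[j]? := by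
  induction l generalizing i with
  | nil => simp
  | cons x l ih =>
    have hx := h x (by simp)
    rw [List.flatMap_cons]
    cases i with
    | zero => rw [List.getElem?_append_left (by omega)]; simp
    | succ i =>
      have e : (i + 1) * m + j - (f x).length = i * m + j := by
        rw [hx, Nat.succ_mul]; omega
      rw [List.getElem?_append_right (by rw [hx, Nat.succ_mul]; omega), e,
        ih fun y hy => h y (by simp [hy])]
      simp

theorem length_allPreds (u b : ℕ) : (allPreds u b).length = u + b := by simp [allPreds]

theorem exists_allPreds {u b : ℕ} (p : Pred u b) : ∃ j < u + b, (allPreds u b)[j]? = some p := by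
  have hp : p ∈ allPreds u b := by cases p <;> simp [allPreds]
  obtain ⟨j, hj, h⟩ := List.mem_iff_getElem.mp hp
  exact ⟨j, by rwa [length_allPreds] at hj, by rw [List.getElem?_eq_getElem hj, h]⟩

theorem allAtoms_inl {u b n : ℕ} (P : Fin u) (a : Fin n) :
    (allAtoms u b n)[(P : ℕ) * n + a]? = some (.inl (P, a)) := by
  have h := getElem?_flatMap_of_length (l := List.finRange u) (f := fun P =>
    (List.finRange n).map fun a => (Sum.inl (P, a) : GroundAtom u b n)) (m := n) (by simp)
    (i := P) a.2
  have h' : (P : ℕ) * n + a < u * n := by nlinarith [P.2, a.2]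
  rw [allAtoms, List.getElem?_append_left (by simpa [List.length_flatMap] using h'), h]
  simp

theorem allAtoms_inr {u b n : ℕ} (R : Fin b) (a c : Fin n) :
    (allAtoms u b n)[u * n + (R * (n * n) + (a * n + c))]? = some (.inr (R, a, c)) := by
  have h := getElem?_flatMap_of_length (l := List.finRange b) (f := fun R =>
    (List.finRange n).flatMap fun a => (List.finRange n).map fun c =>
      (Sum.inr (R, a, c) : GroundAtom u b n)) (m := n * n) (by simp [List.length_flatMap])
    (i := R) (j := a * n + c) (by nlinarith [a.2, c.2])
  have h2 := getElem?_flatMap_of_length (l := List.finRange n) (f := fun a =>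
    (List.finRange n).map fun c => (Sum.inr (R, a, c) : GroundAtom u b n)) (m := n) (by simp)
    (i := a) c.2
  rw [allAtoms, List.getElem?_append_right (by simp [List.length_flatMap])]
  simp only [List.length_flatMap, List.length_map, List.length_finRange, List.map_const',
    List.sum_replicate, smul_eq_mul, Nat.add_sub_cancel_left]
  rw [h]
  have hR : (List.finRange b)[(R : ℕ)]? = some R := by simp
  rw [hR, Option.bind_some, h2]
  simp

section Input
variable {u b : ℕ} {Γ : Type} [Ctx Γ] {π : Γ → Problem u b}

theorem polyBounded_domain (hπ : IsProjection π) : PolyBounded fun γ => (π γ).n :=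
  (PolyBounded.size (Γ := Problem u b)).comp hπ

theorem polyFam_domain (hπ : IsProjection π) : PolyFam fun γ => Fin (π γ).n :=
  polyBounded_domain hπ

theorem Indexes.const {c : ℕ} (j : Fin c) : Indexes (ι := fun _ : Γ => Fin c) fun _ => j :=
  Computes.nat j

theorem decides_bit (hπ : IsProjection π) {P : Γ → Prop} {i : Γ → ℕ} (hi : Computes i)
    (h : ∀ γ, (inputWords (π γ).unary (π γ).binary).getD (i γ) 0 =
      @ite _ (P γ) (Classical.propDecidable _) 1 0) : Decides P :=
  hi.word.congr fun γ => by
    rw [← hπ.1 γ]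
    exact h γ

theorem decides_mem_unaryPreds (hπ : IsProjection π) (p : Pred u b) :
    Decides fun γ => p ∈ (π γ).unary.preds := by
  classical
  obtain ⟨j, hj, h⟩ := exists_allPreds p
  refine decides_bit hπ (.nat (j + 1)) fun γ => ?_
  rw [inputWords, List.getD_cons_succ, List.getD_eq_getElem?_getD, List.append_assoc,
    List.getElem?_append_left (by rwa [List.length_map, length_allPreds]), List.getElem?_map, h]
  simp

theorem decides_mem_binaryPreds (hπ : IsProjection π) (p : Pred u b) :
    Decides fun γ => p ∈ (π γ).binary.preds := by
  classical
  obtain ⟨j, hj, h⟩ := exists_allPreds p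
  refine decides_bit hπ (.nat (u + b + j + 1)) fun γ => ?_
  rw [inputWords, List.getD_cons_succ, List.getD_eq_getElem?_getD, List.append_assoc,
    List.getElem?_append_right (by rw [List.length_map, length_allPreds]; omega), List.length_map,
    length_allPreds, Nat.add_sub_cancel_left,
    List.getElem?_append_left (by rwa [List.length_map, length_allPreds]), List.getElem?_map, h]
  simp

/-- The bits of the ground atoms follow the domain size and the bits of the predicates. -/
theorem decides_listed (hπ : IsProjection π) {α : ∀ γ, GroundAtom u b (π γ).n} {i : Γ → ℕ}
    (hi : Computes i) (h : ∀ γ, (allAtoms u b (π γ).n)[i γ]? = some (α γ)) :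
    Decides fun γ => α γ ∈ (π γ).unary.atoms ∨ α γ ∈ (π γ).binary.atoms := by
  classical
  refine decides_bit hπ (hi.add (.nat (u + b + (u + b) + 1))) fun γ => ?_
  rw [inputWords, ← add_assoc, List.getD_cons_succ, List.getD_eq_getElem?_getD,
    List.getElem?_append_right (by simp [length_allPreds])]
  simp only [List.length_append, List.length_map, length_allPreds, Nat.add_sub_cancel,
    List.getElem?_map, h]
  simp

theorem decides_listed_inl (hπ : IsProjection π) (P : Fin u) {a : ∀ γ, Fin (π γ).n}
    (ha : Indexes a) : Decides fun γ => (.inl (P, a γ) : GroundAtom u b _) ∈ (π γ).unary.atoms ∨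
      (.inl (P, a γ) : GroundAtom u b _) ∈ (π γ).binary.atoms :=
  decides_listed hπ ((Computes.mulNat (.const (P : ℕ)) (polyBounded_domain hπ).1).add ha)
    fun γ => allAtoms_inl P (a γ)

theorem decides_listed_inr (hπ : IsProjection π) (R : Fin b) {a c : ∀ γ, Fin (π γ).n}
    (ha : Indexes a) (hc : Indexes c) :
    Decides fun γ => (.inr (R, a γ, c γ) : GroundAtom u b _) ∈ (π γ).unary.atoms ∨
      (.inr (R, a γ, c γ) : GroundAtom u b _) ∈ (π γ).binary.atoms := by
  have hn := polyBounded_domain hπ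
  refine decides_listed hπ (i := fun γ => u * (π γ).n + (R * ((π γ).n * (π γ).n) +
    ((π γ).n * a γ + c γ))) ((Computes.mulNat (.const u) hn.1).add
      ((Computes.mulNat (.const (R : ℕ)) (Computes.mulNat hn hn.1)).add
        ((Computes.mulNat hn ha).add hc)))
    fun γ => ?_
  rw [mul_comm (π γ).n (a γ : ℕ)]
  exact allAtoms_inr R (a γ) (c γ)

theorem decides_unaryAtom (hπ : IsProjection π) (p : Pred u b) {a : ∀ γ, Fin (π γ).n}
    (ha : Indexes a) : Decides fun γ => unaryAtom (a γ) p ∈ (π γ).unary.atoms := by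
  have h : ∀ γ, unaryAtom (a γ) p ∉ (π γ).binary.atoms := fun γ hγ => by
    have := (π γ).binary.card_elements _ hγ
    rw [elements_unaryAtom] at this
    omega
  rcases p with P | R
  · exact (decides_listed_inl hπ P ha).congr fun γ => or_iff_left (h γ)
  · exact (decides_listed_inr hπ R ha ha).congr fun γ => or_iff_left (h γ)

theorem decides_binaryAtom (hπ : IsProjection π) (R : Fin b) {a c : ∀ γ, Fin (π γ).n}
    (ha : Indexes a) (hc : Indexes c) :
    Decides fun γ => (.inr (R, a γ, c γ) : GroundAtom u b _) ∈ (π γ).binary.atoms := by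
  refine ((Indexes.eq ha hc).not.and (decides_listed_inr hπ R ha hc)).congr fun γ => ?_
  have hcard : GroundAtom.elements (.inr (R, a γ, c γ) : GroundAtom u b _) = {a γ, c γ} := rfl
  constructor
  · rintro ⟨hne, h | h⟩
    · have := (π γ).unary.card_elements _ h
      rw [hcard, Finset.card_pair hne] at this
      omega
    · exact h
  · refine fun h => ⟨fun he => ?_, Or.inr h⟩
    have := (π γ).binary.card_elements _ h
    rw [hcard, he] at this
    simp at this

theorem computes_w (hπ : IsProjection π) (p : Pred u b) : Computes fun γ => (π γ).w p := by
  obtain ⟨j, hj, h⟩ := exists_allPreds p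
  refine (Computes.nat j).value.congr fun γ => ?_
  rw [← hπ.1 γ]
  change (inputValues (π γ).w (π γ).wbar).getD j 0 = _
  rw [inputValues, List.getD_eq_getElem?_getD,
    List.getElem?_append_left (by rwa [List.length_map, length_allPreds]), List.getElem?_map, h]
  rfl

theorem computes_wbar (hπ : IsProjection π) (p : Pred u b) : Computes fun γ => (π γ).wbar p := by
  obtain ⟨j, hj, h⟩ := exists_allPreds p
  refine (Computes.nat (u + b + j)).value.congr fun γ => ?_
  rw [← hπ.1 γ]
  change (inputValues (π γ).w (π γ).wbar).getD (u + b + j) 0 = _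
  rw [inputValues, List.getD_eq_getElem?_getD,
    List.getElem?_append_right (by rw [List.length_map, length_allPreds]; omega), List.length_map,
    length_allPreds, Nat.add_sub_cancel_left, List.getElem?_map, h]
  rfl

end Input

/-! ### Computing the components and the separators -/

section Graph
variable {u b k : ℕ} {Γ : Type} [Ctx Γ] {π : Γ → Problem u b}

theorem decides_adj (hπ : IsProjection π) {a c : ∀ γ, Fin (π γ).n} (ha : Indexes a)
    (hc : Indexes c) : Decides fun γ => (π γ).graph.Adj (a γ) (c γ) :=
  (Indexes.eq ha hc).not.and (Decides.existsFinite fun R =>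
    (decides_binaryAtom hπ R ha hc).or (decides_binaryAtom hπ R hc ha))

theorem decides_mem_range (hπ : IsProjection π) {S : ∀ γ, Fin (k + 1) → Fin (π γ).n}
    (hS : Indexes S) {y : ∀ γ, Fin (π γ).n} (hy : Indexes y) :
    Decides fun γ => y γ ∈ Set.range (S γ) :=
  Decides.existsFinite fun j => Indexes.eq (hS.apply (polyFam_domain hπ) j) hy

theorem decides_inComp (hπ : IsProjection π) {S : ∀ γ, Fin (k + 1) → Fin (π γ).n}
    (hS : Indexes S) {v y : ∀ γ, Fin (π γ).n} (hv : Indexes v) (hy : Indexes y) :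
    Decides fun γ => InComp (π γ).graph (Set.range (S γ)) (v γ) (y γ) := by
  refine (Decides.iterateIn (polyFam_domain hπ) (polyBounded_domain hπ)
    (fun γ => reachWithin (π γ).graph (Set.range (S γ)) (v γ))
    (fun γ _ t y => t y ∨ y ∉ Set.range (S γ) ∧ ∃ a, t a ∧ (π γ).graph.Adj a y) ?_ ?_
    (fun _ _ => rfl) hy).congr fun γ => ?_
  · intro Δ _ ϖ r t y hϖ _ hy ht
    have hπ' : IsProjection fun δ => π (ϖ δ) := hπ.trans hϖ
    refine (ht (fun δ => δ) y .id hy).or ((decides_mem_range hπ' (hS.comp hϖ) hy).not.and ?_)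
    exact Decides.exists (polyFam_domain hπ')
      ((ht (fun p : Ext Δ fun δ => Fin (π (ϖ δ)).n => p.base) (fun p => p.top)
        IsProjection.id.base .top).and (decides_adj hπ'.base .top hy.weaken))
  · exact Indexes.eq .top hv.weaken
  · rw [inComp_iff_reachWithin, Fintype.card_fin]

theorem polyFam_position (hπ : IsProjection π) :
    PolyFam fun γ => Fin (k + 1) × Fin (π γ).n :=
  (PolyFam.fin (.const _)).prod (polyFam_domain hπ)

theorem decides_replaceable (hπ : IsProjection π)
    {solved : ∀ γ, (Fin (k + 1) → Fin (π γ).n) → Fin (π γ).n → Prop}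
    (h : ∀ {Δ : Type} [Ctx Δ] (ϖ : Δ → Γ) (S : ∀ δ, Fin (k + 1) → Fin (π (ϖ δ)).n)
      (v : ∀ δ, Fin (π (ϖ δ)).n), IsProjection ϖ → Indexes S → Indexes v →
      Decides fun δ => solved (ϖ δ) (S δ) (v δ))
    {S : ∀ γ, Fin (k + 1) → Fin (π γ).n} (hS : Indexes S) {v : ∀ γ, Fin (π γ).n} (hv : Indexes v)
    {q : ∀ γ, Fin (k + 1) × Fin (π γ).n} (hq : Indexes q) :
    Decides fun γ => Replaceable (π γ).graph (solved γ) (S γ) (v γ) (q γ) := by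
  have hV := polyFam_domain hπ
  have h1 : Indexes fun γ => (q γ).1 := hq.fst (PolyFam.fin (.const (k + 1))) hV
  have h2 : Indexes fun γ => (q γ).2 := hq.snd (PolyFam.fin (.const (k + 1))) hV
  have hS1 : Indexes fun γ => S γ (q γ).1 := hS.applyVar hV h1
  refine (decides_inComp hπ hS hv h2).and (Decides.and (.or ?_ ?_) ?_)
  · exact Decides.forall hV ((decides_inComp hπ.base hS.weaken hv.weaken .top).imp
      (decides_adj hπ.base .top hS1.weaken).not)
  · exact Decides.existsFinite fun j => (Indexes.eq (Indexes.const j) h1).not.and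
      (Indexes.eq (hS.apply hV j) hS1)
  · refine Decides.forall hV ((decides_inComp hπ.base hS.weaken hv.weaken .top).imp
      ((Indexes.eq .top h2.weaken).not.imp (h (fun p : Ext Γ fun γ => Fin (π γ).n => p.base) _ _
        IsProjection.id.base ?_ .top)))
    exact (hS.update hV h1 h2).weaken

theorem decides_solvable (hπ : IsProjection π) {r : ∀ γ, Fin (π γ).n} (hr : Indexes r)
    {S : ∀ γ, Fin (k + 1) → Fin (π γ).n} (hS : Indexes S) {v : ∀ γ, Fin (π γ).n}
    (hv : Indexes v) : Decides fun γ => Solvable (π γ).graph (r γ) (S γ) (v γ) := by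
  have hV := polyFam_domain hπ
  have hR : PolyBounded fun γ => (r γ : ℕ) :=
    .of_le hr (polyBounded_domain hπ) fun γ => (r γ).2.le
  refine Decides.iterateIn ((hV.tuple (k + 1)).prod hV) hR
    (fun γ r i => Solvable (π γ).graph r i.1 i.2)
    (fun γ _ t i => ∃ q, Replaceable (π γ).graph (fun S v => t (S, v)) i.1 i.2 q) ?_ ?_
    (fun _ _ => rfl) (Indexes.pair hV hS hv)
  · intro Δ _ ϖ r t i hϖ _ hi ht
    have hπ' : IsProjection fun δ => π (ϖ δ) := hπ.trans hϖ
    have hV' := polyFam_domain hπ'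
    refine Decides.exists (polyFam_position hπ') (decides_replaceable hπ'.base
      (fun {Δ'} _ ϖ' S v hϖ' hS hv => ?_) (hi.fst (hV'.tuple (k + 1)) hV').weaken
      (hi.snd (hV'.tuple (k + 1)) hV').weaken .top)
    exact ht (fun δ => (ϖ' δ).base) (fun δ => (S δ, v δ)) (IsProjection.id.base.trans hϖ')
      (Indexes.pair (hV'.comp (IsProjection.id.base.trans hϖ')) hS hv)
  · exact Decides.const False

theorem decides_firstReplacement (hπ : IsProjection π) {r : ∀ γ, Fin (π γ).n} (hr : Indexes r)
    {S : ∀ γ, Fin (k + 1) → Fin (π γ).n} (hS : Indexes S) {v : ∀ γ, Fin (π γ).n}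
    (hv : Indexes v) {q : ∀ γ, Fin (k + 1) × Fin (π γ).n} (hq : Indexes q) :
    Decides fun γ => FirstReplacement (π γ).graph (r γ) (S γ) (v γ) (q γ) := by
  refine (decides_replaceable hπ (fun ϖ S v hϖ hS hv =>
    decides_solvable (hπ.trans hϖ) (hr.comp hϖ) hS hv) hS hv hq).and
    (Decides.forall (polyFam_position hπ) ((Decides.lt Indexes.top hq.weaken).imp
      (decides_replaceable hπ.base (fun ϖ S v hϖ hS hv => ?_) hS.weaken hv.weaken .top).not))
  exact decides_solvable (hπ.base.trans hϖ) (hr.weaken.comp hϖ) hS hv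

end Graph

/-! ### Computing the weights -/

section Weights
variable {u b c d k : ℕ} {Γ : Type} [Ctx Γ] {π : Γ → Problem u b}

theorem computes_typeWeight (hπ : IsProjection π) (ψ : Formula u b) (s : Pred u b → Bool)
    {a : ∀ γ, Fin (π γ).n} (ha : Indexes a) :
    Computes fun γ => typeWeight ψ (π γ).unary (π γ).w (π γ).wbar (a γ) s := by
  classical
  refine Computes.ite ((Decides.const _).and (Decides.forallFinite fun p =>
    (decides_mem_unaryPreds hπ p).imp ((Decides.const _).iff (decides_unaryAtom hπ p ha))))
    (Computes.finsetProd _ fun p => ?_) (by simpa using Computes.int (Γ := Γ) 0)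
  exact Computes.ite (.const _) (computes_w hπ p) (computes_wbar hπ p)

theorem computes_tableWeight (hπ : IsProjection π) (ψ : Formula u b) (s t : Pred u b → Bool)
    {ev : Γ → Fin b × Fin 2 → Prop} (hev : ∀ q, Decides fun γ => ev γ q) :
    Computes fun γ => tableWeight ψ (π γ).binary.preds (ev γ) (π γ).w (π γ).wbar s t := by
  classical
  have h : ∀ β, Decides fun γ => TableSat ψ (π γ).binary.preds (ev γ) s t β := fun β =>
    (Decides.const _).and (Decides.forallFinite fun q => (decides_mem_binaryPreds hπ _).imp
      ((Decides.const _).iff (hev q)))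
  refine Computes.finsetSum _ fun β => Computes.ite (h β)
    (Computes.finsetProd _ fun q => ?_) (by simpa using Computes.int (Γ := Γ) 0)
  exact Computes.ite (.const _) (computes_w hπ _) (computes_wbar hπ _)

theorem computes_evidenceWeight (hπ : IsProjection π) (ψ : Formula u b)
    (typ : Fin c ≃ (Pred u b → Bool)) {x y : ∀ γ, Fin (π γ).n} (hx : Indexes x) (hy : Indexes y)
    {s t : Γ → Fin c} (hs : Indexes s) (ht : Indexes t) :
    Computes fun γ => evidenceWeight ψ (π γ).binary (π γ).w (π γ).wbar typ
      s((x γ, s γ), (y γ, t γ)) := by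
  refine Computes.cases hs (F := fun s γ => evidenceWeight ψ (π γ).binary (π γ).w (π γ).wbar typ
    s((x γ, s), (y γ, t γ))) fun s => ?_
  refine Computes.cases ht (F := fun t γ => evidenceWeight ψ (π γ).binary (π γ).w (π γ).wbar typ
    s((x γ, s), (y γ, t))) fun t => computes_tableWeight hπ ψ (typ s) (typ t) fun ⟨R, i⟩ => ?_
  fin_cases i
  · exact decides_binaryAtom hπ R hx hy
  · exact decides_binaryAtom hπ R hy hx

theorem computes_defaultWeight (hπ : IsProjection π) (ψ : Formula u b)
    (typ : Fin c ≃ (Pred u b → Bool)) (z : Sym2 (Fin c)) :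
    Computes fun γ => defaultWeight ψ (π γ).binary.preds (π γ).w (π γ).wbar typ z := by
  induction z with
  | _ s t => exact computes_tableWeight hπ ψ (typ s) (typ t) fun q => .const False

/-! ### Computing the partition function -/

/-- The exponents that occur are less than this bound. -/
abbrev Problem.exponentBound (I : Problem u b) : ℕ := I.n * I.n + 1

theorem polyBounded_exponentBound (hπ : IsProjection π) :
    PolyBounded fun γ => (π γ).exponentBound :=
  ((polyBounded_domain hπ).mul (polyBounded_domain hπ)).add (.const 1)

/-- The marked vertex weights of a problem instance. -/
noncomputable abbrev Problem.vertexWeight (I : Problem u b) (ψ : Formula u b)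
    (typ : Fin c ≃ (Pred u b → Bool)) (var : Fin c ⊕ Sym2 (Fin c) ≃ Fin d) :
    Fin I.n → Fin c → MvPolynomial (Fin d) ℝ :=
  markedVertexWeight var fun a s => typeWeight ψ I.unary I.w I.wbar a (typ s)

/-- The marked edge weights of a problem instance. -/
noncomputable abbrev Problem.edgeWeight (I : Problem u b) (ψ : Formula u b)
    (typ : Fin c ≃ (Pred u b → Bool)) (var : Fin c ⊕ Sym2 (Fin c) ≃ Fin d) :
    Sym2 (Fin I.n × Fin c) → MvPolynomial (Fin d) ℝ :=
  markedEdgeWeight var (evidenceWeight ψ I.binary I.w I.wbar typ)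

variable (ψ : Formula u b) (typ : Fin c ≃ (Pred u b → Bool)) (var : Fin c ⊕ Sym2 (Fin c) ≃ Fin d)

theorem computesPoly_vertexWeight (hπ : IsProjection π) {x : ∀ γ, Fin (π γ).n} (hx : Indexes x)
    {t : Γ → Fin c} (ht : Indexes t) : ComputesPoly (fun γ => (π γ).exponentBound)
      fun γ => (π γ).vertexWeight ψ typ var (x γ) (t γ) := by
  have hL := polyBounded_exponentBound hπ
  refine ComputesPoly.cases ht (F := fun t γ => (π γ).vertexWeight ψ typ var (x γ) t) fun t => ?_
  exact (ComputesPoly.C hL (computes_typeWeight hπ ψ (typ t) hx)).mul hL (.X hL (.const _))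

theorem computesPoly_edgeWeight (hπ : IsProjection π) {x y : ∀ γ, Fin (π γ).n} (hx : Indexes x)
    (hy : Indexes y) {s t : Γ → Fin c} (hs : Indexes s) (ht : Indexes t) :
    ComputesPoly (fun γ => (π γ).exponentBound)
      fun γ => (π γ).edgeWeight ψ typ var s((x γ, s γ), (y γ, t γ)) := by
  have hL := polyBounded_exponentBound hπ
  refine (ComputesPoly.C hL (computes_evidenceWeight hπ ψ typ hx hy hs ht)).mul hL (.X hL ?_)
  refine Computes.cases hs (F := fun s γ => Code.code (var (.inr s(s, t γ)))) fun s => ?_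
  exact Computes.cases ht (F := fun t γ => Code.code (var (.inr s(s, t)))) fun t => .nat _

theorem computesPoly_separatorWeight (hπ : IsProjection π)
    {S : ∀ γ, Fin (k + 1) → Fin (π γ).n} (hS : Indexes S) {σ : Γ → Fin (k + 1) → Fin c}
    (hσ : Indexes σ) {x : ∀ γ, Fin (π γ).n} (hx : Indexes x) {t : Γ → Fin c} (ht : Indexes t) :
    ComputesPoly (fun γ => (π γ).exponentBound) fun γ => separatorWeight (π γ).graph
      ((π γ).edgeWeight ψ typ var) (S γ) (σ γ) (x γ) (t γ) := by
  have hV := (polyFam_domain hπ).weaken (ι := fun _ => Fin (k + 1))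
  have hj : Indexes fun p : Ext Γ fun _ => Fin (k + 1) => S p.base p.top :=
    Indexes.applyVar hV hS.weaken .top
  have hL := polyBounded_exponentBound hπ
  have h : Decides fun p : Ext Γ fun _ => Fin (k + 1) =>
      (π p.base).graph.Adj (x p.base) (S p.base p.top) ∧
        ∀ j' < p.top, S p.base j' ≠ S p.base p.top :=
    (decides_adj hπ.base hx.weaken hj).and (Decides.forallFinite fun j' : Fin (k + 1) =>
      (Decides.lt (.nat j') .top).imp (Indexes.eq (hS.weaken.apply hV j') hj).not)
  classical
  refine ComputesPoly.prod hL (N := fun _ => k + 1) (.const _) (ComputesPoly.ite h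
    (computesPoly_edgeWeight ψ typ var hπ.base hx.weaken hj ht.weaken ?_)
    ((ComputesPoly.int hL.weaken 1).congr fun _ => Int.cast_one))
  exact Indexes.applyVar (PolyFam.fin (.const c)) hσ.weaken .top

theorem computesPoly_componentProduct (hπ : IsProjection π)
    {S : ∀ γ, Fin (k + 1) → Fin (π γ).n} (hS : Indexes S) {Y : ∀ γ, Fin (π γ).n → Prop}
    (hY : Decides fun p : Ext Γ fun γ => Fin (π γ).n => Y p.base p.top)
    {val : ∀ γ, Fin (π γ).n → MvPolynomial (Fin d) ℝ}
    (hval : ComputesPoly (fun p : Ext Γ fun γ => Fin (π γ).n => (π p.base).exponentBound)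
      fun p => val p.base p.top) :
    ComputesPoly (fun γ => (π γ).exponentBound)
      fun γ => componentProduct (π γ).graph (S γ) (Y γ) (val γ) := by
  have hL := polyBounded_exponentBound hπ
  classical
  refine ComputesPoly.prod hL (polyBounded_domain hπ) (ComputesPoly.ite
    (hY.and (Decides.forall (polyFam_domain hπ).weaken ((Decides.lt Indexes.top
      (Indexes.weaken Indexes.top)).imp (decides_inComp hπ.base.base hS.weaken.weaken
        Indexes.top.weaken .top).not)))
    hval ((ComputesPoly.int hL.weaken 1).congr fun _ => Int.cast_one))

theorem computesPoly_roundValue (hπ : IsProjection π)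
    {S : ∀ γ, Fin (k + 1) → Fin (π γ).n} (hS : Indexes S) {v : ∀ γ, Fin (π γ).n} (hv : Indexes v)
    {σ : Γ → Fin (k + 1) → Fin c} (hσ : Indexes σ) :
    ComputesPoly (fun γ => (π γ).exponentBound) fun γ => roundValue (π γ).graph
      ((π γ).vertexWeight ψ typ var) ((π γ).edgeWeight ψ typ var) (π γ).n (S γ, v γ, σ γ) := by
  have hV := polyFam_domain hπ
  have hL := polyBounded_exponentBound hπ
  have hc {Δ : Type} [Ctx Δ] : PolyFam fun _ : Δ => Fin c := PolyFam.fin (.const c)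
  have hσs {Δ : Type} [Ctx Δ] : PolyFam fun _ : Δ => Fin (k + 1) → Fin c := hc.tuple _
  classical
  refine ComputesPoly.iterate hL ((hV.tuple (k + 1)).prod (hV.prod hσs)) (polyBounded_domain hπ)
    (fun γ => roundValue (π γ).graph ((π γ).vertexWeight ψ typ var) ((π γ).edgeWeight ψ typ var))
    (fun γ r val i => ∑ q, if FirstReplacement (π γ).graph r i.1 i.2.1 q then
      ∑ t, (π γ).vertexWeight ψ typ var q.2 t *
        separatorWeight (π γ).graph ((π γ).edgeWeight ψ typ var) i.1 i.2.2 q.2 t *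
        componentProduct (π γ).graph (Function.update i.1 q.1 q.2)
          (fun y => InComp (π γ).graph (Set.range i.1) i.2.1 y ∧ y ≠ q.2)
          fun y => val (Function.update i.1 q.1 q.2, y, Function.update i.2.2 q.1 t)
      else 0) ?_ ((ComputesPoly.int hL.weaken 0).congr fun p => by simp [roundValue])
    (fun γ r => funext fun i => ?_) (Indexes.pair (hV.prod hσs) hS (Indexes.pair hσs hv hσ))
  · intro Δ _ ϖ r val i hϖ hr hi hval
    have hπ' : IsProjection fun δ => π (ϖ δ) := hπ.trans hϖ
    have hV' := polyFam_domain hπ'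
    have hL' := polyBounded_exponentBound hπ'
    have hS : Indexes fun δ => (i δ).1 := hi.fst (hV'.tuple (k + 1)) (hV'.prod hσs)
    have hvσ : Indexes fun δ => (i δ).2 := hi.snd (hV'.tuple (k + 1)) (hV'.prod hσs)
    have hv : Indexes fun δ => (i δ).2.1 := hvσ.fst hV' hσs
    have hσ : Indexes fun δ => (i δ).2.2 := hvσ.snd hV' hσs
    have hq1 : Indexes fun p : Ext Δ fun δ => Fin (k + 1) × Fin (π (ϖ δ)).n => p.top.1 :=
      Indexes.fst (PolyFam.fin (.const _)) hV'.weaken .top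
    have hq2 : Indexes fun p : Ext Δ fun δ => Fin (k + 1) × Fin (π (ϖ δ)).n => p.top.2 :=
      Indexes.snd (PolyFam.fin (.const (k + 1))) hV'.weaken .top
    have hSq : Indexes fun p : Ext Δ fun δ => Fin (k + 1) × Fin (π (ϖ δ)).n =>
        Function.update (i p.base).1 p.top.1 p.top.2 := hS.weaken.update hV'.weaken hq1 hq2
    refine ComputesPoly.sum (polyFam_position hπ') (ComputesPoly.ite
      (decides_firstReplacement hπ'.base hr.weaken hS.weaken hv.weaken .top)
      (ComputesPoly.sum hc ?_) ((ComputesPoly.int hL'.weaken 0).congr fun _ => Int.cast_zero))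
    refine ComputesPoly.mul hL'.weaken.weaken (ComputesPoly.mul hL'.weaken.weaken
      (computesPoly_vertexWeight ψ typ var hπ'.base.base hq2.weaken .top)
      (computesPoly_separatorWeight ψ typ var hπ'.base.base hS.weaken.weaken hσ.weaken.weaken
        hq2.weaken .top))
      (computesPoly_componentProduct hπ'.base.base hSq.weaken
        ((decides_inComp hπ'.base.base.base hS.weaken.weaken.weaken hv.weaken.weaken.weaken
          .top).and (Indexes.eq .top hq2.weaken.weaken).not) ?_)
    refine hval _ _ IsProjection.id.base.base.base (Indexes.pair
      (hV'.prod hσs).weaken.weaken.weaken hSq.weaken.weaken (Indexes.pair hσs .top ?_))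
    exact hσ.weaken.weaken.weaken.update hc hq1.weaken.weaken Indexes.top.weaken
  · obtain ⟨S, v, σ⟩ := i
    rw [roundValue]

end Weights

/-! ### Computing the model count -/

section Answer
variable {u b c d k : ℕ} {Γ : Type} [Ctx Γ] {π : Γ → Problem u b}
variable (ψ : Formula u b) (typ : Fin c ≃ (Pred u b → Bool)) (var : Fin c ⊕ Sym2 (Fin c) ≃ Fin d)

theorem polyBounded_choose_two {N : Γ → ℕ} (hN : PolyBounded N) :
    PolyBounded fun γ => (N γ).choose 2 := by
  refine .of_le ((Computes.natSum hN (F := fun _ i => i) .top).congr fun γ => ?_) (hN.mul hN)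
    fun γ => (Nat.choose_le_pow _ 2).trans (pow_two _).le
  rw [Fin.sum_univ_eq_sum_range fun i => i, Finset.sum_range_id, Nat.choose_two_right]

theorem polyBounded_pairCount {N : Γ → Fin c → ℕ} (hN : ∀ s, PolyBounded fun γ => N γ s)
    (z : Sym2 (Fin c)) : PolyBounded fun γ => pairCount (N γ) z := by
  induction z with | _ s t => ?_
  simp only [pairCount, Sym2.lift_mk]
  split_ifs with h
  · exact polyBounded_choose_two (hN s)
  · exact (hN s).mul (hN t)

theorem computes_remainingWeight {r : Γ → Sym2 (Fin c) → ℝ} (hr : ∀ z, Computes fun γ => r γ z)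
    {m : Γ → Fin d → ℕ} (hm : ∀ j, PolyBounded fun γ => m γ j) :
    Computes fun γ => remainingWeight var (r γ) (m γ) := by
  refine Computes.finsetProd _ fun z => (hr z).pow ?_
  have h := polyBounded_pairCount (fun s => hm (var (.inl s))) z
  exact .of_le (h.1.sub (hm _).1) h fun γ => Nat.sub_le _ _

theorem computesPoly_rootValue (hπ : IsProjection π) {x : ∀ γ, Fin (π γ).n} (hx : Indexes x) :
    ComputesPoly (fun γ => (π γ).exponentBound) fun γ => rootValue k ψ (π γ).unary (π γ).binary
      (π γ).w (π γ).wbar typ var (x γ) := by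
  have hL := polyBounded_exponentBound hπ
  have hV := polyFam_domain hπ
  have hc {Δ : Type} [Ctx Δ] : PolyFam fun _ : Δ => Fin c := PolyFam.fin (.const c)
  have hS : Indexes fun γ => (fun _ : Fin (k + 1) => x γ) := Indexes.tuple hV fun _ => hx
  refine ComputesPoly.sum hc (ComputesPoly.mul hL.weaken
    (computesPoly_vertexWeight ψ typ var hπ.base hx.weaken .top)
    (computesPoly_componentProduct hπ.base hS.weaken
      (Indexes.eq .top hx.weaken.weaken).not
      (computesPoly_roundValue ψ typ var hπ.base.base hS.weaken.weaken .top
        (Indexes.tuple hc fun _ => Indexes.top.weaken))))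

open Classical in
/-- The model count, in the form in which it is computed. The recursion over separators starts with
the least vertex. -/
noncomputable def Problem.count (I : Problem u b) (k : ℕ) : ℝ :=
  if I.n = 0 then 1 else ∑ m : Fin d → Fin I.exponentBound,
    (∑ x : Fin I.n, if (x : ℕ) = 0 then rootValue k ψ I.unary I.binary I.w I.wbar typ var x
      else 0).coeff (boxExponents m) *
        remainingWeight var (defaultWeight ψ I.binary.preds I.w I.wbar typ) fun j => m j

theorem Problem.count_eq_wfomc {φ : Formula u b} (hψ : ψ.IsQuantifierFree)
    (hφ : ∀ (n : ℕ) (ω : World u b n), φ.Models ω ↔ ψ.Models ω) (I : Problem u b)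
    (hk : TreewidthAtMost I.graph k) :
    I.count ψ typ var k = wfomc φ I.unary I.binary I.w I.wbar := by
  classical
  rw [Problem.count]
  split_ifs with hn
  · exact (wfomc_of_isEmpty hψ (hφ _) _ _ _ _ hn).symm
  · have h : ∀ x : Fin I.n, (x : ℕ) = 0 ↔ x = ⟨0, Nat.pos_of_ne_zero hn⟩ := fun x => by
      rw [Fin.ext_iff]
    rw [wfomc_eq_sum_coeff hψ (hφ _) I.unary I.binary I.w I.wbar typ var hk
      ⟨0, Nat.pos_of_ne_zero hn⟩]
    simp only [h, Finset.sum_ite_eq', Finset.mem_univ, if_true]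

theorem computes_count : Computes fun I : Problem u b => I.count ψ typ var k := by
  classical
  have hπ : IsProjection fun I : Problem u b => I := .id
  have hL := polyBounded_exponentBound hπ
  have hm : PolyFam fun I : Problem u b => Fin d → Fin I.exponentBound := (PolyFam.fin hL).tuple d
  refine Computes.ite (Decides.eq (polyBounded_domain hπ).1 (.nat 0))
    (by simpa using Computes.int (Γ := Problem u b) 1) (Computes.sum hm (Computes.mulReal ?_ ?_))
  · have h0 : Decides fun p : Ext (Problem u b) fun I => Fin I.n => (p.top : ℕ) = 0 :=
      Decides.eq .top (.nat 0)
    have hx : Indexes fun p : Ext (Problem u b) fun I => Fin I.n => p.top := .top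
    exact ComputesPoly.sum (F := fun (I : Problem u b) (x : Fin I.n) => if (x : ℕ) = 0 then
        rootValue k ψ I.unary I.binary I.w I.wbar typ var x else 0) (polyFam_domain hπ)
      (ComputesPoly.ite h0 (computesPoly_rootValue ψ typ var hπ.base hx)
        ((ComputesPoly.int hL.weaken 0).congr fun _ => Int.cast_zero))
  · exact computes_remainingWeight var (fun z => (computes_defaultWeight hπ ψ typ z).weaken)
      fun j => .of_le (Indexes.apply (PolyFam.fin hL).weaken .top j) hL.weaken fun p =>
        (p.top j).2.le

/-- A function of problem instances that can be computed within polynomial time is output by a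
program that leaves its value in the first cell. -/
theorem Computes.exists_outputsWithin {f : Problem u b → ℝ} (hf : Computes f) :
    ∃ (p : Prog) (T : Polynomial ℕ), ∀ I : Problem u b,
      OutputsWithin p I.unary I.binary I.w I.wbar (f I) (T.eval I.n) := by
  obtain ⟨m, h⟩ := hf
  -- the slot `0` stays free, and the slot `1` receives the value
  obtain ⟨P, T, hP⟩ := h (m + 2) 1 (fun _ => 0) (fun _ => one_pos) (by omega)
  refine ⟨.seq P (.seq (.vconst 0 0) (.vadd 0 0 1)), T + 2, fun I => ?_⟩
  obtain ⟨t, s, hexec, ht, hs⟩ := hP I State.zero trivial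
  refine ⟨_, _, .seq hexec (.seq (.vconst 0 0 s) (.vadd 0 0 1 _)), ?_, ?_⟩
  · rw [Polynomial.eval_add]
    have : Ctx.size I = I.n := rfl
    rw [this] at ht
    simpa using ht
  · have h1 : s.val 1 = f I := hs.1
    simp [State.setVal, h1]

end Answer

end WFOMC

theorem mainTheorem1 {u b : ℕ} (φ : WFOMC.Formula u b) (hφ : φ.IsUFO2) (k : ℕ) :
    ∃ (p : WFOMC.Prog) (T : Polynomial ℕ),
      ∀ (n : ℕ) (U : WFOMC.UnaryEvidence u b n) (E : WFOMC.BinaryEvidence u b n),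
        WFOMC.TreewidthAtMost E.gaifmanGraph k →
          ∀ w wbar : WFOMC.Pred u b → ℝ,
            WFOMC.OutputsWithin p U E w wbar (WFOMC.wfomc φ U E w wbar) (T.eval n) := by
  obtain ⟨ψ, hψ, h⟩ := hφ.2.exists_matrix
  let typ := (Fintype.equivFin (WFOMC.Pred u b → Bool)).symm
  let var := Fintype.equivFin (Fin (Fintype.card (WFOMC.Pred u b → Bool)) ⊕
    Sym2 (Fin (Fintype.card (WFOMC.Pred u b → Bool))))
  -- `typ` numbers the types, and `var` numbers the variables that mark types and pairs of types
  obtain ⟨p, T, hp⟩ := (WFOMC.computes_count (k := k) ψ typ var).exists_outputsWithin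
  refine ⟨p, T, fun n U E hk w wbar => ?_⟩
  have := hp ⟨n, U, E, w, wbar⟩
  rwa [WFOMC.Problem.count_eq_wfomc ψ typ var hψ h _ hk] at this
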